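/- **Proposition 3.** Let $M$ be a compact smooth manifold with an open cover $\{U_a\}$, let $\lambda$ be a Hermitian line bundle and $\xi$ a Hermitian vector bundle of rank $r\ge 1$ on $M$, both trivialized over every $U_a$, with unitary transition functions $g_{ab}$ and $h_{ab}$. *Supercharge.* Let $\mathcal F$ be the fermionic Fock space with orthonormal basis $u_{a_1}\wedge\dots\wedge u_{a_k}\wedge|0\rangle_{b_1,\dots,b_l}$ ($a_1>\dots>a_k\ge 0>b_1>\dots>b_l$), where $|0\rangle=u_{-1}\wedge u_{-2}\wedge\cdots$ and $|0\rangle_{b_1,\dots,b_l}$ is $|0\rangle$ with the $u_{b_j}$ removed. Let $N$ be the charge operator (equal to $k-l$ on this basis vector), $S$ the unitary shift induced by $u_i\mapsto u_{i+1}$, $e_0=N$ and $e_n=\sum_i a^*_{i+n}a_i$ for $n\ne 0$, where $a_i^*=u_i\wedge\cdot\,$; so $[e_n,e_m]=-n\,\delta_{n,-m}$, $Se_0S^{-1}=e_0-1$ and $Se_nS^{-1}=e_n$ for $n\neq 0$. Let $\mathcal S$ be the irreducible vacuum module, with vacuum $\eta$, of the Clifford algebra with generators $\psi_n=\psi_{-n}^*$,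 $n\in\mathbb Z$, and relations $\{\psi_n,\psi_m\}=2\delta_{n,-m}$, with $\psi_n\eta=0$ for $n<0$ and $\psi_0\eta=\eta$. Put $\mathcal H=\mathcal S\otimes\mathcal F\otimes\mathbb C^r$. For $x\in\mathbb R$ let $Q(x)$ be the closure of $$\sum_{k\in\mathbb Z}\psi_k\otimes e_{-k}\otimes 1+\frac{x}{2\pi}\,\psi_0\otimes 1\otimes 1$$ on the finite linear combinations of the basis vectors. *Gerbe.* Let $0<\delta\le 1$. Cover the circle $\mathbb T_\phi=\mathbb T\subset\mathbb C$ by the arcs $\mathbb T_\uparrow=\{\operatorname{Im}z>-\delta\}$ and $\mathbb T_\downarrow=\{\operatorname{Im}z<\delta\}$, with the angular coordinates $\phi_\uparrow\in(-\pi/2,3\pi/2)$ and $\phi_\downarrow\in(\pi/2,5\pi/2)$. The twist $\tau$ on $\mathbb T_\phi\times M$ is realized by the trivial Hilbert bundles with fibre $\mathcal H$ over the sets $\mathbb T_\sigma\times U_a$, $\sigma\in\{\uparrow,\downarrow\}$, and by the unitary transition functions $S^{c}\,(1\otimes g_{ab}^{N}\otimes h_{ab})$ from $(\sigma,a)$ to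 $(\sigma',b)$. Here $c=1$ for $(\sigma,\sigma')=(\downarrow,\uparrow)$ and $c=-1$ for $(\sigma,\sigma')=(\uparrow,\downarrow)$ over the points of $\mathbb T_\uparrow\cap\mathbb T_\downarrow$ with $\operatorname{Re}z>0$, and $c=0$ otherwise. They satisfy the cocycle condition up to phases that represent the cup product of the generator of $H^1(\mathbb T,\mathbb Z)$ and the class of $\lambda$. The pullback of this gerbe to $\mathbb T^2\times M=\mathbb T_s\times\mathbb T_\phi\times M$ is again denoted by $\tau$. *Twisted K-theory.* $\mathbf{Fred}^{(0)}$ is the space of pairs $(A,B)$ of bounded operators on $\mathcal H$ with $1-AB$ and $1-BA$ compact, in the topology that is strong in $A$ and $B$ and norm in $1-AB$ and $1-BA$. $K^0(\mathbb T^2\times M,\tau)$ is the set of homotopy classes of continuous sections of the bundle with fibre $\mathbf{Fred}^{(0)}$ that is glued by conjugation with the transition functions of $\tau$. *Claim.* Every $Q(x)$ is self-adjoint and so has a well-defined approximate sign $Q(x)(1+Q(x)^2)^{-1/2}$. Let $F_\sigma(z)$, $z\in\mathbb T_\sigma$, be the approximate sign of the supercharge $Q_\sigma(z)=Q(\phi_\sigma(z))$.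 Then the local families $$\mathrm{susp}(F_\sigma)(s,z,p)=\begin{cases}\cos s+i\sin s\,F_\sigma(z), & s\in[0,\pi],\\ \cos s+i\sin s, & s\in[\pi,2\pi],\end{cases}\qquad e^{is}\in\mathbb T_s,\ (z,p)\in\mathbb T_\sigma\times U_a,$$ define a class in $K^0(\mathbb T^2\times M,\tau)$: they are the operator components $A$ of a continuous section of the Fredholm bundle, and the homotopy class of that section does not depend on the choice of the parametrices $B$. -/

import Mathlib

open scoped ENNReal InnerProductSpace Manifold ContDiff TensorProduct

noncomputable section

namespace TwistedK

/-! ### Fredholm operators and twisted K-theory -/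

section General

variable {X Y ι : Type*} [TopologicalSpace X] [TopologicalSpace Y]
variable {H : Type*} [NormedAddCommGroup H] [InnerProductSpace ℂ H]

/-- A Fredholm operator `op` together with a parametrix `par`. -/
@[ext]
structure Fred0 (H : Type*) [NormedAddCommGroup H] [InnerProductSpace ℂ H] where
  op : H →L[ℂ] H
  par : H →L[ℂ] H
  compact_right : IsCompactOperator (1 - op * par : H →L[ℂ] H)
  compact_left : IsCompactOperator (1 - par * op : H →L[ℂ] H)

/-- `op` and `par` carry the strong operator topology (pointwise convergence), the compact
operators `1 - op * par` and `1 - par * op` carry the norm topology. -/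
instance Fred0.topology : TopologicalSpace (Fred0 H) :=
  TopologicalSpace.induced
    (fun T => ((fun v => T.op v, fun v => T.par v, 1 - T.op * T.par, 1 - T.par * T.op) :
      (H → H) × (H → H) × (H →L[ℂ] H) × (H →L[ℂ] H)))
    inferInstance

/-- A gerbe on `X`, realized by trivial local Hilbert bundles `U i × H` and by unitary local
isomorphisms `trans i j` from the `i`-th to the `j`-th of them, which satisfy the cocycle
condition up to `U(1)`-valued functions `phase i j k`. -/
structure Gerbe (X ι H : Type*) [TopologicalSpace X] [NormedAddCommGroup H]
    [InnerProductSpace ℂ H] where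
  U : ι → Set X
  isOpen_U : ∀ i, IsOpen (U i)
  cover : ∀ x, ∃ i, x ∈ U i
  trans : ι → ι → X → (H ≃ₗᵢ[ℂ] H)
  trans_continuousOn : ∀ i j v, ContinuousOn (fun x => trans i j x v) (U i ∩ U j)
  phase : ι → ι → ι → X → Circle
  phase_continuousOn : ∀ i j k, ContinuousOn (phase i j k) (U i ∩ U j ∩ U k)
  trans_comp : ∀ i j k x, x ∈ U i ∩ U j ∩ U k → ∀ v,
    trans j k x (trans i j x v) = (phase i j k x : ℂ) • trans i k x v

/-- Pullback of a gerbe along a continuous map. -/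
def Gerbe.pullback (G : Gerbe X ι H) (f : Y → X) (hf : Continuous f) : Gerbe Y ι H where
  U i := f ⁻¹' G.U i
  isOpen_U i := (G.isOpen_U i).preimage hf
  cover y := G.cover (f y)
  trans i j y := G.trans i j (f y)
  trans_continuousOn i j v :=
    (G.trans_continuousOn i j v).comp hf.continuousOn (fun _ h => h)
  phase i j k y := G.phase i j k (f y)
  phase_continuousOn i j k :=
    (G.phase_continuousOn i j k).comp hf.continuousOn (fun _ h => h)
  trans_comp i j k y hy v := G.trans_comp i j k (f y) hy v

/-- Continuous sections of the bundle of Fredholm operators associated with a gerbe: local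
continuous families of Fredholm operators that are intertwined by conjugation with the local
isomorphisms. -/
structure FredSection (G : Gerbe X ι H) where
  fam : ∀ i, G.U i → Fred0 H
  continuous_fam : ∀ i, Continuous (fam i)
  op_glue : ∀ i j x (hi : x ∈ G.U i) (hj : x ∈ G.U j) (v : H),
    (fam j ⟨x, hj⟩).op (G.trans i j x v) = G.trans i j x ((fam i ⟨x, hi⟩).op v)
  par_glue : ∀ i j x (hi : x ∈ G.U i) (hj : x ∈ G.U j) (v : H),
    (fam j ⟨x, hj⟩).par (G.trans i j x v) = G.trans i j x ((fam i ⟨x, hi⟩).par v)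

/-- Two sections are homotopic if they are the two ends of a section over `X × [0, 1]`. -/
def FredSection.Homotopic {G : Gerbe X ι H} (σ₀ σ₁ : FredSection G) : Prop :=
  ∃ hom : FredSection (G.pullback (Prod.fst : X × unitInterval → X) continuous_fst),
    (∀ i x (hx : x ∈ G.U i), hom.fam i ⟨(x, 0), hx⟩ = σ₀.fam i ⟨x, hx⟩) ∧
    (∀ i x (hx : x ∈ G.U i), hom.fam i ⟨(x, 1), hx⟩ = σ₁.fam i ⟨x, hx⟩)

/-- The even twisted K-theory `K⁰(X, τ)`, twisted by the gerbe `G`: homotopy classes of continuous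
sections of the bundle of Fredholm operators. -/
def K0 (G : Gerbe X ι H) : Type _ := Quot (FredSection.Homotopic (G := G))

/-- The class of a section. -/
def K0.mk {G : Gerbe X ι H} (σ : FredSection G) : K0 G := Quot.mk _ σ

/-- `F = Q (1 + Q²)^(-1/2)`: the operator `T` is the positive square root of `(1 + Q²)⁻¹`, and
`F = Q T`. -/
def IsApproxSign [CompleteSpace H] (Q : H →ₗ.[ℂ] H) (F : H →L[ℂ] H) : Prop :=
  ∃ T : H →L[ℂ] H, T.IsPositive ∧
    (∀ x, ∃ y, (T (T x), y) ∈ Q.graph ∧ (y, x - T (T x)) ∈ Q.graph) ∧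
    ∀ x, (T x, F x) ∈ Q.graph

open Classical in
/-- The approximate sign `Q (1 + Q²)^(-1/2)` (and `0` if there is no such operator). -/
def approxSign [CompleteSpace H] (Q : H →ₗ.[ℂ] H) : H →L[ℂ] H :=
  if h : ∃ F, IsApproxSign Q F then h.choose else 0

/-- The suspension loop of a bounded operator, at the parameter `s ∈ [0, 2π]`. -/
def susp (A : H →L[ℂ] H) (s : ℝ) : H →L[ℂ] H :=
  if s ≤ Real.pi then (Real.cos s : ℂ) • 1 + (Complex.I * Real.sin s) • A
  else (Real.cos s : ℂ) • 1 + (Complex.I * Real.sin s) • 1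

/-- Čech 1-cocycles for the family `U` with values in a topological group: transition functions
of a bundle with local trivializations over the sets `U a`. -/
structure CechCocycle {M I : Type*} [TopologicalSpace M] (U : I → Set M) (G : Type*)
    [Group G] [TopologicalSpace G] where
  g : I → I → M → G
  continuousOn_g : ∀ a b, ContinuousOn (g a b) (U a ∩ U b)
  comp : ∀ a b c x, x ∈ U a ∩ U b ∩ U c → g b c x * g a b x = g a c x

end General

/-! ### The Fock space -/

/-- A finite set `D` of integers labels the basis vector
`u_{a₁} ∧ … ∧ u_{aₖ} ∧ |0⟩_{b₁, …, bₗ}` of the Fock space, where the `aᵢ` are the non-negative and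
the `bⱼ` the negative elements of `D`. This says whether `u_i` occurs in that vector. -/
def Occ (D : Finset ℤ) (i : ℤ) : Prop := (0 ≤ i ∧ i ∈ D) ∨ (i < 0 ∧ i ∉ D)

/-- The sign of moving `u_i` past the `u_j` with `j > i` in the basis vector labelled by `D`. -/
def fockSign (D : Finset ℤ) (i : ℤ) : ℂ := (-1) ^ {j : ℤ | i < j ∧ Occ D j}.ncard

/-- Algebraic Fock space of finite particle states. -/
abbrev Fock₀ := Finset ℤ →₀ ℂ

open Classical in
/-- The creation operator `u_i ∧ ·`. -/
def create (i : ℤ) : Fock₀ →ₗ[ℂ] Fock₀ :=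
  Finsupp.linearCombination ℂ fun D =>
    if Occ D i then 0 else Finsupp.single (symmDiff D {i}) (fockSign D i)

open Classical in
/-- The annihilation operator, the adjoint of `create i`. -/
def annihilate (i : ℤ) : Fock₀ →ₗ[ℂ] Fock₀ :=
  Finsupp.linearCombination ℂ fun D =>
    if Occ D i then Finsupp.single (symmDiff D {i}) (fockSign D i) else 0

/-- The charge of a basis vector. -/
def charge (D : Finset ℤ) : ℤ :=
  ((D.filter fun i => 0 ≤ i).card : ℤ) - ((D.filter fun i => i < 0).card : ℤ)

/-- The generators `e_n = ∑ᵢ :a*_{i+n} a_i:` of the projective representation of the loop algebra;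
`e_0` is the charge operator. Each sum has only finitely many non-zero terms. -/
def loopGen (n : ℤ) : Fock₀ →ₗ[ℂ] Fock₀ :=
  Finsupp.linearCombination ℂ fun D =>
    if n = 0 then Finsupp.single D (charge D : ℂ)
    else ∑ᶠ i : ℤ, create (i + n) (annihilate i (Finsupp.single D 1))

/-- The shift `u_{i₁} ∧ u_{i₂} ∧ … ↦ u_{i₁+1} ∧ u_{i₂+1} ∧ …` on basis vectors. -/
def shift : Equiv.Perm (Finset ℤ) where
  toFun D := symmDiff (D.map (Equiv.addRight (1 : ℤ)).toEmbedding) {0}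
  invFun D := (symmDiff D {0}).map (Equiv.addRight (-1 : ℤ)).toEmbedding
  left_inv D := by
    ext i
    simp [symmDiff_symmDiff_cancel_right]
  right_inv D := by
    have : ((symmDiff D {0}).map (Equiv.addRight (-1 : ℤ)).toEmbedding).map
        (Equiv.addRight (1 : ℤ)).toEmbedding = symmDiff D {0} := by
      ext i
      simp
    simp only [this, symmDiff_symmDiff_cancel_right]

/-! ### The spinor module -/

/-- Algebraic spinor module. The finite set `A` labels the unit vector proportional to
`ψ_{m₁+1} ⋯ ψ_{mₖ+1} η`, where `m₁ > … > mₖ` are the elements of `A`. -/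
abbrev Spinor₀ := Finset ℕ →₀ ℂ

/-- The sign of moving `ψ_{±(m+1)}` past the generators with larger index. -/
def spinSign (A : Finset ℕ) (m : ℕ) : ℂ := (-1) ^ (A.filter fun j => m < j).card

/-- The Clifford generators `ψ_n`, subject to `ψ_n ψ_m + ψ_m ψ_n = 2 δ_{n,-m}`, in the vacuum
representation: `ψ_n η = 0` for `n < 0` and `ψ_0 η = η`. -/
def cliff : ℤ → (Spinor₀ →ₗ[ℂ] Spinor₀)
  | Int.ofNat 0 => Finsupp.linearCombination ℂ fun A => Finsupp.single A ((-1) ^ A.card)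
  | Int.ofNat (m + 1) => Finsupp.linearCombination ℂ fun A =>
      if m ∈ A then 0 else Finsupp.single (insert m A) ((Real.sqrt 2 : ℂ) * spinSign A m)
  | Int.negSucc m => Finsupp.linearCombination ℂ fun A =>
      if m ∈ A then Finsupp.single (A.erase m) ((Real.sqrt 2 : ℂ) * spinSign A m) else 0

/-! ### The supercharge -/

/-- Labels of the basis of the tensor product of the spinor module and the Fock space. -/
abbrev Idx := Finset ℕ × Finset ℤ

/-- The fibre of the vector bundle `ξ`. -/
abbrev Fib (r : ℕ) := EuclideanSpace ℂ (Fin r)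

/-- The Hilbert space tensor product of the spinor module, the Fock space and `ℂʳ`. -/
abbrev Hil (r : ℕ) := lp (fun _ : Idx => Fib r) 2

/-- The value of `∑ₖ ψ_k ⊗ e_{-k} + (x / 2π) ψ_0 ⊗ 1` on a basis vector. The sum has only finitely
many non-zero terms. -/
def superchargeVec (x : ℝ) (b : Idx) : Idx →₀ ℂ :=
  (∑ᶠ k : ℤ, finsuppTensorFinsupp' ℂ (Finset ℕ) (Finset ℤ)
    (cliff k (Finsupp.single b.1 1) ⊗ₜ[ℂ] loopGen (-k) (Finsupp.single b.2 1))) +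
  ((x / (2 * Real.pi) : ℝ) : ℂ) • finsuppTensorFinsupp' ℂ (Finset ℕ) (Finset ℤ)
    (cliff 0 (Finsupp.single b.1 1) ⊗ₜ[ℂ] Finsupp.single b.2 1)

/-- The inclusion of the finite particle states into the Hilbert space. -/
def incl (r : ℕ) : (Idx →₀ Fib r) →ₗ[ℂ] Hil r :=
  Finsupp.lsum ℂ fun b => lp.lsingle (𝕜 := ℂ) (E := fun _ : Idx => Fib r) 2 b

/-- `∑ₖ ψ_k ⊗ e_{-k} ⊗ 1 + (x / 2π) ψ_0 ⊗ 1 ⊗ 1` on the finite particle states. -/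
def superchargeAlg (r : ℕ) (x : ℝ) : (Idx →₀ Fib r) →ₗ[ℂ] (Idx →₀ Fib r) :=
  Finsupp.lsum ℂ fun b =>
    ∑ b' ∈ (superchargeVec x b).support,
      (superchargeVec x b b') • (Finsupp.lsingle b' : Fib r →ₗ[ℂ] (Idx →₀ Fib r))

theorem incl_apply (r : ℕ) (f : Idx →₀ Fib r) (b : Idx) : incl r f b = f b := by
  classical
  induction f using Finsupp.induction_linear with
  | zero => simp
  | add f g hf hg => simp [hf, hg]
  | single a v =>
    simp only [incl, Finsupp.lsum_single]
    change lp.single (E := fun _ : Idx => Fib r) 2 a v b = _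
    by_cases h : b = a
    · subst h; simp
    · rw [lp.single_apply_ne _ _ _ h, Finsupp.single_eq_of_ne h]

theorem incl_injective (r : ℕ) : Function.Injective (incl r) := by
  intro f g h
  ext1 b
  rw [← incl_apply, h, incl_apply]

/-- The supercharge with the dense domain of finite particle states. -/
def superchargeCore (r : ℕ) (x : ℝ) : Hil r →ₗ.[ℂ] Hil r where
  domain := LinearMap.range (incl r)
  toFun := (incl r ∘ₗ superchargeAlg r x) ∘ₗ
    (LinearEquiv.ofInjective (incl r) (incl_injective r)).symm.toLinearMap

/-- The supercharge at the angle `x`, as a closed operator. -/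
def supercharge (r : ℕ) (x : ℝ) : Hil r →ₗ.[ℂ] Hil r := (superchargeCore r x).closure

/-! ### The gerbe -/

/-- The two arcs of the circle. -/
inductive Side
  | up
  | down

/-- The upper arc `Im z > -δ` and the lower arc `Im z < δ`. -/
def arc (δ : ℝ) : Side → Set Circle
  | Side.up => {z | -δ < (z : ℂ).im}
  | Side.down => {z | (z : ℂ).im < δ}

/-- The angular coordinate `φ`, with values in `(-π/2, 3π/2]` for the upper and in `(π/2, 5π/2]`
for the lower arc. The two coordinates agree at `-1` and differ by `2π` at `1`. -/
def angle : Side → Circle → ℝ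
  | Side.up, z => Complex.arg (-Complex.I * z) + Real.pi / 2
  | Side.down, z => Complex.arg (Complex.I * z) + 3 * Real.pi / 2

/-- The integer cocycle that represents the generator of `H¹` of the circle: the power of the shift
in the transition from the arc `s` to the arc `t`. From the lower to the upper arc it is `1` on the
component of the overlap that contains `1`, and `0` on the one that contains `-1`. -/
def winding : Side → Side → Circle → ℤ
  | Side.down, Side.up, z => if 0 < (z : ℂ).re then 1 else 0
  | Side.up, Side.down, z => if 0 < (z : ℂ).re then -1 else 0
  | _, _, _ => 0

/-- Multiplication by a unit complex number. -/
def circleIso {E : Type*} [NormedAddCommGroup E] [NormedSpace ℂ E] (c : Circle) : E ≃ₗᵢ[ℂ] E where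
  toFun v := (c : ℂ) • v
  invFun v := ((c⁻¹ : Circle) : ℂ) • v
  map_add' := smul_add _
  map_smul' a v := smul_comm _ _ _
  left_inv v := by simp [smul_smul]
  right_inv v := by simp [smul_smul]
  norm_map' v := by
    change ‖(c : ℂ) • v‖ = ‖v‖
    rw [norm_smul, Circle.norm_coe, one_mul]

/-- The unitary operator on `ℓ²(β, E)` that maps the vector `v` at the place `b` to the vector
`L b v` at the place `π b`. -/
def lpIso {β E : Type*} [NormedAddCommGroup E] [InnerProductSpace ℂ E] (π : Equiv.Perm β)
    (L : β → (E ≃ₗᵢ[ℂ] E)) : lp (fun _ : β => E) 2 ≃ₗᵢ[ℂ] lp (fun _ : β => E) 2 where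
  toFun v := ⟨fun b => L (π.symm b) (v (π.symm b)), by
    have h := (memℓp_gen_iff (p := 2) (by simp)).1 v.2
    refine memℓp_gen ?_
    simpa [Function.comp_def] using π.symm.summable_iff.2 h⟩
  invFun v := ⟨fun b => (L b).symm (v (π b)), by
    have h := (memℓp_gen_iff (p := 2) (by simp)).1 v.2
    refine memℓp_gen ?_
    simpa [Function.comp_def] using π.summable_iff.2 h⟩
  map_add' v w := by ext b : 2; simp; rfl
  map_smul' a v := by ext b : 2; simp
  left_inv v := by ext b : 2; simp
  right_inv v := by ext b : 2; simp
  norm_map' v := by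
    rw [lp.norm_eq_tsum_rpow (by simp), lp.norm_eq_tsum_rpow (by simp)]
    congr 1
    simpa using π.symm.tsum_eq fun b => ‖v b‖ ^ (2 : ℝ≥0∞).toReal

theorem lpIso_single {β E : Type*} [DecidableEq β] [NormedAddCommGroup E] [InnerProductSpace ℂ E]
    (π : Equiv.Perm β) (L : β → (E ≃ₗᵢ[ℂ] E)) (b : β) (v : E) :
    lpIso π L (lp.single (E := fun _ : β => E) 2 b v) =
      lp.single (E := fun _ : β => E) 2 (π b) (L b v) := by
  ext c : 2
  change L (π.symm c) (lp.single (E := fun _ : β => E) 2 b v (π.symm c)) = _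
  by_cases h : c = π b
  · subst h; simp
  · have h' : π.symm c ≠ b := fun h' => h (by rw [← h', Equiv.apply_symm_apply])
    rw [lp.single_apply_ne _ _ _ h, lp.single_apply_ne _ _ _ h', map_zero]

/-- Strong continuity of a family of unitary operators can be checked on the vectors that are
concentrated at one place. -/
theorem continuousOn_of_single {X β E : Type*} [TopologicalSpace X] [DecidableEq β]
    [NormedAddCommGroup E] [InnerProductSpace ℂ E]
    (V : X → (lp (fun _ : β => E) 2 ≃ₗᵢ[ℂ] lp (fun _ : β => E) 2)) (W : Set X)
    (h : ∀ b v, ContinuousOn (fun x => V x (lp.single (E := fun _ : β => E) 2 b v)) W)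
    (f : lp (fun _ : β => E) 2) : ContinuousOn (fun x => V x f) W := by
  have hs := lp.hasSum_single (p := 2) (by simp) f
  have ht : TendstoUniformlyOn
      (fun (s : Finset β) x => V x (∑ b ∈ s, lp.single (E := fun _ : β => E) 2 b (f b)))
      (fun x => V x f) Filter.atTop W := by
    rw [Metric.tendstoUniformlyOn_iff]
    intro ε hε
    filter_upwards [(Metric.tendsto_nhds.1 hs) ε hε] with s hs x _
    rwa [LinearIsometryEquiv.dist_map, dist_comm]
  refine ht.continuousOn (Filter.Frequently.of_forall fun s => ?_)
  simp only [map_sum]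
  exact continuousOn_finsetSum _ fun b _ => h b _

theorem charge_shift (D : Finset ℤ) : charge (shift D) = charge D + 1 := by
  have hmem : ∀ i, i ∈ shift D ↔ ¬ (i - 1 ∈ D ↔ i = 0) := by
    intro i
    have : shift D = symmDiff (D.map (Equiv.addRight (1 : ℤ)).toEmbedding) {0} := rfl
    rw [this, Finset.mem_symmDiff]
    have h1 : i ∈ D.map (Equiv.addRight (1 : ℤ)).toEmbedding ↔ i - 1 ∈ D := by
      simp [sub_eq_add_neg]
    rw [h1, Finset.mem_singleton]
    tauto
  have key : ∀ (s : Finset ℤ), (s.map (Equiv.addRight (1 : ℤ)).toEmbedding).card = s.card :=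
    fun s => Finset.card_map _
  have hm : ∀ (s : Finset ℤ) i, i ∈ s.map (Equiv.addRight (1 : ℤ)).toEmbedding ↔ i - 1 ∈ s := by
    intro s i
    simp [sub_eq_add_neg]
  unfold charge
  by_cases h : (-1 : ℤ) ∈ D
  · have hp : (shift D).filter (fun i => 0 ≤ i) =
        (D.filter fun i => 0 ≤ i).map (Equiv.addRight (1 : ℤ)).toEmbedding := by
      ext i
      rw [hm, Finset.mem_filter, Finset.mem_filter, hmem]
      by_cases hi : i = 0
      · subst hi; simp [h]
      · simp only [hi, iff_false, not_not, and_congr_right_iff]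
        omega
    have hn : (D.filter fun i => i < 0).map (Equiv.addRight (1 : ℤ)).toEmbedding =
        insert 0 ((shift D).filter (fun i => i < 0)) := by
      ext i
      rw [hm, Finset.mem_insert, Finset.mem_filter, Finset.mem_filter, hmem]
      by_cases hi : i = 0
      · subst hi; simp [h]
      · simp only [hi, iff_false, not_not, false_or, and_congr_right_iff]
        omega
    rw [hp, key, ← key (D.filter fun i => i < 0), hn, Finset.card_insert_of_notMem (by simp)]
    push_cast
    ring
  · have hp : (shift D).filter (fun i => 0 ≤ i) =
        insert 0 ((D.filter fun i => 0 ≤ i).map (Equiv.addRight (1 : ℤ)).toEmbedding) := by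
      ext i
      rw [Finset.mem_insert, hm, Finset.mem_filter, Finset.mem_filter, hmem]
      by_cases hi : i = 0
      · subst hi; simp [h]
      · simp only [hi, iff_false, not_not, false_or, and_congr_right_iff]
        omega
    have hn : (shift D).filter (fun i => i < 0) =
        (D.filter fun i => i < 0).map (Equiv.addRight (1 : ℤ)).toEmbedding := by
      ext i
      rw [hm, Finset.mem_filter, Finset.mem_filter, hmem]
      by_cases hi : i = 0
      · subst hi; simp [h]
      · simp only [hi, iff_false, not_not, and_congr_right_iff]
        omega
    rw [hp, hn, key, Finset.card_insert_of_notMem (by rw [hm]; simp), key]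
    push_cast
    ring

theorem charge_shift_zpow (n : ℤ) (D : Finset ℤ) : charge ((shift ^ n) D) = charge D + n := by
  have hneg : ∀ D, charge (shift⁻¹ D) = charge D - 1 := fun D => by
    have := charge_shift (shift⁻¹ D)
    rw [← Equiv.Perm.mul_apply, mul_inv_cancel, Equiv.Perm.one_apply] at this
    omega
  induction n generalizing D with
  | zero => simp
  | succ n ih => rw [zpow_add_one, Equiv.Perm.mul_apply, ih, charge_shift]; omega
  | pred n ih => rw [zpow_sub_one, Equiv.Perm.mul_apply, ih, hneg]; omega

theorem winding_add (s t u : Side) (z : Circle) :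
    winding s t z + winding t u z = winding s u z := by
  cases s <;> cases t <;> cases u <;> simp only [winding] <;> (try split_ifs) <;> rfl

theorem winding_eventually {δ : ℝ} (hδ : δ ≤ 1) (s t : Side) (z₀ : Circle)
    (h : z₀ ∈ arc δ s ∩ arc δ t) : ∀ᶠ z in nhds z₀, winding s t z = winding s t z₀ := by
  have key : -δ < (z₀ : ℂ).im → (z₀ : ℂ).im < δ →
      ∀ᶠ z : Circle in nhds z₀, (0 < (z : ℂ).re ↔ 0 < (z₀ : ℂ).re) := by
    intro h1 h2
    have hn : (z₀ : ℂ).re * (z₀ : ℂ).re + (z₀ : ℂ).im * (z₀ : ℂ).im = 1 := by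
      rw [← Complex.normSq_apply, Circle.normSq_coe]
    have hc : Continuous fun z : Circle => (z : ℂ).re :=
      Complex.continuous_re.comp continuous_subtype_val
    have h0 : (z₀ : ℂ).re ≠ 0 := by
      intro h0
      rw [h0] at hn
      nlinarith
    rcases lt_or_gt_of_ne h0 with h0 | h0
    · filter_upwards [hc.continuousAt.eventually_lt continuousAt_const h0] with z hz
      exact ⟨fun h => absurd h hz.not_gt, fun h => absurd h h0.not_gt⟩
    · filter_upwards [continuousAt_const.eventually_lt hc.continuousAt h0] with z hz
      exact ⟨fun _ => h0, fun _ => hz⟩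
  cases s <;> cases t
  · simp [winding]
  · filter_upwards [key h.1 h.2] with z hz
    simp only [winding, hz]
  · filter_upwards [key h.2 h.1] with z hz
    simp only [winding, hz]
  · simp [winding]

/-- The transition operator `S^c (1 ⊗ g^N ⊗ h)` on the Hilbert space, where `S` is the shift and
`N` the charge. -/
def fockTrans (r : ℕ) (c : ℤ) (g : Circle) (h : unitary (Fib r →L[ℂ] Fib r)) :
    Hil r ≃ₗᵢ[ℂ] Hil r :=
  lpIso ((Equiv.refl (Finset ℕ)).prodCongr (shift ^ c)) fun b =>
    (Unitary.linearIsometryEquiv h).trans (circleIso (g ^ charge b.2))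

theorem fockTrans_single (r : ℕ) (c : ℤ) (g : Circle) (h : unitary (Fib r →L[ℂ] Fib r))
    (b : Idx) (v : Fib r) :
    fockTrans r c g h (lp.single (E := fun _ : Idx => Fib r) 2 b v) =
      lp.single (E := fun _ : Idx => Fib r) 2 (b.1, (shift ^ c) b.2)
        (((g ^ charge b.2 : Circle) : ℂ) • (h : Fib r →L[ℂ] Fib r) v) :=
  lpIso_single _ _ b v

theorem fockTrans_apply (r : ℕ) (c : ℤ) (g : Circle) (h : unitary (Fib r →L[ℂ] Fib r))
    (f : Hil r) (b : Idx) :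
    fockTrans r c g h f b = ((g ^ charge ((shift ^ c)⁻¹ b.2) : Circle) : ℂ) •
      (h : Fib r →L[ℂ] Fib r) (f (b.1, (shift ^ c)⁻¹ b.2)) :=
  rfl

theorem fockTrans_comp (r : ℕ) (c c' : ℤ) (g g' : Circle) (h h' : unitary (Fib r →L[ℂ] Fib r))
    (f : Hil r) : fockTrans r c' g' h' (fockTrans r c g h f) =
      ((g' ^ c : Circle) : ℂ) • fockTrans r (c + c') (g' * g) (h' * h) f := by
  ext b : 2
  have hb : (shift ^ (c + c'))⁻¹ b.2 = (shift ^ c)⁻¹ ((shift ^ c')⁻¹ b.2) := by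
    rw [← Equiv.Perm.mul_apply, ← mul_inv_rev, ← zpow_add, add_comm]
  have hc : charge ((shift ^ c')⁻¹ b.2) = charge ((shift ^ c)⁻¹ ((shift ^ c')⁻¹ b.2)) + c := by
    rw [← charge_shift_zpow c, ← Equiv.Perm.mul_apply, mul_inv_cancel, Equiv.Perm.one_apply]
  rw [fockTrans_apply, fockTrans_apply]
  change _ = ((g' ^ c : Circle) : ℂ) • fockTrans r (c + c') (g' * g) (h' * h) f b
  rw [fockTrans_apply, hb, hc, map_smul, smul_smul, smul_smul, ← Circle.coe_mul, ← Circle.coe_mul,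
    mul_zpow, zpow_add]
  rw [mul_assoc, mul_left_comm, mul_comm (g' ^ c)]
  rfl

/-- The gerbe of the local Hilbert bundles `S ⊗ F ⊗ ξ` over the products of the two arcs with the
sets `U a`. The line bundle `λ` and the vector bundle `ξ` on `M` are given by their transition
functions. The subspace of charge `k` is tensored with `λ^k`, and on the component of the overlap
of the arcs that contains `1`, the lower and the upper bundles are identified through the shift.
The phases represent the cup product of the generator of `H¹` of the circle with the class
of `λ`. -/
def fockGerbe {M I : Type*} [TopologicalSpace M] {r : ℕ} {U : I → Set M}
    (hU : ∀ a, IsOpen (U a)) (hcov : ∀ p, ∃ a, p ∈ U a)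
    (lam : CechCocycle U Circle) (xi : CechCocycle U (unitary (Fib r →L[ℂ] Fib r)))
    {δ : ℝ} (hδ₀ : 0 < δ) (hδ₁ : δ ≤ 1) : Gerbe (Circle × M) (Side × I) (Hil r) where
  U i := arc δ i.1 ×ˢ U i.2
  isOpen_U i := by
    refine IsOpen.prod ?_ (hU i.2)
    have hc : Continuous fun z : Circle => (z : ℂ).im :=
      Complex.continuous_im.comp continuous_subtype_val
    cases i.1
    · exact isOpen_lt continuous_const hc
    · exact isOpen_lt hc continuous_const
  cover x := by
    obtain ⟨a, ha⟩ := hcov x.2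
    by_cases h : -δ < (x.1 : ℂ).im
    · exact ⟨(Side.up, a), h, ha⟩
    · exact ⟨(Side.down, a), by change (x.1 : ℂ).im < δ; linarith, ha⟩
  trans i j x := fockTrans r (winding i.1 j.1 x.1) (lam.g i.2 j.2 x.2) (xi.g i.2 j.2 x.2)
  trans_continuousOn i j := by
    refine continuousOn_of_single _ _ fun b v => ?_
    intro x hx
    have hw := (continuous_fst.tendsto x).eventually
      (winding_eventually hδ₁ i.1 j.1 x.1 ⟨hx.1.1, hx.2.1⟩)
    have hg : ContinuousWithinAt (fun y : Circle × M => lam.g i.2 j.2 y.2)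
        (arc δ i.1 ×ˢ U i.2 ∩ arc δ j.1 ×ˢ U j.2) x :=
      ((lam.continuousOn_g i.2 j.2) x.2 ⟨hx.1.2, hx.2.2⟩).comp
        continuous_snd.continuousWithinAt fun y hy => ⟨hy.1.2, hy.2.2⟩
    have hh : ContinuousWithinAt (fun y : Circle × M => xi.g i.2 j.2 y.2)
        (arc δ i.1 ×ˢ U i.2 ∩ arc δ j.1 ×ˢ U j.2) x :=
      ((xi.continuousOn_g i.2 j.2) x.2 ⟨hx.1.2, hx.2.2⟩).comp
        continuous_snd.continuousWithinAt fun y hy => ⟨hy.1.2, hy.2.2⟩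
    have hmain : ContinuousWithinAt (fun y : Circle × M =>
        lp.single (E := fun _ : Idx => Fib r) 2 (b.1, (shift ^ winding i.1 j.1 x.1) b.2)
          (((lam.g i.2 j.2 y.2 ^ charge b.2 : Circle) : ℂ) •
            (xi.g i.2 j.2 y.2 : Fib r →L[ℂ] Fib r) v))
        (arc δ i.1 ×ˢ U i.2 ∩ arc δ j.1 ×ˢ U j.2) x := by
      refine (lp.isometry_single (E := fun _ : Idx => Fib r) _).continuous.continuousAt.comp_continuousWithinAt ?_
      have h1 : ContinuousWithinAt (fun y : Circle × M =>
          ((lam.g i.2 j.2 y.2 ^ charge b.2 : Circle) : ℂ))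
          (arc δ i.1 ×ˢ U i.2 ∩ arc δ j.1 ×ˢ U j.2) x :=
        ((show Continuous fun g : Circle => (g : ℂ) by fun_prop).comp
          (continuous_zpow (charge b.2))).continuousAt
          |>.comp_continuousWithinAt hg
      have h2 : ContinuousWithinAt (fun y : Circle × M =>
          (xi.g i.2 j.2 y.2 : Fib r →L[ℂ] Fib r) v)
          (arc δ i.1 ×ˢ U i.2 ∩ arc δ j.1 ×ˢ U j.2) x :=
        (continuous_subtype_val.continuousAt.comp_continuousWithinAt hh).clm_apply
          continuousWithinAt_const
      exact h1.smul h2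
    refine hmain.congr_of_eventuallyEq ?_ ?_
    · filter_upwards [nhdsWithin_le_nhds hw] with y hy
      rw [fockTrans_single, hy]
    · rw [fockTrans_single]
  phase i j k x := lam.g j.2 k.2 x.2 ^ winding i.1 j.1 x.1
  phase_continuousOn i j k := by
    intro x hx
    have hw := (continuous_fst.tendsto x).eventually
      (winding_eventually hδ₁ i.1 j.1 x.1 ⟨hx.1.1.1, hx.1.2.1⟩)
    have hg : ContinuousWithinAt (fun y : Circle × M => lam.g j.2 k.2 y.2)
        (arc δ i.1 ×ˢ U i.2 ∩ arc δ j.1 ×ˢ U j.2 ∩ arc δ k.1 ×ˢ U k.2) x :=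
      ((lam.continuousOn_g j.2 k.2) x.2 ⟨hx.1.2.2, hx.2.2⟩).comp
        continuous_snd.continuousWithinAt fun y hy => ⟨hy.1.2.2, hy.2.2⟩
    refine (hg.zpow (winding i.1 j.1 x.1)).congr_of_eventuallyEq ?_ rfl
    filter_upwards [nhdsWithin_le_nhds hw] with y hy
    rw [hy]
    rfl
  trans_comp i j k x hx v := by
    rw [fockTrans_comp, winding_add, lam.comp _ _ _ _ ⟨⟨hx.1.1.2, hx.1.2.2⟩, hx.2.2⟩,
      xi.comp _ _ _ _ ⟨⟨hx.1.1.2, hx.1.2.2⟩, hx.2.2⟩]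

end TwistedK

end

noncomputable section

namespace TwistedK

/-! ### Canonical anticommutation relations -/

/-! Everything rests on one computation: Q(x)² is diagonal in the basis of the Fock space and the
spinor module (`superchargeVec_sq`). In 2Q² the mixed terms cancel, because the ψ's anticommute
while the e's commute. What remains is (e_0 + x/2π)², a fermionic number operator, and the bosonic
sum ∑_{k>0} e_k e_{-k}. Expanded in creation and annihilation operators, the latter moves either two
particles, and such terms cancel in pairs, or one particle down to a free place and back. So it
counts inversions (`sum_loopGen_loopGen_neg`). The resulting eigenvalue `energy` has finite sublevel
sets (`finite_energy_le`).

Hence T = (1 + Q²)^(-1/2) is an explicit diagonal operator. By symmetry of Q, ‖QTf‖² = ‖f‖² - ‖Tf‖²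
on finite particle states, so F = QT extends to a contraction. F is symmetric, commutes with T,
satisfies F² = 1 - T², and all pairs (Tu, Fu) lie in the graph of the closure. This data alone
forces self-adjointness (`isSelfAdjoint_closure`) and identifies F as the unique approximate sign
(`isApproxSign_closure`, `isApproxSign_unique`).

For the section, F is strongly continuous in x, and 1 - F² = T² is compact and norm continuous,
since its eigenvalues are uniformly Lipschitz in x. The shift changes the charge by one, which is
the same as moving x by 2π; the factors g^N and h commute with Q because Q preserves the charge and
acts trivially on the fibre. So the transition functions intertwine the local families
(`boundedSupercharge_fockTrans`), the jump of the angle being 2π times the winding cocycle. The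
suspended loop A has the explicit parametrix B with 1 - AB = 1 - BA = max(sin s, 0)² T².

Finally, convex combinations of parametrices of one operator are again parametrices. Sections with
equal operator components are therefore homotopic (`FredSection.homotopic_of_op_eq`). -/

theorem occ_toggle (D : Finset ℤ) (m j : ℤ) :
    Occ (symmDiff D {m}) j ↔ (j = m ∧ ¬ Occ D j) ∨ (j ≠ m ∧ Occ D j) := by
  simp only [Occ, Finset.mem_symmDiff, Finset.mem_singleton]
  by_cases h : j = m <;> by_cases h0 : 0 ≤ j <;> by_cases hD : j ∈ D <;>
    simp_all

theorem occ_toggle_self (D : Finset ℤ) (m : ℤ) : Occ (symmDiff D {m}) m ↔ ¬ Occ D m := by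
  simp [occ_toggle]

theorem occ_toggle_of_ne (D : Finset ℤ) {m j : ℤ} (h : j ≠ m) :
    Occ (symmDiff D {m}) j ↔ Occ D j := by
  simp [occ_toggle, h]

/-- Above i there are only the particles in D and a finite piece of the sea. Without finiteness
`Set.ncard` would return 0 and `fockSign` would lose its meaning. -/
theorem finite_occ_gt (D : Finset ℤ) (i : ℤ) : {j : ℤ | i < j ∧ Occ D j}.Finite := by
  refine (D.finite_toSet.union (Set.finite_Ioo i 0)).subset ?_
  rintro j ⟨hij, ⟨_, h⟩ | ⟨h, _⟩⟩
  · exact Or.inl h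
  · exact Or.inr ⟨hij, h⟩

theorem fockSign_mul_self (D : Finset ℤ) (i : ℤ) : fockSign D i * fockSign D i = 1 := by
  rw [fockSign, ← mul_pow]; simp

/-- Toggling m changes the number of occupied places above i by one exactly when m lies above i.
Toggling is an involution, so the occupied case follows from the free one. -/
theorem fockSign_toggle (D : Finset ℤ) (m i : ℤ) :
    fockSign (symmDiff D {m}) i = if i < m then - fockSign D i else fockSign D i := by
  split_ifs with h
  · have key : ∀ D : Finset ℤ, ¬ Occ D m →
        {j : ℤ | i < j ∧ Occ (symmDiff D {m}) j} = insert m {j : ℤ | i < j ∧ Occ D j} := by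
      intro D hD
      ext j
      by_cases hj : j = m
      · subst hj; simp [h, occ_toggle_self, hD]
      · simp [hj, occ_toggle_of_ne D hj]
    have key2 : ∀ D : Finset ℤ, ¬ Occ D m → fockSign (symmDiff D {m}) i = - fockSign D i := by
      intro D hD
      rw [fockSign, key D hD, Set.ncard_insert_of_notMem (fun h => hD h.2) (finite_occ_gt D i),
        pow_succ, fockSign]
      ring
    by_cases hD : Occ D m
    · have := key2 (symmDiff D {m}) (by simp [occ_toggle_self, hD])
      rw [symmDiff_symmDiff_cancel_right] at this
      rw [this, neg_neg]
    · exact key2 D hD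
  · have : {j : ℤ | i < j ∧ Occ (symmDiff D {m}) j} = {j : ℤ | i < j ∧ Occ D j} := by
      ext j
      simp only [Set.mem_ofPred_eq, and_congr_right_iff]
      intro hj
      exact occ_toggle_of_ne D (by omega)
    rw [fockSign, this, fockSign]

open Classical in
theorem create_single (i : ℤ) (D : Finset ℤ) (c : ℂ) : create i (Finsupp.single D c) =
    if Occ D i then 0 else Finsupp.single (symmDiff D {i}) (c * fockSign D i) := by
  rw [create, Finsupp.linearCombination_single]
  split_ifs <;> simp

open Classical in
theorem annihilate_single (i : ℤ) (D : Finset ℤ) (c : ℂ) : annihilate i (Finsupp.single D c) =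
    if Occ D i then Finsupp.single (symmDiff D {i}) (c * fockSign D i) else 0 := by
  rw [annihilate, Finsupp.linearCombination_single]
  split_ifs <;> simp

/-- Linear maps on finitely supported functions agree if they agree on the basis. -/
theorem linearMap_ext_single {α W : Type*} [AddCommGroup W] [Module ℂ W] {f g : (α →₀ ℂ) →ₗ[ℂ] W}
    (h : ∀ a, f (Finsupp.single a 1) = g (Finsupp.single a 1)) : f = g := by
  refine Finsupp.lhom_ext' fun a => LinearMap.ext_ring ?_
  simpa using h a

theorem symmDiff_swap (D : Finset ℤ) (i j : ℤ) :
    symmDiff (symmDiff D {j}) {i} = symmDiff (symmDiff D {i}) {j} := by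
  rw [symmDiff_assoc, symmDiff_comm ({j} : Finset ℤ), ← symmDiff_assoc]

/-- The two toggles commute. Of the two signs only that of the lower index notices the other toggle,
which gives exactly one factor -1; the other two anticommutators work in the same way. -/
theorem create_anticomm (i j : ℤ) (v : Fock₀) :
    create i (create j v) = - create j (create i v) := by
  classical
  suffices create i ∘ₗ create j = - (create j ∘ₗ create i) by
    simpa using LinearMap.congr_fun this v
  refine linearMap_ext_single fun D => ?_
  simp only [LinearMap.comp_apply, LinearMap.neg_apply, create_single, apply_ite (create _), map_zero,
    occ_toggle, fockSign_toggle, symmDiff_swap D i j]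
  rcases lt_trichotomy i j with h | h | h
  · by_cases hi : Occ D i <;> by_cases hj : Occ D j <;>
      simp [hi, hj, h, h.ne, h.ne', h.not_gt, mul_comm (fockSign D i) (fockSign D j)]
  · subst h
    by_cases hi : Occ D i <;> simp [hi]
  · by_cases hi : Occ D i <;> by_cases hj : Occ D j <;>
      simp [hi, hj, h, h.ne, h.ne', h.not_gt, mul_comm (fockSign D i) (fockSign D j)]

theorem annihilate_anticomm (i j : ℤ) (v : Fock₀) :
    annihilate i (annihilate j v) = - annihilate j (annihilate i v) := by
  classical
  suffices annihilate i ∘ₗ annihilate j = - (annihilate j ∘ₗ annihilate i) by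
    simpa using LinearMap.congr_fun this v
  refine linearMap_ext_single fun D => ?_
  simp only [LinearMap.comp_apply, LinearMap.neg_apply, annihilate_single, apply_ite (annihilate _),
    map_zero, occ_toggle, fockSign_toggle, symmDiff_swap D i j]
  rcases lt_trichotomy i j with h | h | h
  · by_cases hi : Occ D i <;> by_cases hj : Occ D j <;>
      simp [hi, hj, h, h.ne, h.ne', h.not_gt, mul_comm (fockSign D i) (fockSign D j)]
  · subst h
    by_cases hi : Occ D i <;> simp [hi]
  · by_cases hi : Occ D i <;> by_cases hj : Occ D j <;>
      simp [hi, hj, h, h.ne, h.ne', h.not_gt, mul_comm (fockSign D i) (fockSign D j)]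

theorem annihilate_create (i j : ℤ) (v : Fock₀) :
    annihilate i (create j v) = (if i = j then v else 0) - create j (annihilate i v) := by
  classical
  suffices annihilate i ∘ₗ create j =
      (if i = j then LinearMap.id else 0) - (create j ∘ₗ annihilate i) by
    have := LinearMap.congr_fun this v
    split_ifs with h <;> simpa [h] using this
  refine linearMap_ext_single fun D => ?_
  simp only [LinearMap.comp_apply, LinearMap.sub_apply, annihilate_single, create_single,
    apply_ite (annihilate _), apply_ite (create _), map_zero, occ_toggle, fockSign_toggle,
    symmDiff_swap D i j]
  rcases lt_trichotomy i j with h | h | h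
  · by_cases hi : Occ D i <;> by_cases hj : Occ D j <;>
      simp [hi, hj, h, h.ne, h.ne', h.not_gt, mul_comm (fockSign D i) (fockSign D j)]
  · subst h
    by_cases hi : Occ D i <;> simp [hi, fockSign_mul_self]
  · by_cases hi : Occ D i <;> by_cases hj : Occ D j <;>
      simp [hi, hj, h, h.ne, h.ne', h.not_gt, mul_comm (fockSign D i) (fockSign D j)]

/-! ### The loop algebra -/

theorem occ_of_lt {D : Finset ℤ} {R : ℤ} (hR : 0 ≤ R) (hD : ∀ i ∈ D, |i| ≤ R) {i : ℤ} (h : i < -R) :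
    Occ D i := by
  refine Or.inr ⟨by omega, fun hi => ?_⟩
  have := abs_le.1 (hD i hi)
  omega

theorem le_of_occ {D : Finset ℤ} {R : ℤ} (hR : 0 ≤ R) (hD : ∀ i ∈ D, |i| ≤ R) {i : ℤ}
    (h : Occ D i) : i ≤ R := by
  rcases h with ⟨_, hi⟩ | ⟨hi, _⟩
  · exact (abs_le.1 (hD i hi)).2
  · omega

theorem exists_bound (D : Finset ℤ) : ∃ R : ℤ, 0 ≤ R ∧ ∀ i ∈ D, |i| ≤ R :=
  ⟨∑ i ∈ D, |i|, Finset.sum_nonneg fun _ _ => abs_nonneg _,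
    fun _ hi => Finset.single_le_sum (f := fun i : ℤ => |i|) (fun _ _ => abs_nonneg _) hi⟩

/-- A hopping term does not vanish only if it moves a particle to a free place. -/
theorem occ_of_hop_ne_zero {D : Finset ℤ} {i j : ℤ} (hij : j ≠ i)
    (h : create j (annihilate i (Finsupp.single D 1)) ≠ 0) : Occ D i ∧ ¬ Occ D j := by
  classical
  rw [annihilate_single] at h
  split_ifs at h with h1
  · rw [create_single, occ_toggle_of_ne D hij] at h
    split_ifs at h with h2
    · exact absurd rfl h
    · exact ⟨h1, h2⟩
  · simp at h

theorem hop_self (D : Finset ℤ) (i : ℤ) : open Classical in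
    create i (annihilate i (Finsupp.single D 1)) = (if Occ D i then 1 else 0 : ℂ) • Finsupp.single D 1 := by
  classical
  rw [annihilate_single]
  split_ifs with h
  · rw [create_single, if_neg (by simp [occ_toggle_self, h]), symmDiff_symmDiff_cancel_right,
      fockSign_toggle]
    simp [fockSign_mul_self]
  · simp

/-- High places are empty and deep places are full, so only hops near the Fermi level survive. This
keeps the `finsum` in `loopGen` from taking its default value. -/
theorem finite_hop_support {n : ℤ} (hn : n ≠ 0) (v : Fock₀) :
    {i : ℤ | create (i + n) (annihilate i v) ≠ 0}.Finite := by
  induction v using Finsupp.induction_linear with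
  | zero => simp
  | add f g hf hg =>
    refine (hf.union hg).subset fun i hi => ?_
    by_contra h
    simp only [Set.mem_union, Set.mem_ofPred_eq, not_or, not_not] at h
    exact hi (by rw [map_add, map_add, h.1, h.2, add_zero])
  | single D c =>
    obtain ⟨R, hR, hD⟩ := exists_bound D
    refine (Set.finite_Icc (-R - |n|) R).subset fun i hi => ?_
    have h : create (i + n) (annihilate i (Finsupp.single D 1)) ≠ 0 := by
      intro h0
      refine hi ?_
      rw [← mul_one c, ← smul_eq_mul, ← Finsupp.smul_single, map_smul, map_smul, h0, smul_zero]
    obtain ⟨h1, h2⟩ := occ_of_hop_ne_zero (by omega) h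
    refine ⟨?_, le_of_occ hR hD h1⟩
    by_contra h3
    exact h2 (occ_of_lt hR hD (by have := le_abs_self n; omega))

theorem loopGen_single_eq_finsum {n : ℤ} (hn : n ≠ 0) (D : Finset ℤ) :
    loopGen n (Finsupp.single D 1) = ∑ᶠ i : ℤ, create (i + n) (annihilate i (Finsupp.single D 1)) := by
  rw [loopGen, Finsupp.linearCombination_single, if_neg hn, one_smul]

theorem loopGen_zero_single (D : Finset ℤ) :
    loopGen 0 (Finsupp.single D 1) = (charge D : ℂ) • Finsupp.single D 1 := by
  simp [loopGen]

/-- The eventual form allows several such expansions, for different vectors and generators, to be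
truncated at one common finite set; the rest is then finite algebra. -/
theorem loopGen_eq_sum {n : ℤ} (hn : n ≠ 0) (v : Fock₀) :
    ∀ᶠ s : Finset ℤ in Filter.atTop,
      loopGen n v = ∑ i ∈ s, create (i + n) (annihilate i v) := by
  induction v using Finsupp.induction_linear with
  | zero => simp
  | add f g hf hg =>
    filter_upwards [hf, hg] with s h1 h2
    simp [h1, h2, Finset.sum_add_distrib]
  | single D c =>
    have hfin := finite_hop_support hn (Finsupp.single D 1)
    filter_upwards [Filter.eventually_ge_atTop hfin.toFinset] with s hs
    have h1 : loopGen n (Finsupp.single D 1) =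
        ∑ i ∈ s, create (i + n) (annihilate i (Finsupp.single D 1)) := by
      rw [loopGen_single_eq_finsum hn]
      refine finsum_eq_sum_of_support_subset _ fun i hi => ?_
      exact hs (hfin.mem_toFinset.2 hi)
    have h2 : (Finsupp.single D c : Fock₀) = c • Finsupp.single D 1 := by simp
    rw [h2, map_smul, h1, Finset.smul_sum]
    simp only [map_smul]

/-! ### Charge and the commutators of the loop generators -/

theorem charge_toggle_of_not_occ {D : Finset ℤ} {m : ℤ} (h : ¬ Occ D m) :
    charge (symmDiff D {m}) = charge D + 1 := by
  unfold charge
  rcases le_or_gt 0 m with hm | hm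
  · have hD : m ∉ D := fun h' => h (Or.inl ⟨hm, h'⟩)
    have h1 : (symmDiff D {m}).filter (fun i => 0 ≤ i) = insert m (D.filter fun i => 0 ≤ i) := by
      ext i
      simp only [Finset.mem_filter, Finset.mem_symmDiff, Finset.mem_singleton, Finset.mem_insert]
      by_cases hi : i = m
      · subst hi; simp [hD, hm]
      · simp [hi]
    have h2 : (symmDiff D {m}).filter (fun i => i < 0) = D.filter fun i => i < 0 := by
      ext i
      simp only [Finset.mem_filter, Finset.mem_symmDiff, Finset.mem_singleton]
      by_cases hi : i = m
      · subst hi; simp [hm]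
      · simp [hi]
    rw [h1, h2, Finset.card_insert_of_notMem (by simp [hD])]
    push_cast; ring
  · have hD : m ∈ D := by_contra fun h' => h (Or.inr ⟨hm, h'⟩)
    have h1 : (symmDiff D {m}).filter (fun i => 0 ≤ i) = D.filter fun i => 0 ≤ i := by
      ext i
      simp only [Finset.mem_filter, Finset.mem_symmDiff, Finset.mem_singleton]
      by_cases hi : i = m
      · subst hi; simp [hm]
      · simp [hi]
    have h2 : D.filter (fun i => i < 0) = insert m ((symmDiff D {m}).filter fun i => i < 0) := by
      ext i
      simp only [Finset.mem_filter, Finset.mem_symmDiff, Finset.mem_singleton, Finset.mem_insert]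
      by_cases hi : i = m
      · subst hi; simp [hD, hm]
      · simp [hi]
    rw [h1, h2, Finset.card_insert_of_notMem (by simp [hD, Finset.mem_symmDiff])]
    push_cast; ring

theorem charge_toggle_of_occ {D : Finset ℤ} {m : ℤ} (h : Occ D m) :
    charge (symmDiff D {m}) = charge D - 1 := by
  have := charge_toggle_of_not_occ (D := symmDiff D {m}) (m := m) (by simp [occ_toggle_self, h])
  rw [symmDiff_symmDiff_cancel_right] at this
  omega

theorem loopGen_zero_apply (v : Fock₀) (D : Finset ℤ) : loopGen 0 v D = charge D * v D := by
  classical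
  induction v using Finsupp.induction_linear with
  | zero => simp
  | add f g hf hg => simp [hf, hg, mul_add]
  | single a c =>
    have h2 : (Finsupp.single a c : Fock₀) = c • Finsupp.single a 1 := by simp
    rw [h2, map_smul, loopGen_zero_single]
    by_cases h : a = D
    · subst h; simp [mul_comm]
    · simp [h]

/-- In the commutator of `create m` with the hopping terms, only the hop starting at m survives. For
n = 0 the relation says that creation raises the charge by one. -/
theorem loopGen_create (n m : ℤ) (v : Fock₀) :
    loopGen n (create m v) = create m (loopGen n v) + create (m + n) v := by
  classical
  by_cases hn : n = 0
  · subst hn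
    suffices loopGen 0 ∘ₗ create m = create m ∘ₗ loopGen 0 + create m by
      simpa using LinearMap.congr_fun this v
    refine linearMap_ext_single fun D => ?_
    simp only [LinearMap.comp_apply, LinearMap.add_apply, loopGen_zero_single, map_smul]
    rw [create_single]
    split_ifs with h
    · simp
    · ext D'
      rw [loopGen_zero_apply]
      by_cases h' : symmDiff D {m} = D'
      · subst h'; simp [charge_toggle_of_not_occ h]; ring
      · simp [h']
  · obtain ⟨s, h1, h2, h3⟩ := ((loopGen_eq_sum hn (create m v)).and
      ((loopGen_eq_sum hn v).and (Filter.eventually_ge_atTop {m}))).exists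
    have hm : m ∈ s := h3 (by simp)
    rw [h1, h2, map_sum, ← sub_eq_iff_eq_add', ← Finset.sum_sub_distrib]
    rw [Finset.sum_eq_single_of_mem m hm]
    · rw [annihilate_create, if_pos rfl, map_sub, create_anticomm m (m + n)]; abel
    · intro i _ hi
      rw [annihilate_create, if_neg hi, map_sub, create_anticomm m (i + n)]
      simp

theorem loopGen_annihilate (n m : ℤ) (v : Fock₀) :
    loopGen n (annihilate m v) = annihilate m (loopGen n v) - annihilate (m - n) v := by
  classical
  by_cases hn : n = 0
  · subst hn
    suffices loopGen 0 ∘ₗ annihilate m = annihilate m ∘ₗ loopGen 0 - annihilate m by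
      simpa using LinearMap.congr_fun this v
    refine linearMap_ext_single fun D => ?_
    simp only [LinearMap.comp_apply, LinearMap.sub_apply, loopGen_zero_single, map_smul]
    rw [annihilate_single]
    split_ifs with h
    · ext D'
      rw [loopGen_zero_apply]
      by_cases h' : symmDiff D {m} = D'
      · subst h'; simp [charge_toggle_of_occ h]; ring
      · simp [h']
    · simp
  · obtain ⟨s, h1, h2, h3⟩ := ((loopGen_eq_sum hn (annihilate m v)).and
      ((loopGen_eq_sum hn v).and (Filter.eventually_ge_atTop {m - n}))).exists
    have hm : m - n ∈ s := h3 (by simp)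
    rw [h1, h2, map_sum, eq_sub_iff_add_eq, ← eq_sub_iff_add_eq', ← Finset.sum_sub_distrib]
    symm
    rw [Finset.sum_eq_single_of_mem (m - n) hm]
    · rw [annihilate_create, if_pos (by ring), annihilate_anticomm (m - n) m]; simp
    · intro i _ hi
      rw [annihilate_create, if_neg (by omega), annihilate_anticomm i m]
      simp

/-- The sum telescopes to the occupation at the top of the window, which is 0, minus that just below
its bottom, which is 1. This is the source of the central term. -/
theorem sum_occ_sub_occ_pred (D : Finset ℤ) (c : ℤ) : open Classical in
    ∀ᶠ R : ℕ in Filter.atTop, ∑ i ∈ Finset.Icc (-(R : ℤ)) R,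
      ((if Occ D (i - c) then 1 else 0 : ℂ) - (if Occ D (i - c - 1) then 1 else 0)) = -1 := by
  classical
  obtain ⟨B, hB, hD⟩ := exists_bound D
  -- All places above B are free and all below -B are occupied; the extra |c| keeps both ends of the
  -- window outside this range after the translation by c.
  filter_upwards [Filter.eventually_gt_atTop (B + |c|).toNat] with R hR
  have tele : ∀ (f : ℤ → ℂ) (a : ℤ) (k : ℕ), ∑ i ∈ Finset.Ico a (a + k), (f i - f (i - 1)) =
      f (a + k - 1) - f (a - 1) := by
    intro f a k
    induction k with
    | zero => simp
    | succ k ih =>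
      have : Finset.Ico a (a + (k + 1 : ℕ)) = insert (a + k) (Finset.Ico a (a + k)) := by
        ext i; simp; omega
      rw [this, Finset.sum_insert (by simp), ih]
      push_cast
      ring_nf
  have h := tele (fun i => if Occ D (i - c) then 1 else 0) (-(R : ℤ)) (2 * R + 1)
  have hI : Finset.Ico (-(R : ℤ)) (-(R : ℤ) + (2 * R + 1 : ℕ)) = Finset.Icc (-(R : ℤ)) R := by
    ext i; simp; omega
  rw [hI] at h
  have e : ∀ i : ℤ, i - c - 1 = i - 1 - c := fun i => by ring
  simp only [e]
  rw [h]
  have hc := abs_le.1 (le_refl |c|)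
  have h1 : ¬ Occ D (-(R : ℤ) + (2 * R + 1 : ℕ) - 1 - c) := by
    intro h1
    have := le_of_occ hB hD h1
    push_cast at this
    omega
  have h2 : Occ D (-(R : ℤ) - 1 - c) := occ_of_lt hB hD (by omega)
  rw [if_neg h1, if_pos h2, zero_sub]

theorem sum_occ_sub_occ (D : Finset ℤ) (n : ℕ) : open Classical in
    ∀ᶠ R : ℕ in Filter.atTop, ∑ i ∈ Finset.Icc (-(R : ℤ)) R,
      ((if Occ D i then 1 else 0 : ℂ) - (if Occ D (i - n) then 1 else 0)) = -n := by
  classical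
  induction n with
  | zero => simp
  | succ n ih =>
    filter_upwards [ih, sum_occ_sub_occ_pred D n] with R h1 h2
    have e : ∀ i : ℤ, i - (n + 1 : ℕ) = i - n - 1 := fun i => by push_cast; ring
    simp only [e]
    push_cast
    rw [neg_add, ← sub_eq_add_neg, sub_eq_add_neg, ← h1, ← h2, ← Finset.sum_add_distrib]
    exact Finset.sum_congr rfl fun i _ => by ring

theorem tendsto_Icc_atTop : Filter.Tendsto (fun R : ℕ => Finset.Icc (-(R : ℤ)) R)
    Filter.atTop Filter.atTop := by
  refine Filter.tendsto_atTop.2 fun s => ?_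
  obtain ⟨B, hB, hD⟩ := exists_bound s
  filter_upwards [Filter.eventually_ge_atTop B.toNat] with R hR i hi
  have := abs_le.1 (hD i hi)
  simp; omega

theorem tendsto_map_equiv_atTop (e : ℤ ≃ ℤ) :
    Filter.Tendsto (fun s : Finset ℤ => s.map e.toEmbedding) Filter.atTop Filter.atTop := by
  refine Filter.tendsto_atTop.2 fun s => ?_
  filter_upwards [Filter.eventually_ge_atTop (s.map e.symm.toEmbedding)] with t ht i hi
  exact Finset.mem_map.2 ⟨e.symm i, ht (Finset.mem_map.2 ⟨i, hi, rfl⟩), by simp⟩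

/-- Commuting e_n with the hop i → i + m gives the difference of two hopping terms of e_{n+m},
starting at i and at i - n. As n + m ≠ 0, each family is a finite sum equal to e_{n+m} on v, so the
two cancel. -/
theorem loopGen_comm_of_add_ne_zero {n m : ℤ} (hm : m ≠ 0) (h : n + m ≠ 0) (v : Fock₀) :
    loopGen n (loopGen m v) = loopGen m (loopGen n v) := by
  have hev := (tendsto_map_equiv_atTop (Equiv.addRight (-n))).eventually (loopGen_eq_sum h v)
  obtain ⟨s, h1, h2, h3, h4⟩ := ((loopGen_eq_sum hm v).and ((loopGen_eq_sum hm (loopGen n v)).and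
    ((loopGen_eq_sum h v).and hev))).exists
  rw [h1, h2, map_sum, ← sub_eq_zero, ← Finset.sum_sub_distrib]
  rw [Finset.sum_map] at h4
  have e : ∀ i ∈ s, loopGen n (create (i + m) (annihilate i v)) -
      create (i + m) (annihilate i (loopGen n v)) = create (i + (n + m)) (annihilate i v) -
      create (i - n + (n + m)) (annihilate (i - n) v) := by
    intro i _
    rw [loopGen_create, loopGen_annihilate, map_sub]
    rw [show i + m + n = i + (n + m) by ring, show i - n + (n + m) = i + m by ring]
    abel
  rw [Finset.sum_congr rfl e, Finset.sum_sub_distrib, ← h3, sub_eq_zero, h4]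
  rfl

/-- Here the two families of the generic case become the occupation numbers at i and at i - n.
Neither has a finite sum, but over a large symmetric window their difference is -n by
`sum_occ_sub_occ`. -/
theorem loopGen_comm_neg (n : ℕ) (v : Fock₀) :
    loopGen n (loopGen (-n) v) = loopGen (-n) (loopGen n v) - (n : ℂ) • v := by
  classical
  rcases Nat.eq_zero_or_pos n with rfl | hn
  · simp
  have hm : (-n : ℤ) ≠ 0 := by omega
  suffices loopGen n ∘ₗ loopGen (-n) = loopGen (-n) ∘ₗ loopGen n - (n : ℂ) • LinearMap.id by
    simpa using LinearMap.congr_fun this v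
  refine linearMap_ext_single fun D => ?_
  obtain ⟨R, h1, h2, h3⟩ := ((tendsto_Icc_atTop.eventually
    (loopGen_eq_sum hm (Finsupp.single D 1))).and ((tendsto_Icc_atTop.eventually
    (loopGen_eq_sum hm (loopGen n (Finsupp.single D 1)))).and (sum_occ_sub_occ D n))).exists
  simp only [LinearMap.comp_apply, LinearMap.sub_apply, LinearMap.smul_apply, LinearMap.id_apply]
  rw [h1, h2, map_sum, eq_sub_iff_add_eq, ← eq_sub_iff_add_eq', ← Finset.sum_sub_distrib]
  have e : ∀ i ∈ Finset.Icc (-(R : ℤ)) R,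
      create (i + -n) (annihilate i (loopGen n (Finsupp.single D 1))) -
      loopGen n (create (i + -n) (annihilate i (Finsupp.single D 1))) =
      -((((if Occ D i then 1 else 0 : ℂ) - (if Occ D (i - n) then 1 else 0))) •
        (Finsupp.single D 1)) := by
    intro i _
    rw [loopGen_create, loopGen_annihilate, map_sub, sub_smul, ← hop_self, ← hop_self]
    rw [show i + -(n : ℤ) + n = i by ring, show i + -(n : ℤ) = i - n by ring]
    abel
  rw [Finset.sum_congr rfl e, Finset.sum_neg_distrib, ← Finset.sum_smul, h3, neg_smul, neg_neg]

/-- The commutation relations `[e_n, e_m] = -n δ_{n,-m}`. -/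
theorem loopGen_comm (n m : ℤ) (v : Fock₀) : loopGen n (loopGen m v) =
    loopGen m (loopGen n v) - (if n + m = 0 then (n : ℂ) else 0) • v := by
  split_ifs with h
  · obtain rfl : m = -n := by omega
    rcases Int.eq_nat_or_neg n with ⟨k, rfl | rfl⟩
    · exact_mod_cast loopGen_comm_neg k v
    · have := loopGen_comm_neg k v
      rw [neg_neg, this]
      push_cast
      simp
  · rw [zero_smul, sub_zero]
    by_cases hm : m = 0
    · exact (loopGen_comm_of_add_ne_zero (by omega) (by omega) v).symm
    · exact loopGen_comm_of_add_ne_zero hm h v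

/-! ### The Sugawara formula -/

/-- The pairs of an occupied place and a free place below it. -/
def inversions (D : Finset ℤ) : Set (ℤ × ℤ) := {p | p.2 < p.1 ∧ Occ D p.1 ∧ ¬ Occ D p.2}

theorem inversions_subset {D : Finset ℤ} {R : ℤ} (hR : 0 ≤ R) (hD : ∀ i ∈ D, |i| ≤ R) :
    inversions D ⊆ Set.Icc (-R) R ×ˢ Set.Icc (-R) R := by
  rintro ⟨i, j⟩ ⟨h, hi, hj⟩
  have h1 := le_of_occ hR hD hi
  have h2 : -R ≤ j := by
    by_contra h2
    exact hj (occ_of_lt hR hD (by simpa using h2))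
  simp only at h
  exact ⟨⟨by simp only; omega, h1⟩, ⟨h2, by simp only; omega⟩⟩

theorem finite_inversions (D : Finset ℤ) : (inversions D).Finite := by
  obtain ⟨R, hR, hD⟩ := exists_bound D
  exact ((Set.finite_Icc _ _).prod (Set.finite_Icc _ _)).subset (inversions_subset hR hD)

/-- Exchanging the targets of two hopping particles exchanges two creation operators, hence the
sign; `double_hop_swap'` exchanges the sources instead. -/
theorem double_hop_swap {i j i' j' : ℤ} (h : j ≠ i') (h' : j ≠ j') (v : Fock₀) :
    create j' (annihilate j (create i' (annihilate i v))) =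
      - create i' (annihilate j (create j' (annihilate i v))) := by
  rw [annihilate_create, if_neg h, annihilate_create, if_neg h', zero_sub, zero_sub, map_neg,
    map_neg, create_anticomm]

theorem double_hop_swap' {i j i' j' : ℤ} (h : j ≠ i') (h' : i ≠ i') (v : Fock₀) :
    create j' (annihilate j (create i' (annihilate i v))) =
      - create j' (annihilate i (create i' (annihilate j v))) := by
  rw [annihilate_create, if_neg h, annihilate_create, if_neg h', zero_sub, zero_sub, map_neg,
    map_neg, annihilate_anticomm i j, map_neg, map_neg, neg_neg]

/-- The double hopping terms that move two different particles cancel in pairs. -/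
theorem sum_double_hop_eq_zero (D : Finset ℤ) {B R K : ℤ} (hB : 0 ≤ B) (hD : ∀ i ∈ D, |i| ≤ B)
    (hBR : B ≤ R) (hK : 2 * R ≤ K) :
    ∑ t ∈ (Finset.Icc 1 K ×ˢ Finset.Icc (-R) R ×ˢ Finset.Icc (-R) R).filter
        (fun t : ℤ × ℤ × ℤ => t.2.1 ≠ t.2.2 - t.1),
      create (t.2.1 + t.1) (annihilate t.2.1 (create (t.2.2 - t.1)
        (annihilate t.2.2 (Finsupp.single D 1)))) = 0 := by
  classical
  set f : ℤ × ℤ × ℤ → Fock₀ := fun t => create (t.2.1 + t.1) (annihilate t.2.1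
    (create (t.2.2 - t.1) (annihilate t.2.2 (Finsupp.single D 1)))) with hf
  -- A triple (k, j, i) stands for the hops i → i - k and j → j + k. If j + k < i, exchange the
  -- targets, otherwise the sources. The new step is |i - j - k|, which is positive because the
  -- filter excludes j = i - k.
  set g : ℤ × ℤ × ℤ → ℤ × ℤ × ℤ := fun t => if t.2.1 + t.1 < t.2.2 then
    (t.2.2 - t.2.1 - t.1, t.2.1, t.2.2) else (t.2.1 - t.2.2 + t.1, t.2.2, t.2.1) with hg
  have hfg : ∀ t : ℤ × ℤ × ℤ, 1 ≤ t.1 → t.2.1 ≠ t.2.2 - t.1 → f t + f (g t) = 0 := by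
    rintro ⟨k, j, i⟩ hk hne
    simp only at hk hne
    simp only [hf, hg]
    split_ifs with h
    · simp only
      rw [show i - (i - j - k) = j + k by ring, show j + (i - j - k) = i - k by ring,
        double_hop_swap hne (by omega), neg_add_cancel]
    · simp only
      rw [show j - (j - i + k) = i - k by ring, show i + (j - i + k) = j + k by ring,
        double_hop_swap' hne (by omega), neg_add_cancel]
  rw [← Finset.sum_filter_ne_zero]
  refine Finset.sum_involution (fun t _ => g t) ?_ ?_ ?_ ?_
  · rintro t ht
    simp only [Finset.mem_filter, Finset.mem_product, Finset.mem_Icc] at ht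
    exact hfg t ht.1.1.1.1 ht.1.2
  · rintro ⟨k, j, i⟩ ht hne heq
    simp only [Finset.mem_filter, Finset.mem_product, Finset.mem_Icc] at ht
    obtain ⟨⟨⟨hk, hj, hi⟩, hij⟩, -⟩ := ht
    -- At a fixed point of the involution the swapped term is the term itself, so it equals its own
    -- negative and vanishes.
    simp only [hg] at heq
    refine hne ?_
    split_ifs at heq with h
    · simp only [Prod.mk.injEq] at heq
      have hs := double_hop_swap (i := i) (j := j) (i' := i - k) (j' := j + k) hij (by omega)
        (Finsupp.single D 1)
      rw [show j + k = i - k by omega] at hs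
      simp only
      rw [show j + k = i - k by omega]
      exact self_eq_neg.1 hs
    · simp only [Prod.mk.injEq] at heq
      have hs := double_hop_swap' (i := i) (j := j) (i' := i - k) (j' := j + k) hij (by omega)
        (Finsupp.single D 1)
      rw [show j = i by omega] at hs
      simp only
      rw [show j = i by omega]
      exact self_eq_neg.1 hs
  · rintro t ht
    have ht' := ht
    simp only [Finset.mem_filter, Finset.mem_product, Finset.mem_Icc] at ht
    have hne : f (g t) ≠ 0 := by
      intro h0
      have := hfg t ht.1.1.1.1 ht.1.2
      rw [h0, add_zero] at this
      exact ht.2 this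
    refine Finset.mem_filter.2 ⟨?_, hne⟩
    obtain ⟨k, j, i⟩ := t
    simp only at ht
    obtain ⟨⟨⟨hk, hj, hi⟩, hij⟩, h0⟩ := ht
    -- A nonzero term lands on a free place, so i - k ≥ -B. This bounds the new step j - (i - k) by
    -- R + B ≤ K and keeps the involution inside the index set.
    have h1 : create (i - k) (annihilate i (Finsupp.single D 1)) ≠ 0 := by
      intro h1
      rw [h1, map_zero, map_zero] at h0
      exact h0 rfl
    have h2 := (occ_of_hop_ne_zero (by omega) h1).2
    have h3 : -B ≤ i - k := by
      by_contra h3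
      exact h2 (occ_of_lt hB hD (by omega))
    simp only [Finset.mem_filter, Finset.mem_product, Finset.mem_Icc, hg]
    split_ifs with h <;> simp only <;> omega
  · rintro ⟨k, j, i⟩ ht
    simp only [Finset.mem_filter, Finset.mem_product, Finset.mem_Icc] at ht
    obtain ⟨⟨⟨hk, hj, hi⟩, hij⟩, -⟩ := ht
    by_cases h : j + k < i
    · have h1 : g (k, j, i) = (i - j - k, j, i) := by simp only [hg, if_pos h]
      have h2 : j + (i - j - k) < i := by omega
      rw [h1]
      simp only [hg, if_pos h2]
      exact Prod.ext (by simp only; omega) rfl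
    · have h1 : g (k, j, i) = (j - i + k, i, j) := by simp only [hg, if_neg h]
      have h2 : ¬ i + (j - i + k) < j := by omega
      rw [h1]
      simp only [hg, if_neg h2]
      exact Prod.ext (by simp only; omega) rfl

/-- One particle hops from i to i - k and back. The term is the identity if i is occupied and i - k
free, and zero otherwise, so every inversion contributes exactly one; the window is large enough to
contain them all. -/
theorem sum_single_hop (D : Finset ℤ) {B R K : ℤ} (hB : 0 ≤ B) (hD : ∀ i ∈ D, |i| ≤ B)
    (hBR : B ≤ R) (hK : 2 * R ≤ K) :
    ∑ t ∈ (Finset.Icc 1 K ×ˢ Finset.Icc (-R) R ×ˢ Finset.Icc (-R) R).filter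
        (fun t : ℤ × ℤ × ℤ => t.2.1 = t.2.2 - t.1),
      create (t.2.1 + t.1) (annihilate t.2.1 (create (t.2.2 - t.1)
        (annihilate t.2.2 (Finsupp.single D 1)))) =
      ((inversions D).ncard : ℂ) • Finsupp.single D 1 := by
  classical
  have hterm : ∀ t ∈ (Finset.Icc 1 K ×ˢ Finset.Icc (-R) R ×ˢ Finset.Icc (-R) R).filter
        (fun t : ℤ × ℤ × ℤ => t.2.1 = t.2.2 - t.1),
      create (t.2.1 + t.1) (annihilate t.2.1 (create (t.2.2 - t.1)
        (annihilate t.2.2 (Finsupp.single D 1)))) =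
        if (t.2.2, t.2.1) ∈ inversions D then Finsupp.single D 1 else 0 := by
    rintro ⟨k, j, i⟩ ht
    simp only [Finset.mem_filter, Finset.mem_product, Finset.mem_Icc] at ht
    obtain ⟨⟨hk, hj, hi⟩, rfl⟩ := ht
    simp only [sub_add_cancel]
    by_cases h2 : Occ D (i - k)
    · have h3 : create (i - k) (annihilate i (Finsupp.single D 1)) = 0 := by
        by_contra h3
        exact (occ_of_hop_ne_zero (by omega) h3).2 h2
      simp [h3, h2, inversions]
    · have h3 : annihilate (i - k) (annihilate i (Finsupp.single D 1)) = (0 : Fock₀) := by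
        rw [annihilate_anticomm, annihilate_single (i - k), if_neg h2, map_zero, neg_zero]
      rw [annihilate_create, if_pos rfl, map_sub, hop_self, h3]
      have : i - k < i := by omega
      by_cases h1 : Occ D i <;> simp [h1, h2, this, inversions]
  rw [Finset.sum_congr rfl hterm, ← Finset.sum_filter, Finset.sum_const, ← Nat.cast_smul_eq_nsmul ℂ]
  congr 2
  rw [← Set.ncard_coe_finset]
  refine Set.ncard_congr (fun t _ => (t.2.2, t.2.1)) ?_ ?_ ?_
  · rintro t ht
    simp only [Finset.coe_filter, Set.mem_ofPred_eq] at ht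
    exact ht.2
  · rintro ⟨k, j, i⟩ ⟨k', j', i'⟩ ht ht' h
    simp only [Finset.coe_filter, Set.mem_ofPred_eq, Finset.mem_filter] at ht ht'
    simp only [Prod.mk.injEq] at h ⊢
    omega
  · rintro ⟨i, j⟩ hp
    have h1 := inversions_subset hB hD hp
    simp only [Set.mem_prod, Set.mem_Icc] at h1
    have h2 := hp.1
    simp only at h2
    refine ⟨(i - j, j, i), ?_, rfl⟩
    simp only [Finset.coe_filter, Set.mem_ofPred_eq, Finset.mem_filter, Finset.mem_product, Finset.mem_Icc]
    refine ⟨⟨?_, by omega⟩, hp⟩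
    omega

theorem hop_neg_eq_zero {D : Finset ℤ} {B : ℤ} (hB : 0 ≤ B) (hD : ∀ i ∈ D, |i| ≤ B) {k : ℤ}
    (hk : 2 * B < k) (i : ℤ) : create (i + -k) (annihilate i (Finsupp.single D 1)) = 0 := by
  by_contra h
  have := occ_of_hop_ne_zero (by omega) h
  have := inversions_subset hB hD (show (i, i + -k) ∈ inversions D from
    ⟨by simp only; omega, this⟩)
  simp only [Set.mem_prod, Set.mem_Icc] at this
  omega

theorem loopGen_neg_eq_zero {D : Finset ℤ} {B : ℤ} (hB : 0 ≤ B) (hD : ∀ i ∈ D, |i| ≤ B) {k : ℤ}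
    (hk : 2 * B < k) : loopGen (-k) (Finsupp.single D 1) = 0 := by
  rw [loopGen_single_eq_finsum (by omega)]
  simp [hop_neg_eq_zero hB hD hk]

/-- The Sugawara formula: `∑_{k > 0} e_k e_{-k}` is diagonal in the fermionic basis. -/
theorem sum_loopGen_loopGen_neg (D : Finset ℤ) :
    ∀ᶠ K : ℕ in Filter.atTop,
      ∑ k ∈ Finset.Icc 1 (K : ℤ), loopGen k (loopGen (-k) (Finsupp.single D 1)) =
        ((inversions D).ncard : ℂ) • Finsupp.single D 1 := by
  classical
  obtain ⟨B, hB, hD⟩ := exists_bound D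
  -- For k > 2 * B no particle can hop down by k. So only finitely many k matter and one truncation
  -- serves them all.
  have hex : ∀ᶠ s : Finset ℤ in Filter.atTop, ∀ k ∈ Finset.Icc 1 (2 * B),
      loopGen (-k) (Finsupp.single D 1) = ∑ i ∈ s, create (i + -k) (annihilate i (Finsupp.single D 1)) ∧
      loopGen k (loopGen (-k) (Finsupp.single D 1)) =
        ∑ j ∈ s, create (j + k) (annihilate j (loopGen (-k) (Finsupp.single D 1))) := by
    rw [Filter.eventually_all_finset]
    intro k hk
    rw [Finset.mem_Icc] at hk
    exact (loopGen_eq_sum (by omega) _).and (loopGen_eq_sum (by omega) _)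
  obtain ⟨R, hR, hBR⟩ := ((tendsto_Icc_atTop.eventually hex).and
    (Filter.eventually_ge_atTop B.toNat)).exists
  have hR' : B ≤ R := by omega
  have main : ∀ k : ℤ, 1 ≤ k → loopGen k (loopGen (-k) (Finsupp.single D 1)) =
      ∑ j ∈ Finset.Icc (-(R : ℤ)) R, ∑ i ∈ Finset.Icc (-(R : ℤ)) R,
        create (j + k) (annihilate j (create (i - k) (annihilate i (Finsupp.single D 1)))) := by
    intro k hk
    by_cases h : k ≤ 2 * B
    · obtain ⟨h1, h2⟩ := hR k (Finset.mem_Icc.2 ⟨hk, h⟩)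
      rw [h2, h1]
      simp only [map_sum, sub_eq_add_neg]
    · push Not at h
      rw [loopGen_neg_eq_zero hB hD h, map_zero]
      symm
      refine Finset.sum_eq_zero fun j _ => Finset.sum_eq_zero fun i _ => ?_
      rw [sub_eq_add_neg, hop_neg_eq_zero hB hD h, map_zero, map_zero]
  filter_upwards [Filter.eventually_ge_atTop (2 * R)] with K hK
  rw [Finset.sum_congr rfl fun k hk => main k (Finset.mem_Icc.1 hk).1]
  simp only [← Finset.sum_product']
  rw [← Finset.sum_filter_add_sum_filter_not _ (fun t : ℤ × ℤ × ℤ => t.2.1 = t.2.2 - t.1),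
    sum_single_hop D hB hD hR' (by omega), sum_double_hop_eq_zero D hB hD hR' (by omega), add_zero]

/-- There are only finitely many states with bounded charge and boundedly many inversions. -/
theorem finite_charge_inversions (C : ℕ) :
    {D : Finset ℤ | |charge D| ≤ C ∧ (inversions D).ncard ≤ C}.Finite := by
  classical
  refine (Finset.finite_toSet (Finset.Icc (-(3 * C + 3 : ℤ)) (3 * C + 3)).powerset).subset ?_
  rintro D ⟨hc, hi⟩
  have hc' := abs_le.1 hc
  have hcharge : charge D = ((D.filter fun i => 0 ≤ i).card : ℤ) - ((D.filter fun i => i < 0).card : ℤ) :=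
    rfl
  refine Finset.mem_coe.2 (Finset.mem_powerset.2 fun x hx => ?_)
  rw [Finset.mem_Icc]
  rcases le_or_gt 0 x with h0 | h0
  -- Every free place below the occupied place x gives an inversion, and there are at least x -
  -- `charge D` of them. This bounds x by 2 * C.
  · have hW : ((Finset.Ico 0 x \ D.filter fun i => 0 ≤ i) ∪ D.filter fun i => i < 0).card ≤
        (inversions D).ncard := by
      rw [← Set.ncard_coe_finset]
      refine Set.ncard_le_ncard_of_injOn (fun j => (x, j)) ?_
        (fun _ _ _ _ h => (Prod.mk.inj h).2) (finite_inversions D)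
      intro j hj
      simp only [Finset.mem_coe, Finset.mem_union, Finset.mem_sdiff,
        Finset.mem_Ico, Finset.mem_filter] at hj
      have hj' : j < x ∧ ¬ Occ D j := by
        simp only [Occ]
        grind
      exact ⟨hj'.1, Or.inl ⟨h0, hx⟩, hj'.2⟩
    rw [Finset.card_union_of_disjoint] at hW
    · have h1 := Finset.le_card_sdiff (D.filter fun i => 0 ≤ i) (Finset.Ico 0 x)
      rw [Int.card_Ico] at h1
      omega
    · rw [Finset.disjoint_left]
      intro j hj hj'
      simp only [Finset.mem_sdiff, Finset.mem_Ico, Finset.mem_filter] at hj hj'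
      omega
  -- The mirror image: x is now a free place, and at least -x - 1 + `charge D` occupied places lie
  -- above it.
  · have hW : ((Finset.Ioo x 0 \ D.filter fun i => i < 0) ∪ D.filter fun i => 0 ≤ i).card ≤
        (inversions D).ncard := by
      rw [← Set.ncard_coe_finset]
      refine Set.ncard_le_ncard_of_injOn (fun j => (j, x)) ?_
        (fun _ _ _ _ h => (Prod.mk.inj h).1) (finite_inversions D)
      intro j hj
      simp only [Finset.mem_coe, Finset.mem_union, Finset.mem_sdiff,
        Finset.mem_Ioo, Finset.mem_filter] at hj
      have hj' : x < j ∧ Occ D j ∧ ¬ Occ D x := by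
        simp only [Occ]
        grind
      exact hj'
    rw [Finset.card_union_of_disjoint] at hW
    · have h1 := Finset.le_card_sdiff (D.filter fun i => i < 0) (Finset.Ioo x 0)
      rw [Int.card_Ioo] at h1
      omega
    · rw [Finset.disjoint_left]
      intro j hj hj'
      simp only [Finset.mem_sdiff, Finset.mem_Ioo, Finset.mem_filter] at hj hj'
      omega

/-! ### Adjoints -/

/-- Two linear maps whose matrices are adjoint to each other. -/
def IsMatrixAdjoint {α : Type*} (L L' : (α →₀ ℂ) →ₗ[ℂ] (α →₀ ℂ)) : Prop :=
  ∀ a b, L (Finsupp.single a 1) b = starRingEnd ℂ (L' (Finsupp.single b 1) a)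

theorem IsMatrixAdjoint.symm {α : Type*} {L L' : (α →₀ ℂ) →ₗ[ℂ] (α →₀ ℂ)}
    (h : IsMatrixAdjoint L L') : IsMatrixAdjoint L' L := fun a b => by
  rw [h b a, Complex.conj_conj]

theorem IsMatrixAdjoint.apply {α : Type*} {L L' : (α →₀ ℂ) →ₗ[ℂ] (α →₀ ℂ)}
    (h : IsMatrixAdjoint L L') (v : α →₀ ℂ) (b : α) :
    L v b = v.sum fun a c => c * starRingEnd ℂ (L' (Finsupp.single b 1) a) := by
  induction v using Finsupp.induction_linear with
  | zero => simp
  | add f g hf hg => rw [map_add, Finsupp.add_apply, hf, hg, Finsupp.sum_add_index'] <;> simp [add_mul]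
  | single a c =>
    rw [← mul_one c, ← smul_eq_mul, ← Finsupp.smul_single, map_smul, Finsupp.smul_apply, h,
      Finsupp.smul_single, Finsupp.sum_single_index] <;> simp

theorem IsMatrixAdjoint.comp {α : Type*} {L L' N N' : (α →₀ ℂ) →ₗ[ℂ] (α →₀ ℂ)}
    (h : IsMatrixAdjoint L L') (h' : IsMatrixAdjoint N N') :
    IsMatrixAdjoint (L ∘ₗ N) (N' ∘ₗ L') := by
  classical
  intro a b
  rw [LinearMap.comp_apply, LinearMap.comp_apply, h.apply, h'.symm.apply,
    Finsupp.sum_of_support_subset _ (Finset.subset_union_left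
      (s₂ := (L' (Finsupp.single b 1)).support)) _ (by simp),
    Finsupp.sum_of_support_subset (L' (Finsupp.single b 1)) (Finset.subset_union_right
      (s₁ := (N (Finsupp.single a 1)).support)) _ (by simp), map_sum]
  refine Finset.sum_congr rfl fun x _ => ?_
  rw [map_mul, Complex.conj_conj, mul_comm]

theorem conj_fockSign (D : Finset ℤ) (i : ℤ) : starRingEnd ℂ (fockSign D i) = fockSign D i := by
  simp [fockSign]

theorem isMatrixAdjoint_create_annihilate (i : ℤ) : IsMatrixAdjoint (create i) (annihilate i) := by
  classical
  intro D D'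
  rw [create_single, annihilate_single]
  by_cases h : symmDiff D {i} = D'
  · subst h
    by_cases h1 : Occ D i <;> simp [h1, occ_toggle_self, fockSign_toggle, conj_fockSign]
  · have h' : symmDiff D' {i} ≠ D := by
      rintro rfl
      exact h (symmDiff_symmDiff_cancel_right _ _)
    split_ifs <;> simp [h, h']

/-- The adjoint of the hop i → i + n is the reverse hop, which is the term of e_{-n} with index i +
n. -/
theorem isMatrixAdjoint_loopGen (n : ℤ) : IsMatrixAdjoint (loopGen n) (loopGen (-n)) := by
  classical
  intro D D'
  by_cases hn : n = 0
  · subst hn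
    rw [neg_zero, loopGen_zero_apply, loopGen_zero_apply]
    by_cases h : D = D'
    · subst h; simp
    · simp [h, Ne.symm h]
  · obtain ⟨s, h1, h2⟩ := ((loopGen_eq_sum hn (Finsupp.single D 1)).and
      ((tendsto_map_equiv_atTop (Equiv.addRight n)).eventually
      (loopGen_eq_sum (neg_ne_zero.2 hn) (Finsupp.single D' 1)))).exists
    rw [h1, h2, Finset.sum_map, Finsupp.finsetSum_apply, Finsupp.finsetSum_apply, map_sum]
    refine Finset.sum_congr rfl fun i _ => ?_
    have := ((isMatrixAdjoint_create_annihilate (i + n)).comp (isMatrixAdjoint_create_annihilate i).symm) D D'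
    simpa using this

/-! ### Equivariance under the shift -/

theorem mem_shift (D : Finset ℤ) (i : ℤ) : i ∈ shift D ↔ ¬ (i - 1 ∈ D ↔ i = 0) := by
  have : shift D = symmDiff (D.map (Equiv.addRight (1 : ℤ)).toEmbedding) {0} := rfl
  rw [this, Finset.mem_symmDiff]
  have h1 : i ∈ D.map (Equiv.addRight (1 : ℤ)).toEmbedding ↔ i - 1 ∈ D := by
    simp [sub_eq_add_neg]
  rw [h1, Finset.mem_singleton]
  tauto

theorem occ_shift (D : Finset ℤ) (i : ℤ) : Occ (shift D) i ↔ Occ D (i - 1) := by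
  simp only [Occ, mem_shift]
  by_cases h : i - 1 ∈ D <;> by_cases h0 : i = 0 <;> simp [h, h0] <;> grind

theorem shift_toggle (D : Finset ℤ) (i : ℤ) :
    shift (symmDiff D {i}) = symmDiff (shift D) {i + 1} := by
  ext j
  simp only [mem_shift, Finset.mem_symmDiff, Finset.mem_singleton]
  grind

theorem fockSign_shift (D : Finset ℤ) (i : ℤ) : fockSign (shift D) (i + 1) = fockSign D i := by
  have : {j : ℤ | i + 1 < j ∧ Occ (shift D) j} = (fun j => j + 1) '' {j : ℤ | i < j ∧ Occ D j} := by
    ext j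
    simp only [Set.mem_ofPred_eq, Set.mem_image, occ_shift]
    exact ⟨fun h => ⟨j - 1, ⟨by omega, h.2⟩, by ring⟩, by
      rintro ⟨k, ⟨h1, h2⟩, rfl⟩
      exact ⟨by omega, by simpa using h2⟩⟩
  rw [fockSign, this, Set.ncard_image_of_injective _ (add_left_injective 1), fockSign]

theorem create_shift (i : ℤ) (v : Fock₀) :
    create (i + 1) (v.mapDomain shift) = (create i v).mapDomain shift := by
  classical
  suffices create (i + 1) ∘ₗ Finsupp.lmapDomain ℂ ℂ shift = Finsupp.lmapDomain ℂ ℂ shift ∘ₗ create i from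
    LinearMap.congr_fun this v
  refine linearMap_ext_single fun D => ?_
  simp only [LinearMap.comp_apply, Finsupp.lmapDomain_apply, Finsupp.mapDomain_single, create_single,
    occ_shift, add_sub_cancel_right, fockSign_shift]
  split_ifs <;> simp [shift_toggle, Finsupp.mapDomain_single]

theorem annihilate_shift (i : ℤ) (v : Fock₀) :
    annihilate (i + 1) (v.mapDomain shift) = (annihilate i v).mapDomain shift := by
  classical
  suffices annihilate (i + 1) ∘ₗ Finsupp.lmapDomain ℂ ℂ shift =
      Finsupp.lmapDomain ℂ ℂ shift ∘ₗ annihilate i from LinearMap.congr_fun this v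
  refine linearMap_ext_single fun D => ?_
  simp only [LinearMap.comp_apply, Finsupp.lmapDomain_apply, Finsupp.mapDomain_single,
    annihilate_single, occ_shift, add_sub_cancel_right, fockSign_shift]
  split_ifs <;> simp [shift_toggle, Finsupp.mapDomain_single]

/-- The shift merely relabels the hops. For n = 0 this fails: the normally ordered charge changes by
one. -/
theorem loopGen_shift {n : ℤ} (hn : n ≠ 0) (v : Fock₀) :
    loopGen n (v.mapDomain shift) = (loopGen n v).mapDomain shift := by
  obtain ⟨s, h1, h2⟩ := ((loopGen_eq_sum hn v).and
    ((tendsto_map_equiv_atTop (Equiv.addRight 1)).eventually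
    (loopGen_eq_sum hn (v.mapDomain shift)))).exists
  rw [h1, h2, Finset.sum_map, Finsupp.mapDomain_finsetSum]
  refine Finset.sum_congr rfl fun i _ => ?_
  rw [← create_shift, ← annihilate_shift]
  congr 2
  simp only [Equiv.coe_toEmbedding, Equiv.coe_addRight]
  ring

/-- The operators e_0 and e_n commute, the central term being zero, so e_n has no matrix entries
between different eigenvalues of e_0. -/
theorem charge_eq_of_loopGen_ne_zero {n : ℤ} {D D' : Finset ℤ}
    (h : loopGen n (Finsupp.single D 1) D' ≠ 0) : charge D' = charge D := by
  have h1 := congrArg (fun v : Fock₀ => v D') (loopGen_comm 0 n (Finsupp.single D 1))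
  simp only [loopGen_zero_apply, loopGen_zero_single, map_smul, Int.cast_zero, ite_self, zero_smul,
    sub_zero, Finsupp.smul_apply, smul_eq_mul] at h1
  exact_mod_cast mul_right_cancel₀ h h1

/-! ### Clifford relations -/

theorem mem_toggle (A : Finset ℕ) (m j : ℕ) :
    j ∈ symmDiff A {m} ↔ (j = m ∧ j ∉ A) ∨ (j ≠ m ∧ j ∈ A) := by
  simp only [Finset.mem_symmDiff, Finset.mem_singleton]
  tauto

/-- Writing raising and lowering both as toggling lets the single sign rule `spinSign_toggle` serve
all the Clifford relations. -/
theorem toggle_eq_insert {A : Finset ℕ} {m : ℕ} (h : m ∉ A) : symmDiff A {m} = insert m A := by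
  ext j
  rw [mem_toggle, Finset.mem_insert]
  by_cases hj : j = m
  · subst hj; simp [h]
  · simp [hj]

theorem toggle_eq_erase {A : Finset ℕ} {m : ℕ} (h : m ∈ A) : symmDiff A {m} = A.erase m := by
  ext j
  rw [mem_toggle, Finset.mem_erase]
  by_cases hj : j = m
  · subst hj; simp [h]
  · simp [hj]

theorem neg_one_pow_card_toggle (A : Finset ℕ) (m : ℕ) :
    (-1 : ℂ) ^ (symmDiff A {m}).card = - (-1) ^ A.card := by
  by_cases h : m ∈ A
  · rw [toggle_eq_erase h, ← Finset.card_erase_add_one h, pow_succ]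
    ring
  · rw [toggle_eq_insert h, Finset.card_insert_of_notMem h, pow_succ]
    ring

theorem spinSign_toggle (A : Finset ℕ) (m i : ℕ) :
    spinSign (symmDiff A {m}) i = if i < m then - spinSign A i else spinSign A i := by
  unfold spinSign
  split_ifs with h
  · rw [← neg_one_pow_card_toggle _ m]
    congr 2
    ext j
    simp only [Finset.mem_filter, mem_toggle]
    by_cases hj : j = m
    · subst hj; simp [h]
    · simp [hj]
  · congr 2
    ext j
    simp only [Finset.mem_filter, mem_toggle]
    by_cases hj : j = m
    · subst hj; simp [h]
    · simp [hj]

theorem spinSign_mul_self (A : Finset ℕ) (i : ℕ) : spinSign A i * spinSign A i = 1 := by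
  rw [spinSign, ← mul_pow]; simp

theorem conj_spinSign (A : Finset ℕ) (i : ℕ) : starRingEnd ℂ (spinSign A i) = spinSign A i := by
  simp [spinSign]

theorem sqrt_two_mul_self : (Real.sqrt 2 : ℂ) * Real.sqrt 2 = 2 := by
  rw [← Complex.ofReal_mul, Real.mul_self_sqrt (by norm_num)]; simp

theorem cliff_zero_single (A : Finset ℕ) (c : ℂ) :
    cliff 0 (Finsupp.single A c) = Finsupp.single A (c * (-1) ^ A.card) := by
  change cliff (Int.ofNat 0) _ = _
  rw [cliff, Finsupp.linearCombination_single]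
  simp

theorem cliff_succ_single (m : ℕ) (A : Finset ℕ) (c : ℂ) :
    cliff (Int.ofNat (m + 1)) (Finsupp.single A c) = if m ∈ A then 0 else
      Finsupp.single (symmDiff A {m}) (c * ((Real.sqrt 2 : ℂ) * spinSign A m)) := by
  rw [cliff, Finsupp.linearCombination_single]
  split_ifs with h
  · simp
  · simp [toggle_eq_insert h, -Finsupp.single_mul]

theorem cliff_negSucc_single (m : ℕ) (A : Finset ℕ) (c : ℂ) :
    cliff (Int.negSucc m) (Finsupp.single A c) = if m ∈ A then
      Finsupp.single (symmDiff A {m}) (c * ((Real.sqrt 2 : ℂ) * spinSign A m)) else 0 := by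
  rw [cliff, Finsupp.linearCombination_single]
  split_ifs with h
  · simp [toggle_eq_erase h, -Finsupp.single_mul]
  · simp

theorem toggle_swap (D : Finset ℕ) (i j : ℕ) :
    symmDiff (symmDiff D {j}) {i} = symmDiff (symmDiff D {i}) {j} := by
  rw [symmDiff_assoc, symmDiff_comm ({j} : Finset ℕ), ← symmDiff_assoc]

theorem cliff_anticomm_succ_zero (i : ℕ) :
    cliff (Int.ofNat (i + 1)) ∘ₗ cliff 0 = -(cliff 0 ∘ₗ cliff (Int.ofNat (i + 1))) := by
  refine linearMap_ext_single fun A => ?_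
  simp only [LinearMap.comp_apply, LinearMap.neg_apply, cliff_zero_single, cliff_succ_single,
    apply_ite (cliff _), map_zero, neg_one_pow_card_toggle]
  split_ifs
  · simp
  · rw [← Finsupp.single_neg]; congr 1; ring

theorem cliff_anticomm_negSucc_zero (i : ℕ) :
    cliff (Int.negSucc i) ∘ₗ cliff 0 = -(cliff 0 ∘ₗ cliff (Int.negSucc i)) := by
  refine linearMap_ext_single fun A => ?_
  simp only [LinearMap.comp_apply, LinearMap.neg_apply, cliff_zero_single, cliff_negSucc_single,
    apply_ite (cliff _), map_zero, neg_one_pow_card_toggle]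
  split_ifs
  · rw [← Finsupp.single_neg]; congr 1; ring
  · simp

theorem cliff_anticomm_succ_succ (i j : ℕ) :
    cliff (Int.ofNat (i + 1)) ∘ₗ cliff (Int.ofNat (j + 1)) =
      -(cliff (Int.ofNat (j + 1)) ∘ₗ cliff (Int.ofNat (i + 1))) := by
  refine linearMap_ext_single fun A => ?_
  simp only [LinearMap.comp_apply, LinearMap.neg_apply, cliff_succ_single,
    apply_ite (cliff _), map_zero, mem_toggle, spinSign_toggle, toggle_swap A i j]
  rcases lt_trichotomy i j with h | h | h
  · by_cases hi : i ∈ A <;> by_cases hj : j ∈ A <;>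
      simp [hi, hj, h, h.ne, h.ne', h.not_gt, -Finsupp.single_mul]
    congr 1; ring
  · subst h
    by_cases hi : i ∈ A <;> simp [hi]
  · by_cases hi : i ∈ A <;> by_cases hj : j ∈ A <;>
      simp [hi, hj, h, h.ne, h.ne', h.not_gt, -Finsupp.single_mul]
    congr 1; ring

theorem cliff_anticomm_negSucc_negSucc (i j : ℕ) :
    cliff (Int.negSucc i) ∘ₗ cliff (Int.negSucc j) =
      -(cliff (Int.negSucc j) ∘ₗ cliff (Int.negSucc i)) := by
  refine linearMap_ext_single fun A => ?_
  simp only [LinearMap.comp_apply, LinearMap.neg_apply, cliff_negSucc_single,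
    apply_ite (cliff _), map_zero, mem_toggle, spinSign_toggle, toggle_swap A i j]
  rcases lt_trichotomy i j with h | h | h
  · by_cases hi : i ∈ A <;> by_cases hj : j ∈ A <;>
      simp [hi, hj, h, h.ne, h.ne', h.not_gt, -Finsupp.single_mul]
    congr 1; ring
  · subst h
    by_cases hi : i ∈ A <;> simp [hi]
  · by_cases hi : i ∈ A <;> by_cases hj : j ∈ A <;>
      simp [hi, hj, h, h.ne, h.ne', h.not_gt, -Finsupp.single_mul]
    congr 1; ring

theorem cliff_anticomm_negSucc_succ {i j : ℕ} (hij : i ≠ j) :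
    cliff (Int.negSucc i) ∘ₗ cliff (Int.ofNat (j + 1)) =
      -(cliff (Int.ofNat (j + 1)) ∘ₗ cliff (Int.negSucc i)) := by
  refine linearMap_ext_single fun A => ?_
  simp only [LinearMap.comp_apply, LinearMap.neg_apply, cliff_negSucc_single, cliff_succ_single,
    apply_ite (cliff _), map_zero, mem_toggle, spinSign_toggle, toggle_swap A i j]
  rcases lt_or_gt_of_ne hij with h | h
  · by_cases hi : i ∈ A <;> by_cases hj : j ∈ A <;>
      simp [hi, hj, h, h.ne, h.ne', h.not_gt, -Finsupp.single_mul]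
    congr 1; ring
  · by_cases hi : i ∈ A <;> by_cases hj : j ∈ A <;>
      simp [hi, hj, h, h.ne, h.ne', h.not_gt, -Finsupp.single_mul]
    congr 1; ring

theorem cliff_negSucc_cliff_succ_single (m : ℕ) (A : Finset ℕ) :
    cliff (Int.negSucc m) (cliff (Int.ofNat (m + 1)) (Finsupp.single A 1)) =
      (if m ∈ A then 0 else 2 : ℂ) • Finsupp.single A 1 := by
  rw [cliff_succ_single]
  split_ifs with h
  · simp
  · rw [cliff_negSucc_single, if_pos (by simp [mem_toggle, h]), symmDiff_symmDiff_cancel_right,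
      spinSign_toggle, if_neg (lt_irrefl _), Finsupp.smul_single]
    congr 1
    linear_combination sqrt_two_mul_self * spinSign A m * spinSign A m + 2 * spinSign_mul_self A m

theorem cliff_succ_cliff_negSucc_single (m : ℕ) (A : Finset ℕ) :
    cliff (Int.ofNat (m + 1)) (cliff (Int.negSucc m) (Finsupp.single A 1)) =
      (if m ∈ A then 2 else 0 : ℂ) • Finsupp.single A 1 := by
  rw [cliff_negSucc_single]
  split_ifs with h
  · rw [cliff_succ_single, if_neg (by simp [mem_toggle, h]), symmDiff_symmDiff_cancel_right,
      spinSign_toggle, if_neg (lt_irrefl _), Finsupp.smul_single]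
    congr 1
    linear_combination sqrt_two_mul_self * spinSign A m * spinSign A m + 2 * spinSign_mul_self A m
  · simp

/-- The Clifford relations `ψ_n ψ_m + ψ_m ψ_n = 2 δ_{n,-m}`. -/
theorem cliff_anticomm (n m : ℤ) : cliff m ∘ₗ cliff n =
    (if n + m = 0 then (2 : ℂ) else 0) • LinearMap.id - cliff n ∘ₗ cliff m := by
  have hpm : ∀ i : ℕ, cliff (Int.negSucc i) ∘ₗ cliff (Int.ofNat (i + 1)) =
      (2 : ℂ) • LinearMap.id - cliff (Int.ofNat (i + 1)) ∘ₗ cliff (Int.negSucc i) := by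
    intro i
    refine linearMap_ext_single fun A => ?_
    simp only [LinearMap.sub_apply, LinearMap.comp_apply, LinearMap.smul_apply, LinearMap.id_apply,
      cliff_negSucc_cliff_succ_single, cliff_succ_cliff_negSucc_single, ← sub_smul]
    congr 1
    split_ifs <;> simp
  have hz : ∀ {X Y : Spinor₀ →ₗ[ℂ] Spinor₀}, X = -Y → X = (0 : ℂ) • LinearMap.id - Y := by
    rintro X Y rfl
    ext; simp
  have hz' : ∀ {X Y : Spinor₀ →ₗ[ℂ] Spinor₀}, Y = -X → X = (0 : ℂ) • LinearMap.id - Y := by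
    rintro X Y rfl
    ext; simp
  rcases n with (_ | i) | i <;> rcases m with (_ | j) | j
  · change cliff 0 ∘ₗ cliff 0 = (if (0 : ℤ) + 0 = 0 then (2 : ℂ) else 0) • LinearMap.id -
      cliff 0 ∘ₗ cliff 0
    refine linearMap_ext_single fun A => ?_
    simp only [LinearMap.comp_apply, LinearMap.sub_apply, cliff_zero_single]
    rw [one_mul, ← mul_pow]
    simp
    rw [← Finsupp.single_sub]; norm_num
  · rw [if_neg (by simp; omega)]
    exact hz (cliff_anticomm_succ_zero j)
  · rw [if_neg (by simp)]
    exact hz (cliff_anticomm_negSucc_zero j)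
  · rw [if_neg (by simp; omega)]
    exact hz' (cliff_anticomm_succ_zero i)
  · rw [if_neg (by simp; omega)]
    exact hz (cliff_anticomm_succ_succ j i)
  · by_cases h : i = j
    · subst h
      rw [if_pos (by simp [Int.negSucc_eq]), hpm]
    · rw [if_neg (by simp [Int.negSucc_eq]; omega)]
      exact hz (cliff_anticomm_negSucc_succ (Ne.symm h))
  · rw [if_neg (by simp)]
    exact hz' (cliff_anticomm_negSucc_zero i)
  · by_cases h : i = j
    · subst h
      rw [if_pos (by simp [Int.negSucc_eq]), hpm]; abel
    · rw [if_neg (by simp [Int.negSucc_eq]; omega)]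
      exact hz' (cliff_anticomm_negSucc_succ h)
  · rw [if_neg (by simp [Int.negSucc_eq]; omega)]
    exact hz (cliff_anticomm_negSucc_negSucc j i)

theorem isMatrixAdjoint_cliff_succ (m : ℕ) :
    IsMatrixAdjoint (cliff (Int.ofNat (m + 1))) (cliff (Int.negSucc m)) := by
  intro A A'
  rw [cliff_succ_single, cliff_negSucc_single]
  by_cases h : symmDiff A {m} = A'
  · subst h
    by_cases h1 : m ∈ A <;> simp [h1, mem_toggle, spinSign_toggle, conj_spinSign]
  · have h' : symmDiff A' {m} ≠ A := by
      rintro rfl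
      exact h (symmDiff_symmDiff_cancel_right _ _)
    split_ifs <;> simp [h, h']

theorem isMatrixAdjoint_cliff (n : ℤ) : IsMatrixAdjoint (cliff n) (cliff (-n)) := by
  rcases n with (_ | i) | i
  · intro A A'
    change cliff 0 _ _ = starRingEnd ℂ (cliff 0 _ _)
    rw [cliff_zero_single, cliff_zero_single]
    by_cases h : A = A'
    · subst h; simp
    · simp [h, Ne.symm h]
  · exact isMatrixAdjoint_cliff_succ i
  · exact (isMatrixAdjoint_cliff_succ i).symm

theorem cliff_eq_zero_of_lt {A : Finset ℕ} {K : ℤ} (hK : 0 ≤ K) (hA : ∀ m ∈ A, (m : ℤ) < K) {k : ℤ}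
    (hk : k < -K) : cliff k (Finsupp.single A 1) = 0 := by
  rcases k with i | i
  · simp at hk; omega
  · rw [cliff_negSucc_single, if_neg]
    intro h
    have := hA i h
    rw [Int.negSucc_eq] at hk
    omega

/-! ### The square of the supercharge -/

/-- The generators `e_n + y δ_{n,0}`. -/
def twistGen (y : ℂ) (n : ℤ) : Fock₀ →ₗ[ℂ] Fock₀ :=
  loopGen n + (if n = 0 then y else 0) • LinearMap.id

theorem twistGen_of_ne (y : ℂ) {n : ℤ} (hn : n ≠ 0) : twistGen y n = loopGen n := by
  simp [twistGen, hn]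

/-- Adding a scalar to e_0 does not affect commutators. So the term (x/2π) ψ_0 can be absorbed into
the loop algebra, with y = x/2π. -/
theorem twistGen_comm (y : ℂ) (n m : ℤ) : twistGen y m ∘ₗ twistGen y n =
    twistGen y n ∘ₗ twistGen y m + (if n + m = 0 then (n : ℂ) else 0) • LinearMap.id := by
  ext1 D
  ext1
  simp only [twistGen, LinearMap.comp_apply, LinearMap.add_apply, LinearMap.smul_apply,
    LinearMap.id_apply, map_add, map_smul]
  rw [loopGen_comm n m]
  simp only [smul_add, smul_smul]
  rw [mul_comm (if m = 0 then y else 0)]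
  abel

theorem isMatrixAdjoint_twistGen (y : ℝ) (n : ℤ) :
    IsMatrixAdjoint (twistGen y n) (twistGen y (-n)) := by
  classical
  intro D D'
  have h := isMatrixAdjoint_loopGen n D D'
  simp only [twistGen, LinearMap.add_apply, Finsupp.add_apply, h, map_add, neg_eq_zero,
    LinearMap.smul_apply, LinearMap.id_apply, Finsupp.smul_apply, smul_eq_mul, map_mul]
  congr 1
  by_cases hD : D = D'
  · subst hD; split_ifs <;> simp
  · simp [hD, Ne.symm hD]

/-- The truncated supercharge. -/
def superSum (y : ℂ) (K : ℕ) : (Spinor₀ ⊗[ℂ] Fock₀) →ₗ[ℂ] (Spinor₀ ⊗[ℂ] Fock₀) :=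
  ∑ k ∈ Finset.Icc (-(K : ℤ)) K, TensorProduct.map (cliff k) (twistGen y (-k))

/-- For k far below zero ψ_k kills the spinor; for k far above zero e_{-k} kills the Fock vector.
The remaining finite sum is a composable operator, on which the commutation relations can be used.
-/
theorem superchargeVec_eq (x : ℝ) (b : Idx) : ∀ᶠ K : ℕ in Filter.atTop,
    superchargeVec x b = finsuppTensorFinsupp' ℂ (Finset ℕ) (Finset ℤ)
      (superSum ((x / (2 * Real.pi) : ℝ) : ℂ) K (Finsupp.single b.1 1 ⊗ₜ[ℂ] Finsupp.single b.2 1)) := by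
  obtain ⟨B, hB, hD⟩ := exists_bound b.2
  filter_upwards [Filter.eventually_gt_atTop (b.1.sup id), Filter.eventually_ge_atTop (2 * B).toNat]
    with K h1 h2
  have hA : ∀ m ∈ b.1, (m : ℤ) < K := fun m hm => by
    have : m ≤ b.1.sup id := Finset.le_sup (f := id) hm
    omega
  rw [superchargeVec, finsum_eq_sum_of_support_subset (s := Finset.Icc (-(K : ℤ)) K)]
  · simp only [superSum, LinearMap.sum_apply, map_sum, TensorProduct.map_tmul, twistGen,
      LinearMap.add_apply, TensorProduct.tmul_add, map_add, Finset.sum_add_distrib]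
    congr 1
    rw [Finset.sum_eq_single_of_mem 0 (by simp)]
    · rw [neg_zero, if_pos rfl, LinearMap.smul_apply, LinearMap.id_apply, TensorProduct.tmul_smul,
        map_smul]
    · intro k _ hk
      simp [hk]
  · intro k hk
    by_contra h
    refine hk ?_
    beta_reduce
    simp only [Finset.coe_Icc, Set.mem_Icc, not_and_or, not_le] at h
    rcases h with h | h
    · rw [cliff_eq_zero_of_lt (by omega) hA h, TensorProduct.zero_tmul, map_zero]
    · rw [loopGen_neg_eq_zero hB hD (by omega), TensorProduct.tmul_zero, map_zero]

theorem superchargeVec_apply (x : ℝ) (b b' : Idx) : ∀ᶠ K : ℕ in Filter.atTop,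
    superchargeVec x b b' = ∑ k ∈ Finset.Icc (-(K : ℤ)) K, cliff k (Finsupp.single b.1 1) b'.1 *
      twistGen ((x / (2 * Real.pi) : ℝ) : ℂ) (-k) (Finsupp.single b.2 1) b'.2 := by
  filter_upwards [superchargeVec_eq x b] with K hK
  rw [hK, superSum]
  simp only [LinearMap.sum_apply, map_sum, TensorProduct.map_tmul, Finsupp.finsetSum_apply]
  refine Finset.sum_congr rfl fun k _ => ?_
  rw [← finsuppTensorFinsupp'_apply_apply]

theorem sum_Icc_neg_eq {W : Type*} [AddCommMonoid W] (f : ℤ → W) (K : ℕ) :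
    ∑ k ∈ Finset.Icc (-(K : ℤ)) K, f k = f 0 + ∑ k ∈ Finset.Icc 1 (K : ℤ), (f k + f (-k)) := by
  induction K with
  | zero => simp
  | succ K ih =>
    have h1 : Finset.Icc (-((K + 1 : ℕ) : ℤ)) ((K + 1 : ℕ) : ℤ) =
        insert ((K : ℤ) + 1) (insert (-((K : ℤ) + 1)) (Finset.Icc (-(K : ℤ)) K)) := by
      ext i; simp; omega
    have h2 : Finset.Icc 1 ((K + 1 : ℕ) : ℤ) = insert ((K : ℤ) + 1) (Finset.Icc 1 (K : ℤ)) := by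
      ext i; simp; omega
    rw [h1, h2, Finset.sum_insert (by simp; omega), Finset.sum_insert (by simp), ih,
      Finset.sum_insert (by simp)]
    abel

/-- Taking adjoints turns the k-th term into the one with index -k, and the symmetric truncation is
invariant under this. -/
theorem superchargeVec_conj (x : ℝ) (b b' : Idx) :
    superchargeVec x b b' = starRingEnd ℂ (superchargeVec x b' b) := by
  obtain ⟨K, h1, h2⟩ := ((superchargeVec_apply x b b').and (superchargeVec_apply x b' b)).exists
  rw [h1, h2, map_sum]
  refine Finset.sum_equiv (Equiv.neg ℤ) (by intro i; simp; omega) fun k _ => ?_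
  rw [isMatrixAdjoint_cliff k, isMatrixAdjoint_twistGen, map_mul]
  rfl

theorem charge_eq_of_superchargeVec_ne_zero {x : ℝ} {b b' : Idx} (h : superchargeVec x b b' ≠ 0) :
    charge b'.2 = charge b.2 := by
  classical
  obtain ⟨K, h1⟩ := (superchargeVec_apply x b b').exists
  rw [h1] at h
  obtain ⟨k, -, hk⟩ := Finset.exists_ne_zero_of_sum_ne_zero h
  have h2 := right_ne_zero_of_mul hk
  by_contra hne
  refine h2 ?_
  have h3 : loopGen (-k) (Finsupp.single b.2 1) b'.2 = 0 := by
    by_contra h3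
    exact hne (charge_eq_of_loopGen_ne_zero h3)
  have h4 : b.2 ≠ b'.2 := fun h4 => hne (by rw [h4])
  rw [twistGen, LinearMap.add_apply, Finsupp.add_apply, h3, LinearMap.smul_apply, LinearMap.id_apply,
    Finsupp.smul_apply, Finsupp.single_apply, if_neg h4, smul_zero, add_zero]

/-- Conjugation by the shift affects only e_0, which it changes by one; in `superchargeVec_shift`
this becomes x ↦ x + 2π. -/
theorem twistGen_shift (y : ℂ) (n : ℤ) (D D' : Finset ℤ) :
    twistGen y n (Finsupp.single (shift D) 1) (shift D') =
      twistGen (y + 1) n (Finsupp.single D 1) D' := by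
  classical
  by_cases hn : n = 0
  · subst hn
    simp only [twistGen, LinearMap.add_apply, Finsupp.add_apply, loopGen_zero_apply]
    by_cases h : D = D'
    · subst h
      simp [charge_shift]
      ring
    · simp [h]
  · rw [twistGen_of_ne _ hn, twistGen_of_ne _ hn, ← Finsupp.mapDomain_single, loopGen_shift hn,
      Finsupp.mapDomain_apply shift.injective]

theorem superchargeVec_shift (x : ℝ) (A A' : Finset ℕ) (D D' : Finset ℤ) :
    superchargeVec x (A, shift D) (A', shift D') =
      superchargeVec (x + 2 * Real.pi) (A, D) (A', D') := by
  obtain ⟨K, h1, h2⟩ := ((superchargeVec_apply x (A, shift D) (A', shift D')).and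
    (superchargeVec_apply (x + 2 * Real.pi) (A, D) (A', D'))).exists
  rw [h1, h2]
  refine Finset.sum_congr rfl fun k _ => ?_
  rw [twistGen_shift]
  have : (x + 2 * Real.pi) / (2 * Real.pi) = x / (2 * Real.pi) + 1 := by
    field_simp
  rw [this]
  push_cast
  rfl

theorem cliff_anticomm' (n m : ℤ) : cliff m ∘ₗ cliff n =
    (if n + m = 0 then (2 : ℂ) else 0) • LinearMap.id + (-1 : ℂ) • (cliff n ∘ₗ cliff m) := by
  rw [cliff_anticomm]
  ext
  simp [sub_eq_add_neg]

/-- Add the double sum to itself with k and l exchanged. If l ≠ -k, the ψ's anticommute and the e's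
commute, so the two terms cancel. At l = -k the Clifford constant 2 and the central term of the e's
leave the stated summand. -/
theorem superSum_sq (y : ℂ) (K : ℕ) : (2 : ℂ) • (superSum y K ∘ₗ superSum y K) =
    ∑ k ∈ Finset.Icc (-(K : ℤ)) K,
      ((2 : ℂ) • TensorProduct.map (LinearMap.id : Spinor₀ →ₗ[ℂ] Spinor₀) (twistGen y (-k) ∘ₗ twistGen y k) +
        (-k : ℂ) • TensorProduct.map (cliff (-k) ∘ₗ cliff k)
          (LinearMap.id : Fock₀ →ₗ[ℂ] Fock₀)) := by
  have h1 : superSum y K ∘ₗ superSum y K = ∑ k ∈ Finset.Icc (-(K : ℤ)) K,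
      ∑ l ∈ Finset.Icc (-(K : ℤ)) K, TensorProduct.map (cliff k ∘ₗ cliff l)
        (twistGen y (-k) ∘ₗ twistGen y (-l)) := by
    simp only [TensorProduct.map_comp]
    exact Finset.sum_mul_sum (R := Module.End ℂ (Spinor₀ ⊗[ℂ] Fock₀)) _ _ _ _
  have h2 : superSum y K ∘ₗ superSum y K = ∑ k ∈ Finset.Icc (-(K : ℤ)) K,
      ∑ l ∈ Finset.Icc (-(K : ℤ)) K, TensorProduct.map (cliff l ∘ₗ cliff k)
        (twistGen y (-l) ∘ₗ twistGen y (-k)) := by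
    rw [h1, Finset.sum_comm]
  rw [two_smul]
  nth_rewrite 1 [h1]
  rw [h2, ← Finset.sum_add_distrib]
  refine Finset.sum_congr rfl fun k hk => ?_
  rw [← Finset.sum_add_distrib, Finset.sum_eq_single_of_mem (-k) (by simp at hk ⊢; omega)]
  · rw [neg_neg, cliff_anticomm' (-k) k, if_pos (by ring), twistGen_comm y (-k) k, if_pos (by ring)]
    simp only [TensorProduct.map_add_left, TensorProduct.map_add_right, TensorProduct.map_smul_left,
      TensorProduct.map_smul_right]
    push_cast
    module
  · intro l _ hl
    rw [cliff_anticomm' k l, if_neg (by omega), twistGen_comm y (-k) (-l), if_neg (by omega)]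
    simp only [zero_smul, add_zero, zero_add, TensorProduct.map_smul_left]
    module

/-- The eigenvalues of the square of the supercharge. -/
def energy (x : ℝ) (b : Idx) : ℝ :=
  (charge b.2 + x / (2 * Real.pi)) ^ 2 + 2 * (inversions b.2).ncard + 2 * ∑ m ∈ b.1, ((m : ℝ) + 1)

/-- On this basis ψ_k ψ_{-k} is twice the occupation number of the mode labelled m = k - 1; hence
the weights m + 1. -/
theorem sum_cliff_energy (A : Finset ℕ) {K : ℕ} (hK : ∀ m ∈ A, m < K) :
    ∑ k ∈ Finset.Icc 1 (K : ℤ), (k : ℂ) • (cliff k (cliff (-k) (Finsupp.single A 1))) =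
      (2 * ∑ m ∈ A, ((m : ℂ) + 1)) • Finsupp.single A 1 := by
  have h1 : ∑ k ∈ Finset.Icc 1 (K : ℤ), (k : ℂ) • (cliff k (cliff (-k) (Finsupp.single A 1))) =
      ∑ m ∈ Finset.range K, (if m ∈ A then ((2 * (m + 1) : ℂ)) else 0) • Finsupp.single A 1 := by
    symm
    refine Finset.sum_bij (fun m _ => (m : ℤ) + 1) ?_ ?_ ?_ ?_
    · intro m hm
      simp at hm ⊢
      omega
    · intro a _ b _ h
      simpa using h
    · intro k hk
      rw [Finset.mem_Icc] at hk
      exact ⟨(k - 1).toNat, by simp; omega, by omega⟩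
    · intro m _
      have := cliff_succ_cliff_negSucc_single m A
      change _ = _ • cliff (Int.ofNat (m + 1)) (cliff (Int.negSucc m) (Finsupp.single A 1))
      rw [this, smul_smul]
      congr 1
      split_ifs
      · push_cast; ring
      · simp
  rw [h1, ← Finset.sum_smul, ← Finset.sum_filter, Finset.mul_sum]
  congr 1
  refine Finset.sum_congr ?_ fun _ _ => rfl
  ext m
  simp only [Finset.mem_filter, Finset.mem_range]
  exact ⟨fun h => h.2, fun h => ⟨hK m h, h⟩⟩

theorem superSum_superSum_single (x : ℝ) (A : Finset ℕ) (D : Finset ℤ) :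
    ∀ᶠ K : ℕ in Filter.atTop, superSum ((x / (2 * Real.pi) : ℝ) : ℂ) K
      (superSum ((x / (2 * Real.pi) : ℝ) : ℂ) K (Finsupp.single A 1 ⊗ₜ[ℂ] Finsupp.single D 1)) =
      (energy x (A, D) : ℂ) • (Finsupp.single A 1 ⊗ₜ[ℂ] Finsupp.single D 1) := by
  set y : ℂ := ((x / (2 * Real.pi) : ℝ) : ℂ) with hy
  filter_upwards [sum_loopGen_loopGen_neg D, Filter.eventually_gt_atTop (A.sup id)] with K h1 h2
  have hA : ∀ m ∈ A, m < K := fun m hm => by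
    have : m ≤ A.sup id := Finset.le_sup (f := id) hm
    omega
  have h3 := LinearMap.congr_fun (superSum_sq y K) (Finsupp.single A 1 ⊗ₜ[ℂ] Finsupp.single D 1)
  rw [sum_Icc_neg_eq] at h3
  -- Put the terms for k and -k in the order that kills the vacuum. The bosons contribute the
  -- constant 2k and the fermions -2k, so there is no zero-point energy and the result does not
  -- depend on the cutoff.
  have h4 : ∀ k ∈ Finset.Icc 1 (K : ℤ),
      ((2 : ℂ) • TensorProduct.map (LinearMap.id : Spinor₀ →ₗ[ℂ] Spinor₀) (twistGen y (-k) ∘ₗ twistGen y k) +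
        (-k : ℂ) • TensorProduct.map (cliff (-k) ∘ₗ cliff k)
          (LinearMap.id : Fock₀ →ₗ[ℂ] Fock₀)) +
      ((2 : ℂ) • TensorProduct.map (LinearMap.id : Spinor₀ →ₗ[ℂ] Spinor₀) (twistGen y (- -k) ∘ₗ twistGen y (-k)) +
        (-((-k : ℤ) : ℂ)) • TensorProduct.map (cliff (- -k) ∘ₗ cliff (-k))
          (LinearMap.id : Fock₀ →ₗ[ℂ] Fock₀)) =
      (4 : ℂ) • TensorProduct.map (LinearMap.id : Spinor₀ →ₗ[ℂ] Spinor₀) (loopGen k ∘ₗ loopGen (-k)) +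
        (2 : ℂ) • TensorProduct.map ((k : ℂ) • (cliff k ∘ₗ cliff (-k)))
          (LinearMap.id : Fock₀ →ₗ[ℂ] Fock₀) := by
    intro k hk
    rw [Finset.mem_Icc] at hk
    rw [neg_neg, cliff_anticomm' k (-k), if_pos (by ring), twistGen_comm y k (-k), if_pos (by ring),
      twistGen_of_ne y (show k ≠ 0 by omega), twistGen_of_ne y (show -k ≠ 0 by omega)]
    simp only [TensorProduct.map_add_left, TensorProduct.map_add_right, TensorProduct.map_smul_left,
      TensorProduct.map_smul_right]
    push_cast
    module
  rw [Finset.sum_congr rfl h4] at h3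
  have h5 : twistGen y 0 (twistGen y 0 (Finsupp.single D 1)) =
      ((charge D + y) ^ 2 : ℂ) • Finsupp.single D 1 := by
    have : twistGen y 0 (Finsupp.single D 1) = (charge D + y : ℂ) • Finsupp.single D 1 := by
      simp only [twistGen, LinearMap.add_apply, loopGen_zero_single]
      simp
    rw [this, map_smul, this, smul_smul, pow_two]
  simp only [LinearMap.smul_apply, LinearMap.comp_apply, LinearMap.add_apply,
    add_zero, LinearMap.sum_apply, TensorProduct.map_tmul, LinearMap.id_apply, neg_zero, Int.cast_zero,
    zero_smul, h5, Finset.sum_add_distrib, ← Finset.smul_sum, ← TensorProduct.tmul_sum,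
    ← TensorProduct.sum_tmul, h1, sum_cliff_energy A hA, TensorProduct.tmul_smul,
    TensorProduct.smul_tmul', smul_smul] at h3
  have h6 : (2 : ℂ) ≠ 0 := two_ne_zero
  rw [← smul_right_inj h6, h3, TensorProduct.smul_tmul', ← TensorProduct.add_tmul, ← add_smul,
    ← TensorProduct.add_tmul, ← add_smul, TensorProduct.smul_tmul', smul_smul]
  congr 2
  rw [energy, hy, Finset.sum_add_distrib]
  push_cast
  ring

/-- The square of the supercharge is diagonal. -/
theorem superchargeVec_sq (x : ℝ) (b : Idx) :
    ((superchargeVec x b).sum fun b' c => c • superchargeVec x b') =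
      Finsupp.single b (energy x b : ℂ) := by
  set τ := finsuppTensorFinsupp' ℂ (Finset ℕ) (Finset ℤ)
  set y : ℂ := ((x / (2 * Real.pi) : ℝ) : ℂ) with hy
  have key : ∀ w : Idx →₀ ℂ, ∀ᶠ K : ℕ in Filter.atTop,
      Finsupp.linearCombination ℂ (superchargeVec x) w = τ (superSum y K (τ.symm w)) := by
    intro w
    induction w using Finsupp.induction_linear with
    | zero => simp
    | add f g hf hg =>
      filter_upwards [hf, hg] with K h1 h2
      simp [h1, h2]
    | single b c =>
      filter_upwards [superchargeVec_eq x b] with K hK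
      have h2 : (Finsupp.single b c : Idx →₀ ℂ) = c • Finsupp.single b 1 := by simp
      have h3 : τ.symm (Finsupp.single b 1) = Finsupp.single b.1 1 ⊗ₜ[ℂ] Finsupp.single b.2 1 := by
        rw [LinearEquiv.symm_apply_eq]
        simp [τ]
      rw [h2, map_smul, map_smul, map_smul, map_smul, h3, Finsupp.linearCombination_single, one_smul,
        hK]
  obtain ⟨K, h1, h2, h3⟩ := ((key (superchargeVec x b)).and ((superchargeVec_eq x b).and
    (superSum_superSum_single x b.1 b.2))).exists
  rw [Finsupp.linearCombination_apply] at h1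
  rw [h1, h2, LinearEquiv.symm_apply_apply, h3, map_smul]
  simp [τ]

/-! ### Positivity and properness of the energy -/

theorem energy_nonneg (x : ℝ) (b : Idx) : 0 ≤ energy x b := by
  unfold energy
  positivity

/-- The energy is a proper function of the state. -/
theorem finite_energy_le (x C : ℝ) : {b : Idx | energy x b ≤ C}.Finite := by
  obtain ⟨n, hn⟩ := exists_nat_ge (C + 1 + |x / (2 * Real.pi)|)
  refine ((Finset.finite_toSet (Finset.range n).powerset).prod (finite_charge_inversions n)).subset ?_
  rintro ⟨A, D⟩ h
  simp only [Set.mem_ofPred_eq, energy] at h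
  have h0 : 0 ≤ ∑ m ∈ A, ((m : ℝ) + 1) := Finset.sum_nonneg fun _ _ => by positivity
  have h1 : (0 : ℝ) ≤ (inversions D).ncard := by positivity
  have h2 := sq_nonneg ((charge D : ℝ) + x / (2 * Real.pi))
  have h3 := abs_nonneg (x / (2 * Real.pi))
  refine ⟨?_, ?_, ?_⟩
  · refine Finset.mem_coe.2 (Finset.mem_powerset.2 fun m hm => Finset.mem_range.2 ?_)
    have := Finset.single_le_sum (f := fun m : ℕ => (m : ℝ) + 1) (fun _ _ => by positivity) hm
    have : (m : ℝ) < n := by simp only at this; linarith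
    exact_mod_cast this
  · have h4 : |(charge D : ℝ) + x / (2 * Real.pi)| ≤ C + 1 := by
      rw [abs_le]
      constructor <;> nlinarith
    have h5 : |(charge D : ℝ)| ≤ n := by
      calc |(charge D : ℝ)| = |(charge D + x / (2 * Real.pi)) - x / (2 * Real.pi)| := by ring_nf
        _ ≤ |(charge D : ℝ) + x / (2 * Real.pi)| + |x / (2 * Real.pi)| := abs_sub _ _
        _ ≤ n := by linarith
    exact_mod_cast h5
  · have : ((inversions D).ncard : ℝ) ≤ n := by linarith
    exact_mod_cast this

/-! ### Essential self-adjointness from a bounded transform -/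

section BoundedTransform

variable {H : Type*} [NormedAddCommGroup H] [InnerProductSpace ℂ H] [CompleteSpace H]

theorem isClosable_of_symmetric {Q : H →ₗ.[ℂ] H} (hd : Dense (Q.domain : Set H))
    (hs : Q.IsFormalAdjoint Q) : Q.IsClosable :=
  (LinearPMap.adjoint_isClosed hd).isClosable.leIsClosable (hs.le_adjoint hd)

/-- Symmetry is a closed condition in each argument separately, so it passes to the closure of the
graph one variable at a time. -/
theorem closure_graph_symmetric {Q : H →ₗ.[ℂ] H} (hd : Dense (Q.domain : Set H))
    (hs : Q.IsFormalAdjoint Q) {p q : H × H} (hp : p ∈ Q.closure.graph) (hq : q ∈ Q.closure.graph) :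
    ⟪p.2, q.1⟫_ℂ = ⟪p.1, q.2⟫_ℂ := by
  rw [← (isClosable_of_symmetric hd hs).graph_closure_eq_closure_graph] at hp hq
  have key : ∀ p ∈ Q.graph, ∀ q ∈ Q.graph, ⟪p.2, q.1⟫_ℂ = ⟪p.1, q.2⟫_ℂ := by
    intro p hp q hq
    obtain ⟨a, ha1, ha2⟩ := (LinearPMap.mem_graph_iff _).1 hp
    obtain ⟨b, hb1, hb2⟩ := (LinearPMap.mem_graph_iff _).1 hq
    rw [← ha1, ← ha2, ← hb1, ← hb2]
    exact hs a b
  have key2 : ∀ q ∈ Q.graph, ⟪p.2, q.1⟫_ℂ = ⟪p.1, q.2⟫_ℂ := by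
    intro q hq
    have hc : IsClosed {p : H × H | ⟪p.2, q.1⟫_ℂ = ⟪p.1, q.2⟫_ℂ} :=
      isClosed_eq (by fun_prop) (by fun_prop)
    exact closure_minimal (fun p hp => key p hp q hq) hc hp
  have hc : IsClosed {q : H × H | ⟪p.2, q.1⟫_ℂ = ⟪p.1, q.2⟫_ℂ} :=
    isClosed_eq (by fun_prop) (by fun_prop)
  exact closure_minimal (fun q hq => key2 q hq) hc hq

/-- If (u, w) lies in the graph of the adjoint, then u = T(Tu + Fw), because T² + F² = 1. Since the
range of T lies in the domain of the closure, the adjoint is no larger than the closure; the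
converse inclusion is symmetry. -/
theorem isSelfAdjoint_closure {Q : H →ₗ.[ℂ] H} (hd : Dense (Q.domain : Set H))
    (hs : Q.IsFormalAdjoint Q) {T F : H →L[ℂ] H} (hT : T.IsPositive)
    (hF : ∀ u v, ⟪F u, v⟫_ℂ = ⟪u, F v⟫_ℂ) (hTF : ∀ u, T (F u) = F (T u))
    (hFF : ∀ u, F (F u) = u - T (T u)) (hg : ∀ u, (T u, F u) ∈ Q.closure.graph) :
    IsSelfAdjoint Q.closure := by
  have hd' : Dense (Q.closure.domain : Set H) := hd.mono (Q.le_closure).1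
  rw [LinearPMap.isSelfAdjoint_def]
  have hle : Q.closure.graph ≤ Q.closure.graph.adjoint := by
    intro p hp
    rw [Submodule.mem_adjoint_iff]
    intro a b hab
    rw [sub_eq_zero]
    exact closure_graph_symmetric hd hs hab hp
  refine LinearPMap.eq_of_eq_graph (le_antisymm ?_ ?_)
  · rw [LinearPMap.adjoint_graph_eq_graph_adjoint hd']
    rintro ⟨u, w⟩ huw
    have huw' := (Submodule.mem_adjoint_iff _ _).1 huw
    have h1 : u = T (T u + F w) := by
      refine ext_inner_left ℂ fun h => ?_
      -- Test against T(Fh), which the closure maps to F(Fh) = h - T²h. As h is arbitrary, this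
      -- determines u.
      have h2 := huw' _ _ (hg (F h))
      simp only [hFF, sub_eq_zero, inner_sub_left] at h2
      rw [sub_eq_iff_eq_add] at h2
      have e1 : ⟪T (F h), w⟫_ℂ = ⟪h, T (F w)⟫_ℂ := by
        rw [hT.inner_left_eq_inner_right, hF, hTF]
      have e2 : ⟪T (T h), u⟫_ℂ = ⟪h, T (T u)⟫_ℂ := by
        rw [hT.inner_left_eq_inner_right, hT.inner_left_eq_inner_right]
      rw [h2, e1, e2, map_add, inner_add_right, add_comm]
    have h2 := hg (T u + F w)
    rw [← h1] at h2
    have h3 := hle h2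
    rw [← LinearPMap.adjoint_graph_eq_graph_adjoint hd'] at h3 huw
    have h4 := LinearPMap.mem_graph_snd_inj _ huw h3 rfl
    rwa [h4]
  · rw [LinearPMap.adjoint_graph_eq_graph_adjoint hd']
    exact hle

/-- Q sends T²u to FTu and FTu = TFu to F²u = u - T²u. So T² is a right inverse of 1 + Q². -/
theorem isApproxSign_closure {Q : H →ₗ.[ℂ] H} {T F : H →L[ℂ] H} (hT : T.IsPositive)
    (hTF : ∀ u, T (F u) = F (T u)) (hFF : ∀ u, F (F u) = u - T (T u))
    (hg : ∀ u, (T u, F u) ∈ Q.closure.graph) : IsApproxSign Q.closure F := by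
  refine ⟨T, hT, fun u => ⟨F (T u), hg (T u), ?_⟩, hg⟩
  have := hg (F u)
  rwa [hTF, hFF] at this

/-- The difference p of T'²u and T²u satisfies Q²p = -p, so ‖Qp‖² = -‖p‖² by symmetry and p = 0.
Positive square roots are unique, hence T' = T, and F' = QT' is determined. -/
theorem isApproxSign_unique {Q : H →ₗ.[ℂ] H} (hd : Dense (Q.domain : Set H))
    (hs : Q.IsFormalAdjoint Q) {T F : H →L[ℂ] H} (hT : T.IsPositive)
    (hTF : ∀ u, T (F u) = F (T u)) (hFF : ∀ u, F (F u) = u - T (T u))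
    (hg : ∀ u, (T u, F u) ∈ Q.closure.graph) {F' : H →L[ℂ] H} (h : IsApproxSign Q.closure F') : F' = F := by
  obtain ⟨T', hT', h1, h2⟩ := h
  have hTT : T' * T' = T * T := by
    ext u
    obtain ⟨y, hy1, hy2⟩ := h1 u
    have h3 := hg (T u)
    have h4 := hg (F u)
    rw [hTF, hFF] at h4
    have h5 := Submodule.sub_mem _ hy1 h3
    have h6 := Submodule.sub_mem _ hy2 h4
    have h7 := closure_graph_symmetric hd hs h5 h6
    simp only [Prod.mk_sub_mk] at h7
    set p := T' (T' u) - T (T u) with hp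
    have h8 : u - T' (T' u) - (u - T (T u)) = -p := by rw [hp]; abel
    rw [h8, inner_neg_right, inner_self_eq_norm_sq_to_K, inner_self_eq_norm_sq_to_K] at h7
    have h9 : ‖y - F (T u)‖ ^ 2 = -‖p‖ ^ 2 := by exact_mod_cast h7
    have h10 : ‖p‖ = 0 := by nlinarith [sq_nonneg ‖y - F (T u)‖, sq_nonneg ‖p‖]
    exact sub_eq_zero.1 (norm_eq_zero.1 h10)
  have hT0 : (0 : H →L[ℂ] H) ≤ T := (ContinuousLinearMap.nonneg_iff_isPositive T).2 hT
  have hT0' : (0 : H →L[ℂ] H) ≤ T' := (ContinuousLinearMap.nonneg_iff_isPositive T').2 hT'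
  have hTT' : T' = T := by
    rw [← CFC.sqrt_mul_self T, ← hTT, CFC.sqrt_mul_self T']
  subst hTT'
  ext u
  exact LinearPMap.mem_graph_snd_inj _ (h2 u) (hg u) rfl

end BoundedTransform

/-! ### Diagonal operators -/

theorem incl_single (r : ℕ) (b : Idx) (v : Fib r) :
    incl r (Finsupp.single b v) = lp.single (E := fun _ : Idx => Fib r) 2 b v := by
  simp only [incl, Finsupp.lsum_single]
  rfl

theorem denseRange_incl (r : ℕ) : DenseRange (incl r) := by
  intro f
  refine mem_closure_of_tendsto (lp.hasSum_single (p := 2) (by simp) f)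
    (Filter.Eventually.of_forall fun s => ?_)
  exact ⟨∑ b ∈ s, Finsupp.single b (f b), by simp only [map_sum, incl_single]⟩

/-- Continuous linear maps on the Hilbert space agree if they agree on the basis. -/
theorem clm_ext_single {r : ℕ} {W : Type*} [NormedAddCommGroup W] [NormedSpace ℂ W]
    {A B : Hil r →L[ℂ] W} (h : ∀ b v, A (incl r (Finsupp.single b v)) = B (incl r (Finsupp.single b v))) :
    A = B := by
  have h' : A.toLinearMap ∘ₗ incl r = B.toLinearMap ∘ₗ incl r := Finsupp.lhom_ext h
  ext f
  exact congrFun ((denseRange_incl r).equalizer A.continuous B.continuous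
    (funext fun f => LinearMap.congr_fun h' f)) f

theorem memlp_diag {r : ℕ} {f : Idx → ℝ} {C : ℝ} (hf : ∀ b, |f b| ≤ C) (v : Hil r) :
    Memℓp (fun b => (f b : ℂ) • v b) 2 := by
  have h : Memℓp (fun b => (C : ℂ) • v b) 2 := (lp.memℓp v).const_smul (C : ℂ)
  refine h.mono' ?_
  intro b
  rw [norm_smul, norm_smul, Complex.norm_real, Complex.norm_real]
  exact mul_le_mul_of_nonneg_right ((hf b).trans (le_abs_self C)) (norm_nonneg _)

theorem norm_le_of_diag {r : ℕ} {f : Idx → ℝ} {C : ℝ} (hC : 0 ≤ C) (hf : ∀ b, |f b| ≤ C)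
    {u v : Hil r} (h : ∀ b, u b = (f b : ℂ) • v b) : ‖u‖ ≤ C * ‖v‖ := by
  have h2 : ‖u‖ ≤ ‖(C : ℂ) • v‖ := by
    refine lp.norm_mono (by simp) fun b => ?_
    rw [h b]
    change _ ≤ ‖(C : ℂ) • v b‖
    rw [norm_smul, norm_smul, Complex.norm_real, Complex.norm_real]
    exact mul_le_mul_of_nonneg_right ((hf b).trans (le_abs_self C)) (norm_nonneg _)
  rwa [norm_smul, Complex.norm_real, Real.norm_of_nonneg hC] at h2

/-- Multiplication by a bounded function. -/
def diagOp (r : ℕ) (f : Idx → ℝ) (hf : ∀ b, |f b| ≤ 1) : Hil r →L[ℂ] Hil r :=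
  LinearMap.mkContinuous
    { toFun := fun v => ⟨fun b => (f b : ℂ) • v b, memlp_diag hf v⟩
      map_add' := fun u v => by ext b : 2; exact smul_add _ _ _
      map_smul' := fun c v => by ext b : 2; exact smul_comm (f b : ℂ) c (v b) } 1
    fun v => norm_le_of_diag zero_le_one hf fun b => rfl

theorem diagOp_apply {r : ℕ} {f : Idx → ℝ} (hf : ∀ b, |f b| ≤ 1) (v : Hil r) (b : Idx) :
    diagOp r f hf v b = (f b : ℂ) • v b := rfl

theorem diagOp_incl_single {r : ℕ} {f : Idx → ℝ} (hf : ∀ b, |f b| ≤ 1) (b : Idx) (v : Fib r) :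
    diagOp r f hf (incl r (Finsupp.single b v)) = incl r (Finsupp.single b ((f b : ℂ) • v)) := by
  classical
  ext c : 2
  rw [diagOp_apply, incl_apply, incl_apply]
  by_cases h : b = c
  · subst h; simp
  · simp [h]

theorem diagOp_isPositive {r : ℕ} {f : Idx → ℝ} (hf : ∀ b, |f b| ≤ 1) (h0 : ∀ b, 0 ≤ f b) :
    (diagOp r f hf).IsPositive := by
  rw [ContinuousLinearMap.isPositive_def]
  refine ⟨fun u v => ?_, fun u => ?_⟩
  · change ⟪diagOp r f hf u, v⟫_ℂ = ⟪u, diagOp r f hf v⟫_ℂ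
    rw [lp.inner_eq_tsum, lp.inner_eq_tsum]
    refine tsum_congr fun b => ?_
    rw [diagOp_apply, diagOp_apply, inner_smul_left, inner_smul_right, Complex.conj_ofReal]
  · rw [ContinuousLinearMap.reApplyInnerSelf_apply, lp.inner_eq_tsum]
    have hs := lp.hasSum_inner (𝕜 := ℂ) (diagOp r f hf u) u
    rw [RCLike.re_eq_complex_re, Complex.re_tsum hs.summable]
    refine tsum_nonneg fun b => ?_
    rw [diagOp_apply, inner_smul_left, Complex.conj_ofReal, Complex.re_ofReal_mul]
    exact mul_nonneg (h0 b) (inner_self_nonneg (𝕜 := ℂ))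

theorem norm_diag_le {r : ℕ} {A : Hil r →L[ℂ] Hil r} {f : Idx → ℝ} (h : ∀ v b, A v b = (f b : ℂ) • v b)
    {C : ℝ} (hC : 0 ≤ C) (hf : ∀ b, |f b| ≤ C) : ‖A‖ ≤ C :=
  A.opNorm_le_bound hC fun v => norm_le_of_diag hC hf (h v)

/-- A diagonal operator with eigenvalues that tend to zero is compact. -/
theorem isCompactOperator_of_diag {r : ℕ} {A : Hil r →L[ℂ] Hil r} {f : Idx → ℝ}
    (h : ∀ v b, A v b = (f b : ℂ) • v b) (hf : ∀ ε > 0, {b | ε < |f b|}.Finite) :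
    IsCompactOperator A := by
  classical
  have hmem : A ∈ closure {B : Hil r →L[ℂ] Hil r | IsCompactOperator B} := by
    refine Metric.mem_closure_iff.2 fun ε hε => ?_
    set s := (hf (ε / 2) (by positivity)).toFinset with hs
    -- Cut A down to the finitely many places with eigenvalue above ε/2. Each `P b` factors through
    -- the finite-dimensional fibre and is therefore compact.
    let P : Idx → (Hil r →L[ℂ] Hil r) := fun b =>
      (lp.singleContinuousLinearMap ℂ (fun _ : Idx => Fib r) 2 b) ∘L
        (lp.evalCLM ℂ (fun _ : Idx => Fib r) 2 b) ∘L A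
    have hP : ∀ b v c, P b v c = if c = b then A v c else 0 := by
      intro b v c
      change lp.single (E := fun _ : Idx => Fib r) 2 b (A v b) c = _
      split_ifs with h
      · subst h; simp
      · rw [lp.single_apply_ne _ _ _ h]
    refine ⟨∑ b ∈ s, P b, ?_, ?_⟩
    · have : ∀ t : Finset Idx, IsCompactOperator (∑ b ∈ t, P b : Hil r →L[ℂ] Hil r) := by
        intro t
        induction t using Finset.induction_on with
        | empty => simpa using isCompactOperator_zero
        | insert b t hb ih =>
          rw [Finset.sum_insert hb]
          refine IsCompactOperator.add ?_ ih
          exact (isCompactOperator_of_locallyCompactSpace_rng (lp.singleContinuousLinearMap ℂ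
            (fun _ : Idx => Fib r) 2 b)).comp_clm _
      exact this s
    · rw [dist_eq_norm]
      refine lt_of_le_of_lt (norm_diag_le (f := fun b => if b ∈ s then 0 else f b) ?_
        (C := ε / 2) (by positivity) ?_) (by linarith)
      · intro v b
        have e1 : (∑ b ∈ s, P b) v b = ∑ c ∈ s, P c v b := by
          rw [sum_apply, lp.coeFn_sum, Finset.sum_apply]
        rw [sub_apply, lp.coeFn_sub, Pi.sub_apply, e1]
        simp only [hP, Finset.sum_ite_eq]
        split_ifs
        · simp
        · rw [sub_zero, h]
      · intro b
        split_ifs with hb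
        · simp; positivity
        · simpa [hs] using hb
  rwa [(isClosed_setOfPred_isCompactOperator).closure_eq] at hmem

/-! ### The supercharge on finite particle states -/

/-- The vector `w ⊗ v`. -/
def fibMap {r : ℕ} (v : Fib r) : (Idx →₀ ℂ) →ₗ[ℂ] (Idx →₀ Fib r) :=
  Finsupp.mapRange.linearMap (LinearMap.toSpanSingleton ℂ (Fib r) v)

theorem fibMap_apply {r : ℕ} (v : Fib r) (w : Idx →₀ ℂ) (b : Idx) : fibMap v w b = w b • v := rfl

theorem fibMap_single {r : ℕ} (v : Fib r) (b : Idx) (c : ℂ) :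
    fibMap v (Finsupp.single b c) = Finsupp.single b (c • v) := by
  simp [fibMap]

theorem superchargeAlg_single (r : ℕ) (x : ℝ) (b : Idx) (v : Fib r) :
    superchargeAlg r x (Finsupp.single b v) = fibMap v (superchargeVec x b) := by
  rw [superchargeAlg, Finsupp.lsum_single, LinearMap.sum_apply]
  conv_rhs => rw [← Finsupp.sum_single (superchargeVec x b), Finsupp.sum, map_sum]
  refine Finset.sum_congr rfl fun b' _ => ?_
  rw [fibMap_single, LinearMap.smul_apply, Finsupp.lsingle_apply, Finsupp.smul_single]

theorem superchargeAlg_fibMap (r : ℕ) (x : ℝ) (v : Fib r) (w : Idx →₀ ℂ) :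
    superchargeAlg r x (fibMap v w) = fibMap v (Finsupp.linearCombination ℂ (superchargeVec x) w) := by
  suffices superchargeAlg r x ∘ₗ fibMap v = fibMap v ∘ₗ Finsupp.linearCombination ℂ (superchargeVec x)
    from LinearMap.congr_fun this w
  refine linearMap_ext_single fun b => ?_
  simp only [LinearMap.comp_apply, fibMap_single, superchargeAlg_single,
    Finsupp.linearCombination_single, one_smul]

theorem superchargeAlg_sq_single (r : ℕ) (x : ℝ) (b : Idx) (v : Fib r) :
    superchargeAlg r x (superchargeAlg r x (Finsupp.single b v)) =
      Finsupp.single b ((energy x b : ℂ) • v) := by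
  rw [superchargeAlg_single, superchargeAlg_fibMap, Finsupp.linearCombination_apply,
    superchargeVec_sq, fibMap_single]

/-- Q commutes with Q², which is diagonal, so Q connects only states of equal energy. This is why T
commutes with Q. -/
theorem energy_eq_of_superchargeVec_ne_zero {x : ℝ} {b b' : Idx} (h : superchargeVec x b b' ≠ 0) :
    energy x b' = energy x b := by
  set L := Finsupp.linearCombination ℂ (superchargeVec x) with hL
  have hLL : ∀ b, L (L (Finsupp.single b 1)) = Finsupp.single b (energy x b : ℂ) := by
    intro b
    rw [hL, Finsupp.linearCombination_single, one_smul, Finsupp.linearCombination_apply,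
      superchargeVec_sq]
  have h1 : L ∘ₗ L = Finsupp.lsum ℂ (fun b => (energy x b : ℂ) • Finsupp.lsingle b) := by
    refine linearMap_ext_single fun b => ?_
    rw [LinearMap.comp_apply, hLL]
    simp
  have h2 : ∀ (w : Idx →₀ ℂ) c, L (L w) c = energy x c * w c := by
    intro w c
    have := LinearMap.congr_fun h1 w
    rw [LinearMap.comp_apply] at this
    rw [this]
    classical
    induction w using Finsupp.induction_linear with
    | zero => simp
    | add f g hf hg => 
      simp only [map_add, Finsupp.add_apply] at *
      rw [hf (LinearMap.congr_fun h1 f), hg (LinearMap.congr_fun h1 g)]; ring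
    | single a d =>
      by_cases hac : a = c
      · subst hac; simp
      · simp [hac]
  have h3 : L (L (superchargeVec x b)) b' = energy x b' * superchargeVec x b b' := h2 _ _
  have h4 : L (superchargeVec x b) = (energy x b : ℂ) • Finsupp.single b 1 := by
    have := hLL b
    rw [hL, Finsupp.linearCombination_single, one_smul] at this
    rw [hL, this]
    simp
  rw [h4, map_smul, hL, Finsupp.linearCombination_single, one_smul, Finsupp.smul_apply, smul_eq_mul]
    at h3
  exact_mod_cast (mul_right_cancel₀ h h3).symm

theorem inner_incl_single (r : ℕ) (f : Idx →₀ Fib r) (b : Idx) (v : Fib r) :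
    ⟪incl r f, incl r (Finsupp.single b v)⟫_ℂ = ⟪f b, v⟫_ℂ := by
  classical
  rw [incl_single, lp.inner_single_right, incl_apply]

theorem inner_incl_single_left (r : ℕ) (f : Idx →₀ Fib r) (b : Idx) (v : Fib r) :
    ⟪incl r (Finsupp.single b v), incl r f⟫_ℂ = ⟪v, f b⟫_ℂ := by
  classical
  rw [incl_single, lp.inner_single_left, incl_apply]

theorem superchargeAlg_symm (r : ℕ) (x : ℝ) (f g : Idx →₀ Fib r) :
    ⟪incl r (superchargeAlg r x f), incl r g⟫_ℂ = ⟪incl r f, incl r (superchargeAlg r x g)⟫_ℂ := by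
  induction f using Finsupp.induction_linear with
  | zero => simp
  | add f₁ f₂ h₁ h₂ => simp only [map_add, inner_add_left, h₁, h₂]
  | single b v =>
    induction g using Finsupp.induction_linear with
    | zero => simp
    | add f₁ f₂ h₁ h₂ => simp only [map_add, inner_add_right, h₁, h₂]
    | single c w =>
      rw [inner_incl_single, inner_incl_single_left, superchargeAlg_single, superchargeAlg_single,
        fibMap_apply, fibMap_apply, inner_smul_left, inner_smul_right, superchargeVec_conj x c b]

theorem mem_superchargeCore_graph (r : ℕ) (x : ℝ) (f : Idx →₀ Fib r) :
    (incl r f, incl r (superchargeAlg r x f)) ∈ (superchargeCore r x).graph := by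
  rw [LinearPMap.mem_graph_iff]
  refine ⟨⟨incl r f, f, rfl⟩, rfl, ?_⟩
  change incl r (superchargeAlg r x ((LinearEquiv.ofInjective (incl r) (incl_injective r)).symm
    ⟨incl r f, f, rfl⟩)) = _
  congr 2
  rw [LinearEquiv.symm_apply_eq]
  rfl

theorem superchargeCore_isFormalAdjoint (r : ℕ) (x : ℝ) :
    (superchargeCore r x).IsFormalAdjoint (superchargeCore r x) := by
  rintro ⟨_, f, rfl⟩ ⟨_, g, rfl⟩
  have key : ∀ f, superchargeCore r x ⟨incl r f, f, rfl⟩ = incl r (superchargeAlg r x f) := by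
    intro f
    exact LinearPMap.mem_graph_snd_inj _
      (LinearPMap.mem_graph (superchargeCore r x) ⟨incl r f, f, rfl⟩)
      (mem_superchargeCore_graph r x f) rfl
  rw [key, key]
  exact superchargeAlg_symm r x f g

theorem superchargeCore_dense (r : ℕ) (x : ℝ) : Dense ((superchargeCore r x).domain : Set (Hil r)) := by
  have := denseRange_incl r
  rwa [DenseRange, ← LinearMap.coe_range] at this

/-! ### The bounded transform of the supercharge -/

/-- The eigenvalues of `(1 + Q²)^(-1/2)`. -/
def damp (x : ℝ) (b : Idx) : ℝ := (Real.sqrt (1 + energy x b))⁻¹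

theorem damp_nonneg (x : ℝ) (b : Idx) : 0 ≤ damp x b := by
  unfold damp; positivity

theorem damp_mul_self (x : ℝ) (b : Idx) : damp x b * damp x b = (1 + energy x b)⁻¹ := by
  have := energy_nonneg x b
  rw [damp, ← mul_inv, Real.mul_self_sqrt (by positivity)]

theorem abs_damp_le (x : ℝ) (b : Idx) : |damp x b| ≤ 1 := by
  have h := energy_nonneg x b
  rw [abs_of_nonneg (damp_nonneg x b), damp]
  refine inv_le_one_of_one_le₀ ?_
  rw [Real.one_le_sqrt]
  linarith

/-- `(1 + Q²)^(-1/2)` on finite particle states. -/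
def dampAlg (r : ℕ) (x : ℝ) : (Idx →₀ Fib r) →ₗ[ℂ] (Idx →₀ Fib r) :=
  Finsupp.lsum ℂ fun b => (damp x b : ℂ) • Finsupp.lsingle b

theorem dampAlg_single (r : ℕ) (x : ℝ) (b : Idx) (v : Fib r) :
    dampAlg r x (Finsupp.single b v) = Finsupp.single b ((damp x b : ℂ) • v) := by
  simp [dampAlg]

/-- `(1 + Q²)^(-1/2)`. -/
def dampOp (r : ℕ) (x : ℝ) : Hil r →L[ℂ] Hil r := diagOp r (damp x) (abs_damp_le x)

theorem dampOp_incl (r : ℕ) (x : ℝ) (f : Idx →₀ Fib r) :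
    dampOp r x (incl r f) = incl r (dampAlg r x f) := by
  suffices (dampOp r x).toLinearMap ∘ₗ incl r = incl r ∘ₗ dampAlg r x from LinearMap.congr_fun this f
  refine Finsupp.lhom_ext fun b v => ?_
  simp only [LinearMap.comp_apply, dampAlg_single]
  exact diagOp_incl_single _ b v

theorem dampAlg_fibMap_superchargeVec (r : ℕ) (x : ℝ) (b : Idx) (v : Fib r) :
    dampAlg r x (fibMap v (superchargeVec x b)) =
      (damp x b : ℂ) • fibMap v (superchargeVec x b) := by
  conv_lhs => rw [← Finsupp.sum_single (superchargeVec x b), Finsupp.sum, map_sum, map_sum]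
  conv_rhs => rw [← Finsupp.sum_single (superchargeVec x b), Finsupp.sum, map_sum, Finset.smul_sum]
  refine Finset.sum_congr rfl fun b' hb' => ?_
  rw [fibMap_single, dampAlg_single, Finsupp.smul_single, damp, damp,
    energy_eq_of_superchargeVec_ne_zero (Finsupp.mem_support_iff.1 hb')]

theorem dampAlg_superchargeAlg (r : ℕ) (x : ℝ) (f : Idx →₀ Fib r) :
    dampAlg r x (superchargeAlg r x f) = superchargeAlg r x (dampAlg r x f) := by
  suffices dampAlg r x ∘ₗ superchargeAlg r x = superchargeAlg r x ∘ₗ dampAlg r x from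
    LinearMap.congr_fun this f
  refine Finsupp.lhom_ext fun b v => ?_
  simp only [LinearMap.comp_apply, dampAlg_single]
  rw [superchargeAlg_single, dampAlg_fibMap_superchargeVec, ← Finsupp.smul_single, map_smul,
    superchargeAlg_single]

theorem superchargeAlg_sq_damp_sq (r : ℕ) (x : ℝ) (f : Idx →₀ Fib r) :
    superchargeAlg r x (superchargeAlg r x (dampAlg r x (dampAlg r x f))) =
      f - dampAlg r x (dampAlg r x f) := by
  suffices superchargeAlg r x ∘ₗ superchargeAlg r x ∘ₗ dampAlg r x ∘ₗ dampAlg r x =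
      LinearMap.id - dampAlg r x ∘ₗ dampAlg r x from LinearMap.congr_fun this f
  refine Finsupp.lhom_ext fun b v => ?_
  simp only [LinearMap.comp_apply, dampAlg_single, superchargeAlg_sq_single, LinearMap.sub_apply,
    LinearMap.id_apply, ← Finsupp.single_sub, smul_smul]
  congr 1
  have h := energy_nonneg x b
  have h2 : (energy x b * (damp x b * damp x b) : ℝ) = 1 - damp x b * damp x b := by
    rw [damp_mul_self]; field_simp; ring
  have h3 : (energy x b : ℂ) * (damp x b * damp x b) = 1 - damp x b * damp x b := by exact_mod_cast h2
  rw [h3, sub_smul, one_smul]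

/-- Moving Q and T across the inner product yields ‖QTf‖² = ⟨f, Q²T²f⟩ = ‖f‖² - ‖Tf‖². -/
theorem norm_superchargeAlg_dampAlg_le (r : ℕ) (x : ℝ) (f : Idx →₀ Fib r) :
    ‖incl r (superchargeAlg r x (dampAlg r x f))‖ ≤ 1 * ‖incl r f‖ := by
  have hpos := diagOp_isPositive (r := r) (abs_damp_le x) (damp_nonneg x)
  have h1 : ⟪incl r (superchargeAlg r x (dampAlg r x f)), incl r (superchargeAlg r x (dampAlg r x f))⟫_ℂ
      = ⟪incl r f, incl r f⟫_ℂ - ⟪incl r (dampAlg r x f), incl r (dampAlg r x f)⟫_ℂ := by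
    have hsymm : ∀ f g, ⟪incl r (dampAlg r x f), incl r g⟫_ℂ = ⟪incl r f, incl r (dampAlg r x g)⟫_ℂ := by
      intro f g
      rw [← dampOp_incl, ← dampOp_incl]
      exact hpos.inner_left_eq_inner_right _ _
    rw [superchargeAlg_symm, hsymm, hsymm, dampAlg_superchargeAlg, dampAlg_superchargeAlg,
      superchargeAlg_sq_damp_sq, map_sub, inner_sub_right]
  rw [inner_self_eq_norm_sq_to_K, inner_self_eq_norm_sq_to_K, inner_self_eq_norm_sq_to_K] at h1
  have h2 : ‖incl r (superchargeAlg r x (dampAlg r x f))‖ ^ 2 =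
      ‖incl r f‖ ^ 2 - ‖incl r (dampAlg r x f)‖ ^ 2 := by exact_mod_cast h1
  rw [one_mul]
  refine le_of_sq_le_sq ?_ (norm_nonneg _)
  nlinarith [sq_nonneg ‖incl r (dampAlg r x f)‖]

/-- The bounded transform `Q (1 + Q²)^(-1/2)` of the supercharge. -/
def boundedSupercharge (r : ℕ) (x : ℝ) : Hil r →L[ℂ] Hil r :=
  (incl r ∘ₗ superchargeAlg r x ∘ₗ dampAlg r x).extendOfNorm (incl r)

theorem boundedSupercharge_incl (r : ℕ) (x : ℝ) (f : Idx →₀ Fib r) :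
    boundedSupercharge r x (incl r f) = incl r (superchargeAlg r x (dampAlg r x f)) :=
  LinearMap.extendOfNorm_eq (denseRange_incl r) ⟨1, norm_superchargeAlg_dampAlg_le r x⟩ f

theorem norm_boundedSupercharge_apply_le (r : ℕ) (x : ℝ) (u : Hil r) :
    ‖boundedSupercharge r x u‖ ≤ ‖u‖ := by
  have := LinearMap.norm_extendOfNorm_apply_le
    (f := incl r ∘ₗ superchargeAlg r x ∘ₗ dampAlg r x) (denseRange_incl r) 1
    (norm_superchargeAlg_dampAlg_le r x) u
  rwa [one_mul] at this

theorem boundedSupercharge_symm (r : ℕ) (x : ℝ) (u v : Hil r) :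
    ⟪boundedSupercharge r x u, v⟫_ℂ = ⟪u, boundedSupercharge r x v⟫_ℂ := by
  have hpos := diagOp_isPositive (r := r) (abs_damp_le x) (damp_nonneg x)
  refine (denseRange_incl r).induction_on₂ (p := fun u v =>
    ⟪boundedSupercharge r x u, v⟫_ℂ = ⟪u, boundedSupercharge r x v⟫_ℂ) ?_ ?_ u v
  · exact isClosed_eq (by fun_prop) (by fun_prop)
  · intro f g
    rw [boundedSupercharge_incl, boundedSupercharge_incl, superchargeAlg_symm,
      ← dampAlg_superchargeAlg, ← dampOp_incl, ← dampOp_incl]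
    exact hpos.inner_left_eq_inner_right _ _

theorem dampOp_boundedSupercharge (r : ℕ) (x : ℝ) (u : Hil r) :
    dampOp r x (boundedSupercharge r x u) = boundedSupercharge r x (dampOp r x u) := by
  refine (denseRange_incl r).induction_on (p := fun u =>
    dampOp r x (boundedSupercharge r x u) = boundedSupercharge r x (dampOp r x u)) u ?_ ?_
  · exact isClosed_eq (by fun_prop) (by fun_prop)
  · intro f
    rw [boundedSupercharge_incl, dampOp_incl, dampOp_incl, boundedSupercharge_incl,
      dampAlg_superchargeAlg]

theorem boundedSupercharge_sq (r : ℕ) (x : ℝ) (u : Hil r) :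
    boundedSupercharge r x (boundedSupercharge r x u) = u - dampOp r x (dampOp r x u) := by
  refine (denseRange_incl r).induction_on (p := fun u =>
    boundedSupercharge r x (boundedSupercharge r x u) = u - dampOp r x (dampOp r x u)) u ?_ ?_
  · exact isClosed_eq (by fun_prop) (by fun_prop)
  · intro f
    rw [boundedSupercharge_incl, boundedSupercharge_incl, dampOp_incl, dampOp_incl,
      dampAlg_superchargeAlg, superchargeAlg_sq_damp_sq, map_sub]

/-- For finite particle states the pair lies in the graph of the core. The general case follows by
density, since the pair is continuous in u and the graph of the closure is closed. -/
theorem mem_supercharge_graph (r : ℕ) (x : ℝ) (u : Hil r) :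
    (dampOp r x u, boundedSupercharge r x u) ∈ (superchargeCore r x).closure.graph := by
  have hcl := (isClosable_of_symmetric (superchargeCore_dense r x)
    (superchargeCore_isFormalAdjoint r x)).closure_isClosed
  refine (denseRange_incl r).induction_on (p := fun u =>
    (dampOp r x u, boundedSupercharge r x u) ∈ (superchargeCore r x).closure.graph) u ?_ ?_
  · exact hcl.preimage (f := fun u => (dampOp r x u, boundedSupercharge r x u)) (by fun_prop)
  · intro f
    rw [boundedSupercharge_incl, dampOp_incl]
    exact LinearPMap.le_graph_of_le (LinearPMap.le_closure _) (mem_superchargeCore_graph r x _)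

theorem supercharge_isSelfAdjoint (r : ℕ) (x : ℝ) : IsSelfAdjoint (supercharge r x) :=
  isSelfAdjoint_closure (superchargeCore_dense r x) (superchargeCore_isFormalAdjoint r x)
    (diagOp_isPositive (abs_damp_le x) (damp_nonneg x)) (boundedSupercharge_symm r x)
    (dampOp_boundedSupercharge r x) (boundedSupercharge_sq r x) (mem_supercharge_graph r x)

theorem isApproxSign_supercharge (r : ℕ) (x : ℝ) :
    IsApproxSign (supercharge r x) (boundedSupercharge r x) :=
  isApproxSign_closure (diagOp_isPositive (abs_damp_le x) (damp_nonneg x))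
    (dampOp_boundedSupercharge r x) (boundedSupercharge_sq r x) (mem_supercharge_graph r x)

theorem eq_boundedSupercharge (r : ℕ) (x : ℝ) {F : Hil r →L[ℂ] Hil r}
    (h : IsApproxSign (supercharge r x) F) : F = boundedSupercharge r x :=
  isApproxSign_unique (superchargeCore_dense r x) (superchargeCore_isFormalAdjoint r x)
    (diagOp_isPositive (abs_damp_le x) (damp_nonneg x))
    (dampOp_boundedSupercharge r x) (boundedSupercharge_sq r x) (mem_supercharge_graph r x) h

theorem approxSign_supercharge (r : ℕ) (x : ℝ) :
    approxSign (supercharge r x) = boundedSupercharge r x := by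
  have h : ∃ F, IsApproxSign (supercharge r x) F := ⟨_, isApproxSign_supercharge r x⟩
  rw [approxSign, dif_pos h]
  exact eq_boundedSupercharge r x h.choose_spec

/-! ### Continuity and compactness of the bounded transform -/

theorem continuous_energy (b : Idx) : Continuous fun x => energy x b := by
  unfold energy
  fun_prop

theorem continuous_damp (b : Idx) : Continuous fun x => damp x b := by
  unfold damp
  refine Continuous.inv₀ ((continuous_const.add (continuous_energy b)).sqrt) fun x => ?_
  have := energy_nonneg x b
  positivity

theorem boundedSupercharge_incl_single (r : ℕ) (x : ℝ) (b : Idx) (v : Fib r) :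
    boundedSupercharge r x (incl r (Finsupp.single b v)) =
      (damp x b : ℂ) • incl r (fibMap v (superchargeVec x b)) := by
  rw [boundedSupercharge_incl, dampAlg_single, ← Finsupp.smul_single, map_smul, map_smul,
    superchargeAlg_single]

/-- On a basis vector, x enters only through the scalar `damp` and a term affine in x. Uniform
contractivity carries continuity over to all vectors. -/
theorem continuous_boundedSupercharge_apply (r : ℕ) (u : Hil r) :
    Continuous fun x => boundedSupercharge r x u := by
  have h1 : ∀ f : Idx →₀ Fib r, Continuous fun x => boundedSupercharge r x (incl r f) := by
    intro f
    induction f using Finsupp.induction_linear with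
    | zero => simpa using continuous_const
    | add f g hf hg =>
      simp only [map_add]
      exact hf.add hg
    | single b v =>
      simp only [boundedSupercharge_incl_single, superchargeVec, map_add, map_smul]
      have := continuous_damp b
      fun_prop
  rw [Metric.continuous_iff]
  intro x ε hε
  obtain ⟨f, hf⟩ := (denseRange_incl r).exists_dist_lt u (show 0 < ε / 3 by positivity)
  obtain ⟨η, hη, hx⟩ := Metric.continuous_iff.1 (h1 f) x (ε / 3) (by positivity)
  refine ⟨η, hη, fun y hy => ?_⟩
  have hb : ∀ y, dist (boundedSupercharge r y u) (boundedSupercharge r y (incl r f)) < ε / 3 := by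
    intro y
    rw [dist_eq_norm, ← map_sub]
    refine (norm_boundedSupercharge_apply_le r y _).trans_lt ?_
    rwa [← dist_eq_norm]
  calc dist (boundedSupercharge r y u) (boundedSupercharge r x u)
      ≤ dist (boundedSupercharge r y u) (boundedSupercharge r y (incl r f)) +
        dist (boundedSupercharge r y (incl r f)) (boundedSupercharge r x (incl r f)) +
        dist (boundedSupercharge r x (incl r f)) (boundedSupercharge r x u) := dist_triangle4 _ _ _ _
    _ < ε / 3 + ε / 3 + ε / 3 := by
        have h2 := hb x
        rw [dist_comm] at h2
        exact add_lt_add (add_lt_add (hb y) (hx y hy)) h2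
    _ = ε := by ring

theorem dampOp_sq_apply (r : ℕ) (x : ℝ) (u : Hil r) (b : Idx) :
    (dampOp r x * dampOp r x) u b = (((1 + energy x b)⁻¹ : ℝ) : ℂ) • u b := by
  change dampOp r x (dampOp r x u) b = _
  rw [dampOp, diagOp_apply, diagOp_apply, smul_smul, ← damp_mul_self]
  push_cast
  rfl

theorem isCompactOperator_dampOp_sq (r : ℕ) (x : ℝ) :
    IsCompactOperator (dampOp r x * dampOp r x : Hil r →L[ℂ] Hil r) := by
  refine isCompactOperator_of_diag (dampOp_sq_apply r x) fun ε hε => ?_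
  refine (finite_energy_le x ε⁻¹).subset fun b hb => ?_
  have h := energy_nonneg x b
  have hb' : ε < |(1 + energy x b)⁻¹| := hb
  rw [abs_of_pos (by positivity), lt_inv_comm₀ hε (by positivity)] at hb'
  have : energy x b ≤ ε⁻¹ := by linarith
  exact this

/-- The bound does not depend on c, hence it is uniform over all states; this makes T² norm
continuous in x. It comes from |s + t| ≤ (1 + s²)(1 + t²). -/
theorem abs_inv_sub_inv_le (s t c : ℝ) (hc : 0 ≤ c) :
    |(1 + (s ^ 2 + c))⁻¹ - (1 + (t ^ 2 + c))⁻¹| ≤ |s - t| := by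
  have h1 : 0 < 1 + (s ^ 2 + c) := by positivity
  have h2 : 0 < 1 + (t ^ 2 + c) := by positivity
  rw [inv_sub_inv h1.ne' h2.ne', abs_div, abs_of_pos (mul_pos h1 h2), div_le_iff₀ (mul_pos h1 h2)]
  have e : 1 + (t ^ 2 + c) - (1 + (s ^ 2 + c)) = (s - t) * (-(s + t)) := by ring
  rw [e, abs_mul]
  refine mul_le_mul_of_nonneg_left ?_ (abs_nonneg _)
  have h3 : 1 + s ^ 2 ≤ 1 + (s ^ 2 + c) := by linarith
  have h4 : 1 + t ^ 2 ≤ 1 + (t ^ 2 + c) := by linarith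
  have h5 : (1 + s ^ 2) * (1 + t ^ 2) ≤ (1 + (s ^ 2 + c)) * (1 + (t ^ 2 + c)) := by gcongr
  refine le_trans ?_ h5
  rw [abs_le]
  constructor <;>
    nlinarith [sq_nonneg (s - 1), sq_nonneg (s + 1), sq_nonneg (t - 1), sq_nonneg (t + 1),
      mul_nonneg (sq_nonneg s) (sq_nonneg t)]

theorem continuous_dampOp_sq (r : ℕ) :
    Continuous fun x => (dampOp r x * dampOp r x : Hil r →L[ℂ] Hil r) := by
  refine (LipschitzWith.of_dist_le_mul (K := ⟨(2 * Real.pi)⁻¹, by positivity⟩) fun x y => ?_).continuous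
  rw [dist_eq_norm]
  refine norm_diag_le (f := fun b => (1 + energy x b)⁻¹ - (1 + energy y b)⁻¹) ?_
    (mul_nonneg (NNReal.coe_nonneg _) dist_nonneg) ?_
  · intro u b
    rw [sub_apply, lp.coeFn_sub, Pi.sub_apply, dampOp_sq_apply, dampOp_sq_apply, ← sub_smul]
    push_cast
    rfl
  · intro b
    have h0 : (0 : ℝ) ≤ 2 * (inversions b.2).ncard + 2 * ∑ m ∈ b.1, ((m : ℝ) + 1) := by positivity
    have := abs_inv_sub_inv_le (charge b.2 + x / (2 * Real.pi)) (charge b.2 + y / (2 * Real.pi)) _ h0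
    simp only [energy, add_assoc] at this ⊢
    refine this.trans (le_of_eq ?_)
    rw [show (charge b.2 : ℝ) + x / (2 * Real.pi) - (charge b.2 + y / (2 * Real.pi)) =
      (2 * Real.pi)⁻¹ * (x - y) by ring, abs_mul, abs_of_pos (by positivity), Real.dist_eq]
    rfl

/-! ### Equivariance of the bounded transform -/

theorem ncard_inversions_shift (D : Finset ℤ) :
    (inversions (shift D)).ncard = (inversions D).ncard := by
  have : inversions (shift D) = (fun p : ℤ × ℤ => (p.1 + 1, p.2 + 1)) '' inversions D := by
    ext ⟨i, j⟩
    constructor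
    · rintro ⟨h1, h2, h3⟩
      simp only at h1
      rw [occ_shift] at h2 h3
      exact ⟨(i - 1, j - 1), ⟨by simp only; omega, h2, h3⟩, by simp⟩
    · rintro ⟨⟨i', j'⟩, ⟨h1, h2, h3⟩, h⟩
      simp only [Prod.mk.injEq] at h
      obtain ⟨rfl, rfl⟩ := h
      simp only at h1
      refine ⟨by simp only; omega, ?_, ?_⟩ <;> rw [occ_shift] <;> simpa
  rw [this, Set.ncard_image_of_injective]
  rintro ⟨i, j⟩ ⟨i', j'⟩ h
  simpa using h

theorem ncard_inversions_shift_zpow (n : ℤ) (D : Finset ℤ) :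
    (inversions ((shift ^ n) D)).ncard = (inversions D).ncard := by
  have hneg : ∀ D, (inversions (shift⁻¹ D)).ncard = (inversions D).ncard := fun D => by
    have := ncard_inversions_shift (shift⁻¹ D)
    rw [← Equiv.Perm.mul_apply, mul_inv_cancel, Equiv.Perm.one_apply] at this
    exact this.symm
  induction n generalizing D with
  | zero => simp
  | succ n ih => rw [zpow_add_one, Equiv.Perm.mul_apply, ih, ncard_inversions_shift]
  | pred n ih => rw [zpow_sub_one, Equiv.Perm.mul_apply, ih, hneg]

theorem superchargeVec_shift_zpow (n : ℤ) (x : ℝ) (A A' : Finset ℕ) (D D' : Finset ℤ) :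
    superchargeVec (x - 2 * Real.pi * n) (A, (shift ^ n) D) (A', (shift ^ n) D') =
      superchargeVec x (A, D) (A', D') := by
  have hneg : ∀ x D D', superchargeVec x (A, shift⁻¹ D) (A', shift⁻¹ D') =
      superchargeVec (x - 2 * Real.pi) (A, D) (A', D') := fun x D D' => by
    have := superchargeVec_shift (x - 2 * Real.pi) A A' (shift⁻¹ D) (shift⁻¹ D')
    rw [← Equiv.Perm.mul_apply, ← Equiv.Perm.mul_apply, mul_inv_cancel, Equiv.Perm.one_apply,
      Equiv.Perm.one_apply, sub_add_cancel] at this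
    exact this.symm
  induction n generalizing D D' x with
  | zero => simp
  | succ n ih =>
    rw [zpow_add_one, Equiv.Perm.mul_apply, Equiv.Perm.mul_apply]
    have := ih (x - 2 * Real.pi) (shift D) (shift D')
    rw [superchargeVec_shift, sub_add_cancel] at this
    rw [← this]
    congr 1
    push_cast
    ring_nf
  | pred n ih =>
    rw [zpow_sub_one, Equiv.Perm.mul_apply, Equiv.Perm.mul_apply]
    have := ih (x + 2 * Real.pi) (shift⁻¹ D) (shift⁻¹ D')
    rw [hneg, add_sub_cancel_right] at this
    rw [← this]
    congr 1
    push_cast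
    ring_nf

theorem energy_shift_zpow (n : ℤ) (x : ℝ) (A : Finset ℕ) (D : Finset ℤ) :
    energy (x - 2 * Real.pi * n) (A, (shift ^ n) D) = energy x (A, D) := by
  simp only [energy, ncard_inversions_shift_zpow, charge_shift_zpow]
  have : ((charge D + n : ℤ) : ℝ) + (x - 2 * Real.pi * n) / (2 * Real.pi) =
      charge D + x / (2 * Real.pi) := by
    push_cast
    field_simp
    ring
  rw [this]

/-- The transition operators intertwine the bounded transforms. -/
theorem boundedSupercharge_fockTrans (r : ℕ) (c : ℤ) (g : Circle) (h : unitary (Fib r →L[ℂ] Fib r))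
    (x : ℝ) (u : Hil r) :
    boundedSupercharge r (x - 2 * Real.pi * c) (fockTrans r c g h u) =
      fockTrans r c g h (boundedSupercharge r x u) := by
  classical
  suffices boundedSupercharge r (x - 2 * Real.pi * c) ∘L
      (fockTrans r c g h).toContinuousLinearEquiv.toContinuousLinearMap =
      (fockTrans r c g h).toContinuousLinearEquiv.toContinuousLinearMap ∘L boundedSupercharge r x from
    congrArg (fun A : Hil r →L[ℂ] Hil r => A u) this
  refine clm_ext_single fun b v => ?_
  change boundedSupercharge r (x - 2 * Real.pi * c) (fockTrans r c g h (incl r (Finsupp.single b v))) =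
    fockTrans r c g h (boundedSupercharge r x (incl r (Finsupp.single b v)))
  rw [boundedSupercharge_incl_single, incl_single, fockTrans_single, ← incl_single,
    boundedSupercharge_incl_single, map_smul, damp, damp, energy_shift_zpow]
  congr 1
  ext1
  funext ⟨A, D⟩
  rw [fockTrans_apply, incl_apply, incl_apply, fibMap_apply, fibMap_apply]
  obtain ⟨D', rfl⟩ := (shift ^ c).surjective D
  have hinv : (shift ^ c)⁻¹ ((shift ^ c) D') = D' := by
    rw [← Equiv.Perm.mul_apply, inv_mul_cancel, Equiv.Perm.one_apply]
  rw [superchargeVec_shift_zpow, hinv]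
  -- Nonzero matrix entries preserve the charge, so the phases g^N on the two sides coincide.
  by_cases h0 : superchargeVec x b (A, D') = 0
  · simp [h0]
  · have hch : charge D' = charge b.2 := charge_eq_of_superchargeVec_ne_zero h0
    rw [hch, map_smul]
    exact smul_comm _ _ _

/-! ### The angular coordinate -/

theorem re_ne_zero_of_abs_im_lt {z : Circle} (h1 : -1 < (z : ℂ).im) (h2 : (z : ℂ).im < 1) :
    (z : ℂ).re ≠ 0 := by
  have hn : (z : ℂ).re * (z : ℂ).re + (z : ℂ).im * (z : ℂ).im = 1 := by
    rw [← Complex.normSq_apply, Circle.normSq_coe]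
  intro h0
  rw [h0] at hn
  nlinarith

/-- The sign of Re z = Im(iz) decides whether negating iz changes its argument by π or by -π.
Together with the offsets π/2 and 3π/2 this makes the coordinates agree on the left and differ by 2π
on the right. -/
theorem angle_down_sub_angle_up {z : Circle} (h0 : (z : ℂ).re ≠ 0) :
    angle Side.down z = angle Side.up z + if 0 < (z : ℂ).re then 2 * Real.pi else 0 := by
  have e : -Complex.I * z = -(Complex.I * z) := by ring
  have him : (Complex.I * (z : ℂ)).im = (z : ℂ).re := by simp
  simp only [angle, e]
  split_ifs with h
  · rw [Complex.arg_neg_eq_arg_sub_pi_of_im_pos (by rwa [him])]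
    ring
  · rw [Complex.arg_neg_eq_arg_add_pi_of_im_neg (by rw [him]; exact lt_of_le_of_ne (not_lt.1 h) h0)]
    ring

/-- On the overlap δ ≤ 1 excludes ±i, so Re z ≠ 0 and the jump of the angle is exactly what the
shift to the power of the cocycle compensates. -/
theorem angle_eq_sub_winding {δ : ℝ} (hδ : δ ≤ 1) (s t : Side) (z : Circle) (hs : z ∈ arc δ s)
    (ht : z ∈ arc δ t) : angle t z = angle s z - 2 * Real.pi * winding s t z := by
  have key : z ∈ arc δ Side.up → z ∈ arc δ Side.down → (z : ℂ).re ≠ 0 := fun h1 h2 => by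
    have h1' : -δ < (z : ℂ).im := h1
    have h2' : (z : ℂ).im < δ := h2
    exact re_ne_zero_of_abs_im_lt (by linarith) (by linarith)
  cases s <;> cases t
  · simp [winding]
  · rw [angle_down_sub_angle_up (key hs ht)]
    simp only [winding]
    split_ifs <;> push_cast <;> ring
  · rw [angle_down_sub_angle_up (key ht hs)]
    simp only [winding]
    split_ifs <;> push_cast <;> ring
  · simp [winding]

/-- The branch cut of the upper coordinate is at -i and that of the lower one at i; both lie outside
the respective arc because δ ≤ 1. -/
theorem continuousOn_angle {δ : ℝ} (hδ : δ ≤ 1) (s : Side) : ContinuousOn (angle s) (arc δ s) := by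
  intro z hz
  refine ContinuousAt.continuousWithinAt ?_
  have hcoe : Continuous fun z : Circle => (z : ℂ) := continuous_subtype_val
  have hn : (z : ℂ).re * (z : ℂ).re + (z : ℂ).im * (z : ℂ).im = 1 := by
    rw [← Complex.normSq_apply, Circle.normSq_coe]
  cases s
  · have hz' : -δ < (z : ℂ).im := hz
    have h : -Complex.I * (z : ℂ) ∈ Complex.slitPlane := by
      rw [Complex.mem_slitPlane_iff]
      by_cases h0 : (z : ℂ).re = 0
      · left
        rw [h0] at hn
        simp
        nlinarith
      · right
        simpa using h0
    exact (ContinuousAt.comp (f := fun z : Circle => -Complex.I * (z : ℂ)) (g := Complex.arg)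
      (Complex.continuousAt_arg h) (by fun_prop)).add continuousAt_const
  · have hz' : (z : ℂ).im < δ := hz
    have h : Complex.I * (z : ℂ) ∈ Complex.slitPlane := by
      rw [Complex.mem_slitPlane_iff]
      by_cases h0 : (z : ℂ).re = 0
      · left
        rw [h0] at hn
        simp
        nlinarith
      · right
        simpa using h0
    exact (ContinuousAt.comp (f := fun z : Circle => Complex.I * (z : ℂ)) (g := Complex.arg)
      (Complex.continuousAt_arg h) (by fun_prop)).add continuousAt_const

/-! ### The suspended family -/

section Suspension

variable {H : Type*} [NormedAddCommGroup H] [InnerProductSpace ℂ H]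

/-- The suspension loop as a function on the circle. -/
def suspCircle (A : H →L[ℂ] H) (w : Circle) : H →L[ℂ] H :=
  ((w : ℂ).re : ℂ) • 1 + (Complex.I * (max (w : ℂ).im 0 : ℝ)) • A + (Complex.I * (min (w : ℂ).im 0 : ℝ)) • 1

/-- The parametrix of the suspension loop. -/
def suspCirclePar (A : H →L[ℂ] H) (w : Circle) : H →L[ℂ] H :=
  ((w : ℂ).re : ℂ) • 1 - (Complex.I * (max (w : ℂ).im 0 : ℝ)) • A - (Complex.I * (min (w : ℂ).im 0 : ℝ)) • 1

/-- The positive part of sin s multiplies A and the negative part multiplies 1. This turns the case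
distinction in `susp` into one formula that is visibly continuous on the circle. -/
theorem suspCircle_exp (A : H →L[ℂ] H) {s : ℝ} (hs : s ∈ Set.Icc 0 (2 * Real.pi)) :
    suspCircle A (Circle.exp s) = susp A s := by
  have hre : ((Circle.exp s : Circle) : ℂ).re = Real.cos s := by
    rw [Circle.coe_exp, Complex.exp_ofReal_mul_I_re]
  have him : ((Circle.exp s : Circle) : ℂ).im = Real.sin s := by
    rw [Circle.coe_exp, Complex.exp_ofReal_mul_I_im]
  rw [suspCircle, susp, hre, him]
  split_ifs with h
  · have := Real.sin_nonneg_of_nonneg_of_le_pi hs.1 h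
    rw [max_eq_left this, min_eq_right this]
    simp
  · have : Real.sin s ≤ 0 := by
      have h2 := Real.sin_nonneg_of_nonneg_of_le_pi (x := s - Real.pi) (by linarith) (by linarith [hs.2])
      rw [Real.sin_sub_pi] at h2
      linarith
    rw [max_eq_right this, min_eq_left this]
    simp

theorem suspCircle_scalars (w : Circle) :
    (w : ℂ).re ^ 2 + (max (w : ℂ).im 0) ^ 2 + (min (w : ℂ).im 0) ^ 2 = 1 ∧
      max (w : ℂ).im 0 * min (w : ℂ).im 0 = 0 := by
  have hn : (w : ℂ).re * (w : ℂ).re + (w : ℂ).im * (w : ℂ).im = 1 := by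
    rw [← Complex.normSq_apply, Circle.normSq_coe]
  rcases le_total 0 (w : ℂ).im with h | h
  · rw [max_eq_left h, min_eq_right h]
    exact ⟨by nlinarith, mul_zero _⟩
  · rw [max_eq_right h, min_eq_left h]
    exact ⟨by nlinarith, zero_mul _⟩

/-- With a = cos s, p = max(sin s, 0) and q = min(sin s, 0), both products equal a² + (pA + q)².
Since pq = 0 and A² = 1 - T, this is 1 - p²T. -/
theorem suspCircle_mul_par (A T : H →L[ℂ] H) (hA : A * A = 1 - T) (w : Circle) :
    1 - suspCircle A w * suspCirclePar A w = (((max (w : ℂ).im 0) ^ 2 : ℝ) : ℂ) • T ∧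
      1 - suspCirclePar A w * suspCircle A w = (((max (w : ℂ).im 0) ^ 2 : ℝ) : ℂ) • T := by
  obtain ⟨h1, h2⟩ := suspCircle_scalars w
  obtain rfl : T = 1 - A * A := by rw [hA]; abel
  unfold suspCircle suspCirclePar
  generalize (w : ℂ).re = a at *
  generalize max (w : ℂ).im 0 = p at *
  generalize min (w : ℂ).im 0 = q at *
  have h1' : (a : ℂ) * a + p * p + q * q = 1 := by
    rw [← Complex.ofReal_one, ← h1]; push_cast; ring
  have h2' : (p : ℂ) * q = 0 := by exact_mod_cast h2
  have hI := Complex.I_mul_I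
  constructor
  all_goals
    simp only [mul_add, add_mul, mul_sub, sub_mul, smul_mul_smul_comm, mul_one, one_mul, smul_sub]
    push_cast
    match_scalars <;>
      first
      | linear_combination -h1' + q ^ 2 * hI
      | linear_combination 2 * Complex.I ^ 2 * h2'
      | linear_combination p ^ 2 * hI

end Suspension

/-! ### Sections of the Fredholm bundle -/

section Sections

variable {X ι : Type*} [TopologicalSpace X]
variable {H : Type*} [NormedAddCommGroup H] [InnerProductSpace ℂ H]

theorem Fred0.continuous_iff {f : X → Fred0 H} : Continuous f ↔
    (∀ v, Continuous fun x => (f x).op v) ∧ (∀ v, Continuous fun x => (f x).par v) ∧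
      Continuous (fun x => (1 - (f x).op * (f x).par : H →L[ℂ] H)) ∧
      Continuous fun x => (1 - (f x).par * (f x).op : H →L[ℂ] H) := by
  rw [continuous_induced_rng]
  refine continuous_prodMk.trans (and_congr continuous_pi_iff ?_)
  exact continuous_prodMk.trans (and_congr continuous_pi_iff continuous_prodMk)

theorem one_sub_mul_lerp (A B C : H →L[ℂ] H) (t : ℝ) :
    1 - A * (((1 - t : ℝ) : ℂ) • B + (t : ℂ) • C) =
      ((1 - t : ℝ) : ℂ) • (1 - A * B) + (t : ℂ) • (1 - A * C) := by
  rw [mul_add, mul_smul_comm, mul_smul_comm]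
  push_cast
  module

theorem one_sub_lerp_mul (A B C : H →L[ℂ] H) (t : ℝ) :
    1 - (((1 - t : ℝ) : ℂ) • B + (t : ℂ) • C) * A =
      ((1 - t : ℝ) : ℂ) • (1 - B * A) + (t : ℂ) • (1 - C * A) := by
  rw [add_mul, smul_mul_assoc, smul_mul_assoc]
  push_cast
  module

/-- The convex combinations of two parametrices of the same operator are parametrices. -/
def Fred0.lerp (S T : Fred0 H) (h : S.op = T.op) (t : ℝ) : Fred0 H where
  op := S.op
  par := ((1 - t : ℝ) : ℂ) • S.par + (t : ℂ) • T.par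
  compact_right := by
    rw [one_sub_mul_lerp]
    nth_rw 2 [h]
    exact (S.compact_right.smul _).add (T.compact_right.smul _)
  compact_left := by
    rw [one_sub_lerp_mul]
    nth_rw 2 [h]
    exact (S.compact_left.smul _).add (T.compact_left.smul _)

theorem Fred0.continuous_lerp {S T : X → Fred0 H} {t : X → ℝ} (hS : Continuous S)
    (hT : Continuous T) (h : ∀ x, (S x).op = (T x).op) (ht : Continuous t) :
    Continuous fun x => (S x).lerp (T x) (h x) (t x) := by
  obtain ⟨hS₁, hS₂, hS₃, hS₄⟩ := Fred0.continuous_iff.1 hS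
  obtain ⟨-, hT₂, hT₃, hT₄⟩ := Fred0.continuous_iff.1 hT
  simp only [← h] at hT₃ hT₄
  have h₀ : Continuous fun x => ((1 - t x : ℝ) : ℂ) := by fun_prop
  have h₁ : Continuous fun x => ((t x : ℝ) : ℂ) := by fun_prop
  refine Fred0.continuous_iff.2 ⟨hS₁, fun v => (h₀.smul (hS₂ v)).add (h₁.smul (hT₂ v)), ?_, ?_⟩
  · refine ((h₀.smul hS₃).add (h₁.smul hT₃)).congr fun x => ?_
    exact (one_sub_mul_lerp _ _ _ _).symm
  · refine ((h₀.smul hS₄).add (h₁.smul hT₄)).congr fun x => ?_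
    exact (one_sub_lerp_mul _ _ _ _).symm

/-- Two sections with the same operator components are homotopic: the homotopy class does not
depend on the parametrices. -/
theorem FredSection.homotopic_of_op_eq {G : Gerbe X ι H} (σ τ : FredSection G)
    (h : ∀ i x, (σ.fam i x).op = (τ.fam i x).op) : σ.Homotopic τ := by
  let pr : ∀ i, (G.pullback (Prod.fst : X × unitInterval → X) continuous_fst).U i → G.U i :=
    fun i y => ⟨y.1.1, y.2⟩
  have hpr : ∀ i, Continuous (pr i) := fun i =>
    (continuous_fst.comp continuous_subtype_val).subtype_mk _
  refine ⟨{
    fam := fun i y => (σ.fam i (pr i y)).lerp (τ.fam i (pr i y)) (h i _) y.1.2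
    continuous_fam := fun i => Fred0.continuous_lerp ((σ.continuous_fam i).comp (hpr i))
      ((τ.continuous_fam i).comp (hpr i)) _
      (continuous_subtype_val.comp (continuous_snd.comp continuous_subtype_val))
    op_glue := fun i j x hi hj v => σ.op_glue i j x.1 hi hj v
    par_glue := fun i j x hi hj v => ?_ }, ?_, ?_⟩
  · have h₁ := σ.par_glue i j x.1 hi hj v
    have h₂ := τ.par_glue i j x.1 hi hj v
    change ((1 - (x.2 : ℝ) : ℝ) : ℂ) • (σ.fam j ⟨x.1, hj⟩).par (G.trans i j x.1 v) +
        ((x.2 : ℝ) : ℂ) • (τ.fam j ⟨x.1, hj⟩).par (G.trans i j x.1 v) =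
      G.trans i j x.1 (((1 - (x.2 : ℝ) : ℝ) : ℂ) • (σ.fam i ⟨x.1, hi⟩).par v +
        ((x.2 : ℝ) : ℂ) • (τ.fam i ⟨x.1, hi⟩).par v)
    rw [h₁, h₂, map_add, map_smul, map_smul]
  · intro i x hx
    apply Fred0.ext
    · rfl
    · simp [Fred0.lerp, pr]
  · intro i x hx
    apply Fred0.ext
    · exact h i _
    · simp [Fred0.lerp, pr]

end Sections

/-! ### The suspended supercharge family -/

theorem boundedSupercharge_mul_self (r : ℕ) (x : ℝ) :
    boundedSupercharge r x * boundedSupercharge r x = 1 - dampOp r x * dampOp r x := by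
  ext1 u
  exact boundedSupercharge_sq r x u

/-- The suspension of the bounded transform of the supercharge, with its parametrix. -/
def suspFred (r : ℕ) (w : Circle) (x : ℝ) : Fred0 (Hil r) where
  op := suspCircle (boundedSupercharge r x) w
  par := suspCirclePar (boundedSupercharge r x) w
  compact_right := by
    rw [(suspCircle_mul_par _ _ (boundedSupercharge_mul_self r x) w).1]
    exact (isCompactOperator_dampOp_sq r x).smul (((max (w : ℂ).im 0) ^ 2 : ℝ) : ℂ)
  compact_left := by
    rw [(suspCircle_mul_par _ _ (boundedSupercharge_mul_self r x) w).2]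
    exact (isCompactOperator_dampOp_sq r x).smul (((max (w : ℂ).im 0) ^ 2 : ℝ) : ℂ)

/-- The loop and its parametrix need only strong continuity of F. Their defects involve just T² and
a continuous scalar, so they are norm continuous. -/
theorem continuous_suspFred (r : ℕ) :
    Continuous fun p : Circle × ℝ => suspFred r p.1 p.2 := by
  have hF : ∀ u : Hil r, Continuous fun p : Circle × ℝ => boundedSupercharge r p.2 u := fun u =>
    (continuous_boundedSupercharge_apply r u).comp continuous_snd
  have hT : Continuous fun p : Circle × ℝ =>
      (dampOp r p.2 * dampOp r p.2 : Hil r →L[ℂ] Hil r) :=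
    (continuous_dampOp_sq r).comp continuous_snd
  have hw : Continuous fun p : Circle × ℝ => (p.1 : ℂ) :=
    continuous_subtype_val.comp continuous_fst
  have hre : Continuous fun p : Circle × ℝ => (((p.1 : ℂ).re : ℝ) : ℂ) := by fun_prop
  have hmax : Continuous fun p : Circle × ℝ => Complex.I * ((max (p.1 : ℂ).im 0 : ℝ) : ℂ) := by
    fun_prop
  have hmin : Continuous fun p : Circle × ℝ => Complex.I * ((min (p.1 : ℂ).im 0 : ℝ) : ℂ) := by
    fun_prop
  have hsq : Continuous fun p : Circle × ℝ => (((max (p.1 : ℂ).im 0) ^ 2 : ℝ) : ℂ) := by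
    fun_prop
  refine Fred0.continuous_iff.2 ⟨fun v => ?_, fun v => ?_, ?_, ?_⟩
  · exact ((hre.smul continuous_const).add (hmax.smul (hF v))).add (hmin.smul continuous_const)
  · exact ((hre.smul continuous_const).sub (hmax.smul (hF v))).sub (hmin.smul continuous_const)
  · refine (hsq.smul hT).congr fun p => ?_
    exact (suspCircle_mul_par _ _ (boundedSupercharge_mul_self r p.2) p.1).1.symm
  · refine (hsq.smul hT).congr fun p => ?_
    exact (suspCircle_mul_par _ _ (boundedSupercharge_mul_self r p.2) p.1).2.symm

theorem suspFred_op_fockTrans (r : ℕ) (w : Circle) (x : ℝ) (c : ℤ) (g : Circle)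
    (h : unitary (Fib r →L[ℂ] Fib r)) (v : Hil r) :
    (suspFred r w (x - 2 * Real.pi * c)).op (fockTrans r c g h v) =
      fockTrans r c g h ((suspFred r w x).op v) := by
  simp only [suspFred, suspCircle, add_apply, smul_apply, one_apply_eq_self, map_add,
    map_smul, boundedSupercharge_fockTrans]

theorem suspFred_par_fockTrans (r : ℕ) (w : Circle) (x : ℝ) (c : ℤ) (g : Circle)
    (h : unitary (Fib r →L[ℂ] Fib r)) (v : Hil r) :
    (suspFred r w (x - 2 * Real.pi * c)).par (fockTrans r c g h v) =
      fockTrans r c g h ((suspFred r w x).par v) := by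
  simp only [suspFred, suspCirclePar, sub_apply, smul_apply, one_apply_eq_self, map_sub,
    map_smul, boundedSupercharge_fockTrans]

theorem continuous_suspFred_angle (r : ℕ) {δ : ℝ} (hδ : δ ≤ 1) (s : Side) {X : Type*}
    [TopologicalSpace X] {w z : X → Circle} (hw : Continuous w) (hz : Continuous z)
    (h : ∀ x, z x ∈ arc δ s) : Continuous fun x => suspFred r (w x) (angle s (z x)) := by
  have ha : Continuous fun x => (w x, angle s (z x)) :=
    hw.prodMk ((continuousOn_angle hδ s).comp_continuous hz h)
  exact Continuous.comp (f := fun x => (w x, angle s (z x)))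
    (g := fun p : Circle × ℝ => suspFred r p.1 p.2) (continuous_suspFred r) ha

/-- The section of the Fredholm bundle given by the suspended supercharge family. -/
def suspSection {M I : Type*} [TopologicalSpace M] {r : ℕ} {U : I → Set M}
    (hU : ∀ a, IsOpen (U a)) (hcov : ∀ p, ∃ a, p ∈ U a)
    (lam : CechCocycle U Circle) (xi : CechCocycle U (unitary (Fib r →L[ℂ] Fib r)))
    {δ : ℝ} (hδ₀ : 0 < δ) (hδ₁ : δ ≤ 1) :
    FredSection ((fockGerbe hU hcov lam xi hδ₀ hδ₁).pullback
      (Prod.snd : Circle × (Circle × M) → Circle × M) continuous_snd) where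
  fam i x := suspFred r x.1.1 (angle i.1 x.1.2.1)
  continuous_fam i := continuous_suspFred_angle r hδ₁ i.1 continuous_subtype_val.fst
    continuous_subtype_val.snd.fst fun x => x.2.1
  op_glue i j x hi hj v := by
    have h := suspFred_op_fockTrans r x.1 (angle i.1 x.2.1) (winding i.1 j.1 x.2.1)
      (lam.g i.2 j.2 x.2.2) (xi.g i.2 j.2 x.2.2) v
    rw [← angle_eq_sub_winding hδ₁ i.1 j.1 x.2.1 hi.1 hj.1] at h
    exact h
  par_glue i j x hi hj v := by
    have h := suspFred_par_fockTrans r x.1 (angle i.1 x.2.1) (winding i.1 j.1 x.2.1)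
      (lam.g i.2 j.2 x.2.2) (xi.g i.2 j.2 x.2.2) v
    rw [← angle_eq_sub_winding hδ₁ i.1 j.1 x.2.1 hi.1 hj.1] at h
    exact h

theorem exists_circleExp_eq (w : Circle) : ∃ s ∈ Set.Icc 0 (2 * Real.pi), Circle.exp s = w := by
  have h₁ := Complex.neg_pi_lt_arg (w : ℂ)
  have h₂ := Complex.arg_le_pi (w : ℂ)
  rcases le_or_gt 0 (Complex.arg w) with h | h
  · exact ⟨Complex.arg w, ⟨h, by linarith⟩, Circle.exp_arg w⟩
  · exact ⟨Complex.arg w + 2 * Real.pi, ⟨by linarith, by linarith⟩, by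
      rw [Circle.exp_add, Circle.exp_two_pi, mul_one, Circle.exp_arg]⟩

end TwistedK

/-! ### The main theorem -/

theorem proposition3 {d : ℕ} {M : Type*} [TopologicalSpace M] [T2Space M] [CompactSpace M]
    [ChartedSpace (EuclideanSpace ℝ (Fin d)) M] [IsManifold (𝓡 d) ∞ M]
    {I : Type*} {U : I → Set M} (hU : ∀ a, IsOpen (U a)) (hcov : ∀ p, ∃ a, p ∈ U a)
    {r : ℕ} [NeZero r] (lam : TwistedK.CechCocycle U Circle)
    (xi : TwistedK.CechCocycle U (unitary (TwistedK.Fib r →L[ℂ] TwistedK.Fib r)))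
    {δ : ℝ} (hδ₀ : 0 < δ) (hδ₁ : δ ≤ 1) :
    (∀ x : ℝ, IsSelfAdjoint (TwistedK.supercharge r x) ∧
      ∃! F, TwistedK.IsApproxSign (TwistedK.supercharge r x) F) ∧
    ∃! κ : TwistedK.K0 ((TwistedK.fockGerbe hU hcov lam xi hδ₀ hδ₁).pullback
        (Prod.snd : Circle × (Circle × M) → Circle × M) continuous_snd),
      ∃ σ, TwistedK.K0.mk σ = κ ∧
        ∀ (i : TwistedK.Side × I) (s : ℝ), s ∈ Set.Icc 0 (2 * Real.pi) →
          ∀ (z : Circle) (p : M) (h : z ∈ TwistedK.arc δ i.1 ∧ p ∈ U i.2),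
            (σ.fam i ⟨(Circle.exp s, (z, p)), h⟩).op =
              TwistedK.susp
                (TwistedK.approxSign (TwistedK.supercharge r (TwistedK.angle i.1 z))) s := by
  refine ⟨fun x => ⟨TwistedK.supercharge_isSelfAdjoint r x, _,
    TwistedK.isApproxSign_supercharge r x, fun F hF => TwistedK.eq_boundedSupercharge r x hF⟩, ?_⟩
  have hsusp : ∀ (i : TwistedK.Side × I) (s : ℝ), s ∈ Set.Icc 0 (2 * Real.pi) →
      ∀ (z : Circle) (p : M) (h : z ∈ TwistedK.arc δ i.1 ∧ p ∈ U i.2),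
        ((TwistedK.suspSection hU hcov lam xi hδ₀ hδ₁).fam i ⟨(Circle.exp s, (z, p)), h⟩).op =
          TwistedK.susp
            (TwistedK.approxSign (TwistedK.supercharge r (TwistedK.angle i.1 z))) s := by
    intro i s hs z p h
    rw [TwistedK.approxSign_supercharge]
    exact TwistedK.suspCircle_exp _ hs
  refine ⟨TwistedK.K0.mk (TwistedK.suspSection hU hcov lam xi hδ₀ hδ₁), ⟨_, rfl, hsusp⟩, ?_⟩
  rintro _ ⟨σ, rfl, hσ⟩
  -- The prescribed values for s in [0, 2π] cover the whole circle, so they fix the operator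
  -- components everywhere, and only the parametrices can differ.
  refine Quot.sound (TwistedK.FredSection.homotopic_of_op_eq _ _ ?_)
  rintro i ⟨⟨w, z, p⟩, h⟩
  obtain ⟨s, hs, rfl⟩ := TwistedK.exists_circleExp_eq w
  exact (hσ i s hs z p h).trans (hsusp i s hs z p h).symm

end
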